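/- Let $\Sigma\subset\mathbb{R}^2$ be a compact (embedded) $C^2$ curve with nowhere vanishing curvature, that is, a regular simple $C^2$ arc including its endpoints or a regular simple closed $C^2$ curve; let $\mu$ be the arc length measure on $\Sigma$, $n(\xi)$ a unit normal to $\Sigma$ at $\xi\in\Sigma$, and for $f\in\mathcal{S}(\mathbb{R}^2)$ put $$E_\Sigma f(x)=\int_\Sigma f(\xi)\,e^{2\pi i\xi\cdot x}\,d\mu(\xi),\qquad x\in\mathbb{R}^2 .$$ Let $\omega\in\mathbb{S}^1$ and $p,q\in[1,\infty]$ (with $1/\infty=0$). For $g\ge 0$ let $\mathcal{R}g(\omega,t)=\int_{\{x\cdot\omega=t\}}g\,d\lambda_{\omega,t}$, where $\lambda_{\omega,t}$ is Lebesgue measure on the line $\{x\cdot\omega=t\}$. Consider the two estimates (S) there is a constant $C<\infty$ such that $\|E_\Sigma f\|_{L^q(\{x:\,|x\cdot\omega-t|\le 1/2\})}\le C\,\|f\|_{L^p(\Sigma,\mu)}$ for all $f\in\mathcal{S}(\mathbb{R}^2)$ and all $t\in\mathbb{R}$; (R) there is a constant $C<\infty$ such that $\big(\mathcal{R}(|E_\Sigma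 f|^q)(\omega,t)\big)^{1/q}\le C\,\|f\|_{L^p(\Sigma,\mu)}$ for all $f\in\mathcal{S}(\mathbb{R}^2)$ and all $t\in\mathbb{R}$, where for $q=\infty$ the left-hand side is the essential supremum of $|E_\Sigma f|$ on the line $\{x\cdot\omega=t\}$. (a) (Transversal case) If $n(\xi)\cdot\omega\ne 0$ for all $\xi\in\Sigma$, then (S) holds if and only if $\frac1p+\frac1q\le 1$ and $q\ge 2$, and (R) holds if and only if the same condition is satisfied. (b) (Non-transversal case) If $n(\xi)\cdot\omega=0$ for some $\xi\in\Sigma$, then (S) holds if and only if $$\begin{cases}\frac1p+\frac2q\le 1 & \text{if } p\le q,\\[2pt] \frac1p+\frac2q<1 & \text{if } p>q,\end{cases}$$ and (R) holds if and only if the same condition is satisfied. In both cases the same characterization holds for the estimate (S) on a single strip, that is, with $t\in\mathbb{R}$ fixed. -/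

import Mathlib

open scoped ENNReal NNReal

noncomputable section

/-- The Euclidean plane. -/
abbrev Plane : Type := EuclideanSpace ℝ (Fin 2)

/-- Counterclockwise rotation by a right angle. -/
def rot (v : Plane) : Plane := !₂[-(v 1), v 0]

/-- A compact embedded `C²` curve in the plane, given by a regular parametrization on `[a, b]`:
either a simple arc with its endpoints, or a simple closed curve. (A map that is `C²` on `[a, b]`
up to the endpoints extends to a `C²` map on the line, so nothing is lost by taking `γ` to be `C²`
on all of `ℝ`; nothing is asked of an arc outside `[a, b]`.) -/
structure CompactC2Curve where
  γ : ℝ → Plane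
  a : ℝ
  b : ℝ
  lt : a < b
  contDiff : ContDiff ℝ 2 γ
  regular : ∀ s ∈ Set.Icc a b, deriv γ s ≠ 0
  simple : Set.InjOn γ (Set.Icc a b) ∨
    (Function.Periodic γ (b - a) ∧ Set.InjOn γ (Set.Ico a b))

namespace CompactC2Curve

/-- The signed curvature `det(γ', γ'') / |γ'|³` at the point `γ s`. -/
def curvature (Γ : CompactC2Curve) (s : ℝ) : ℝ :=
  (deriv Γ.γ s 0 * deriv (deriv Γ.γ) s 1 - deriv Γ.γ s 1 * deriv (deriv Γ.γ) s 0)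
    / ‖deriv Γ.γ s‖ ^ 3

/-- The unit normal vector at the point `γ s`. -/
def normal (Γ : CompactC2Curve) (s : ℝ) : Plane :=
  ‖deriv Γ.γ s‖⁻¹ • rot (deriv Γ.γ s)

/-- The transversality condition: `n(ξ) · ω ≠ 0` for all points `ξ = γ s` of the curve. -/
def Transversal (Γ : CompactC2Curve) (ω : Plane) : Prop :=
  ∀ s ∈ Set.Icc Γ.a Γ.b, inner ℝ (Γ.normal s) ω ≠ 0

/-- The arc length measure on the curve, as a measure on the plane: the image under `γ` of
`|γ'(s)| ds` on `[a, b]`. -/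
def arcLength (Γ : CompactC2Curve) : MeasureTheory.Measure Plane :=
  ((MeasureTheory.volume.restrict (Set.Icc Γ.a Γ.b)).withDensity
    (fun s => ‖deriv Γ.γ s‖ₑ)).map Γ.γ

/-- The Fourier extension operator `E f(x) = ∫ f(ξ) e^{2π i ξ·x} dμ(ξ)`. -/
def extension (Γ : CompactC2Curve) (f : Plane → ℂ) (x : Plane) : ℂ :=
  ∫ ξ, f ξ * Complex.exp (2 * Real.pi * Complex.I * (inner ℝ ξ x : ℝ)) ∂Γ.arcLength

end CompactC2Curve

/-- The strip `{x : |x · ω - t| ≤ 1/2}` of unit width. -/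
def strip (ω : Plane) (t : ℝ) : Set Plane := {x | |inner ℝ x ω - t| ≤ 1 / 2}

/-- Lebesgue measure on the line `{x : x · ω = t}`, for a unit vector `ω`. -/
def lineMeasure (ω : Plane) (t : ℝ) : MeasureTheory.Measure Plane :=
  (MeasureTheory.volume : MeasureTheory.Measure ℝ).map (fun s => t • ω + s • rot ω)

/-- The Radon transform of a nonnegative function. -/
def radon (g : Plane → ℝ≥0∞) (ω : Plane) (t : ℝ) : ℝ≥0∞ := ∫⁻ x, g x ∂(lineMeasure ω t)

/-- `(R(|F|^q)(ω, t))^{1/q}`, understood as the essential supremum of `|F|` on the line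
if `q = ∞`. -/
def radonRoot (F : Plane → ℂ) (q : ℝ≥0∞) (ω : Plane) (t : ℝ) : ℝ≥0∞ :=
  if q = ∞ then essSup (fun x => ‖F x‖ₑ) (lineMeasure ω t)
  else (radon (fun x => ‖F x‖ₑ ^ q.toReal) ω t) ^ (1 / q.toReal)

/-- The extension estimate on the single strip `{|x · ω - t| ≤ 1/2}`. -/
def StripEstimateAt (Γ : CompactC2Curve) (ω : Plane) (p q : ℝ≥0∞) (t : ℝ) : Prop :=
  ∃ C : ℝ≥0, ∀ f : SchwartzMap Plane ℂ,
    MeasureTheory.eLpNorm (Γ.extension f) q (MeasureTheory.volume.restrict (strip ω t))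
      ≤ C * MeasureTheory.eLpNorm f p Γ.arcLength

/-- The extension estimate on the strips `{|x · ω - t| ≤ 1/2}`, uniformly in `t`. -/
def StripEstimate (Γ : CompactC2Curve) (ω : Plane) (p q : ℝ≥0∞) : Prop :=
  ∃ C : ℝ≥0, ∀ (f : SchwartzMap Plane ℂ) (t : ℝ),
    MeasureTheory.eLpNorm (Γ.extension f) q (MeasureTheory.volume.restrict (strip ω t))
      ≤ C * MeasureTheory.eLpNorm f p Γ.arcLength

/-- The Radon transform estimate, uniformly in `t`. -/
def RadonEstimate (Γ : CompactC2Curve) (ω : Plane) (p q : ℝ≥0∞) : Prop :=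
  ∃ C : ℝ≥0, ∀ (f : SchwartzMap Plane ℂ) (t : ℝ),
    radonRoot (Γ.extension f) q ω t ≤ C * MeasureTheory.eLpNorm f p Γ.arcLength

end

open MeasureTheory Set Filter Topology FourierTransform

/-! ### Plancherel's theorem for the integral Fourier transform -/

theorem enorm_fourier_le_lintegral (g : ℝ → ℂ) (u : ℝ) : ‖𝓕 g u‖ₑ ≤ ∫⁻ s, ‖g s‖ₑ := by
  rw [Real.fourier_eq]
  refine (enorm_integral_le_lintegral_enorm _).trans_eq ?_
  refine lintegral_congr fun s => ?_
  rw [← ofReal_norm, ← ofReal_norm, Circle.norm_smul]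

theorem continuous_fourier_of_integrable {g : ℝ → ℂ} (hg : Integrable g) : Continuous (𝓕 g) :=
  VectorFourier.fourierIntegral_continuous Real.continuous_fourierChar
    (by exact continuous_inner) hg

/-- Both sides are locally integrable and pair equally with smooth compactly supported functions. In
each pairing the transform can be moved onto the test function: for the L² transform by its
compatibility with tempered distributions, for the integral by Fubini. -/
theorem fourier_toLp_two_ae_eq {g : ℝ → ℂ} (hg : Integrable g) (hg2 : MemLp g 2) :
    (𝓕 (hg2.toLp g) : Lp ℂ 2 (volume : Measure ℝ)) =ᵐ[volume] 𝓕 g := by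
  have hc := continuous_fourier_of_integrable hg
  rw [← sub_ae_eq_zero]
  refine ae_eq_zero_of_integral_contDiff_smul_eq_zero ?_ ?_
  · exact ((Lp.memLp _).locallyIntegrable (by norm_num)).sub hc.locallyIntegrable
  · intro φ hφ hφc
    have hφ₁ : HasCompactSupport (Complex.ofRealCLM ∘ φ) := hφc.comp_left rfl
    have hφ₂ : ContDiff ℝ ((⊤ : ℕ∞) : WithTop ℕ∞) (Complex.ofRealCLM ∘ φ) := by fun_prop
    set ψ := hφ₁.toSchwartzMap hφ₂ with hψ
    have key := DFunLike.congr_fun (Lp.fourier_toTemperedDistribution_eq (hg2.toLp g)) ψ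
    rw [TemperedDistribution.fourier_apply, Lp.toTemperedDistribution_apply,
      Lp.toTemperedDistribution_apply] at key
    have h1 : ∫ x, (𝓕 ψ) x • (hg2.toLp g) x = ∫ x, ψ x • 𝓕 g x := by
      have e := VectorFourier.integral_fourierIntegral_smul_eq_flip (L := innerₗ ℝ)
        Real.continuous_fourierChar continuous_inner (ψ.integrable (μ := volume)) (hg : Integrable g)
      rw [flip_innerₗ] at e
      refine Eq.trans ?_ e
      refine integral_congr_ae ?_
      filter_upwards [hg2.coeFn_toLp] with x hx
      rw [hx]; rfl
    rw [h1] at key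
    have i1 : Integrable fun x => φ x • (𝓕 (hg2.toLp g) : Lp ℂ 2 (volume : Measure ℝ)) x :=
      ((Lp.memLp _).locallyIntegrable (by norm_num)).integrable_smul_left_of_hasCompactSupport
        hφ.continuous hφc
    have i2 : Integrable fun x => φ x • 𝓕 g x :=
      hc.locallyIntegrable.integrable_smul_left_of_hasCompactSupport hφ.continuous hφc
    simp only [Pi.sub_apply, smul_sub]
    rw [integral_sub i1 i2, sub_eq_zero]
    simpa [hψ] using key.symm

/-- Plancherel's theorem for functions in `L¹ ∩ L²`. -/
theorem lintegral_enorm_fourier_sq {g : ℝ → ℂ} (hg : Integrable g) (hg2 : MemLp g 2) :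
    ∫⁻ u, ‖𝓕 g u‖ₑ ^ (2 : ℝ) = ∫⁻ s, ‖g s‖ₑ ^ (2 : ℝ) := by
  have h1 : eLpNorm (𝓕 g) 2 volume = eLpNorm g 2 volume := by
    rw [← eLpNorm_congr_ae (fourier_toLp_two_ae_eq hg hg2), ← eLpNorm_congr_ae hg2.coeFn_toLp]
    have := Lp.norm_fourier_eq (hg2.toLp g)
    rw [Lp.norm_def, Lp.norm_def] at this
    exact (ENNReal.toReal_eq_toReal_iff' (Lp.memLp _).2.ne (Lp.memLp _).2.ne).1 this
  rw [eLpNorm_eq_lintegral_rpow_enorm_toReal (by norm_num) (by norm_num),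
    eLpNorm_eq_lintegral_rpow_enorm_toReal (by norm_num) (by norm_num)] at h1
  simpa using ENNReal.rpow_left_injective (x := 1 / (2 : ℝ)) (by norm_num)
    (by simpa using h1)

/-! ### The Hausdorff–Young inequality by real interpolation -/

theorem fourier_indicator_add_compl {g : ℝ → ℂ} (hg : Integrable g) {A : Set ℝ}
    (hA : MeasurableSet A) (u : ℝ) :
    𝓕 g u = 𝓕 (A.indicator g) u + 𝓕 (Aᶜ.indicator g) u := by
  have h := VectorFourier.fourierIntegral_add (μ := volume) (L := innerₗ ℝ)
    Real.continuous_fourierChar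
    (by exact continuous_inner) (hg.indicator hA) (hg.indicator hA.compl)
  rw [indicator_self_add_compl] at h
  exact congrFun h u

theorem lintegral_enorm_indicator_rpow (g : ℝ → ℂ) {A : Set ℝ} (hA : MeasurableSet A) {r : ℝ}
    (hr : 0 < r) : ∫⁻ x, ‖A.indicator g x‖ₑ ^ r = ∫⁻ x in A, ‖g x‖ₑ ^ r := by
  rw [← lintegral_indicator hA]
  refine lintegral_congr fun x => ?_
  by_cases hx : x ∈ A <;> simp [hx, hr]

theorem enorm_rpow_eq_ofReal (z : ℂ) {r : ℝ} (hr : 0 ≤ r) :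
    ‖z‖ₑ ^ r = ENNReal.ofReal (‖z‖ ^ r) := by
  rw [← ofReal_norm, ENNReal.ofReal_rpow_of_nonneg (norm_nonneg _) hr]

/-- Chebyshev's inequality combined with Plancherel's theorem, for the part of `g` on `A`. -/
theorem meas_lt_norm_fourier_indicator_mul_le {g : ℝ → ℂ} (hg : Integrable g) (hg2 : MemLp g 2)
    {A : Set ℝ} (hA : MeasurableSet A) {w : ℝ → ℝ} (hw : Measurable w) {t : ℝ} (ht : 0 < t) :
    (volume.withDensity fun u => ENNReal.ofReal (w u ^ (-2 : ℝ)))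
        {u | t / 2 < ‖𝓕 (A.indicator g) u‖ * w u} ≤
      ENNReal.ofReal (4 * t ^ (-2 : ℝ)) * ∫⁻ x in A, ‖g x‖ₑ ^ (2 : ℝ) := by
  have hc := continuous_fourier_of_integrable (hg.indicator hA)
  have hm : MeasurableSet {u | t / 2 < ‖𝓕 (A.indicator g) u‖ * w u} :=
    measurableSet_lt measurable_const (hc.norm.measurable.mul hw)
  rw [withDensity_apply _ hm, ← lintegral_enorm_indicator_rpow g hA two_pos,
    ← lintegral_enorm_fourier_sq (hg.indicator hA) (hg2.indicator hA), ← lintegral_indicator hm,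
    ← lintegral_const_mul _ (by fun_prop)]
  refine lintegral_mono fun u => ?_
  by_cases hu : u ∈ {u | t / 2 < ‖𝓕 (A.indicator g) u‖ * w u}
  · rw [indicator_of_mem hu, enorm_rpow_eq_ofReal _ two_pos.le,
      ← ENNReal.ofReal_mul (by positivity)]
    refine ENNReal.ofReal_le_ofReal ?_
    have hu' : t / 2 < ‖𝓕 (A.indicator g) u‖ * w u := hu
    set N := ‖𝓕 (A.indicator g) u‖
    have hN : 0 ≤ N := norm_nonneg _
    have hw0 : 0 < w u := by
      by_contra h
      nlinarith [mul_nonneg hN (neg_nonneg.2 (not_lt.1 h))]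
    rw [Real.rpow_neg hw0.le, Real.rpow_neg ht.le, Real.rpow_two, Real.rpow_two, Real.rpow_two,
      mul_assoc, inv_mul_eq_div, ← mul_div_assoc, inv_eq_one_div, div_le_div_iff₀ (by positivity)
      (by positivity)]
    nlinarith
  · rw [indicator_of_notMem hu]; exact zero_le

/-- The Hausdorff–Young inequality (with a non-sharp constant). -/
theorem exists_lintegral_enorm_fourier_rpow_le {r q : ℝ} (hrq : r.HolderConjugate q)
    (hr2 : r < 2) :
    ∃ C : ℝ≥0, ∀ g : ℝ → ℂ, Measurable g → Integrable g → MemLp g 2 →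
      ∫⁻ u, ‖𝓕 g u‖ₑ ^ q ≤ C * (∫⁻ s, ‖g s‖ₑ ^ r) ^ (q / r) := by
  have hr1 : 1 < r := hrq.lt
  have hr0 : 0 < r := hrq.pos
  have hq0 : 0 < q := hrq.symm.pos
  have hq2 : 2 < q := by
    have := hrq.mul_eq_add
    nlinarith
  have hqr : q / r = q - 2 + 1 := by
    rw [div_eq_iff hr0.ne']; linarith [hrq.mul_eq_add]
  have hm : 0 < q - 2 := by linarith
  refine ⟨Real.toNNReal (q * 4 * (q - 2)⁻¹ * 2 ^ (q - 2)), fun g hgm hg hg2 => ?_⟩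
  set I := ∫⁻ s, ‖g s‖ₑ ^ r with hI
  have hC : 0 < q * 4 * (q - 2)⁻¹ * 2 ^ (q - 2) := by positivity
  rcases eq_or_ne I ∞ with hItop | hItop
  · rw [hItop, ENNReal.top_rpow_of_pos (by positivity), ENNReal.mul_top]
    · exact le_top
    · simpa using hC
  rcases eq_or_ne I 0 with hI0 | hI0
  · have hz : g =ᵐ[volume] 0 := by
      have := (lintegral_eq_zero_iff (by fun_prop)).1 (hI ▸ hI0)
      filter_upwards [this] with x hx
      simpa [hr0, hr0.not_gt] using hx
    have hz' : ∀ u, 𝓕 g u = 0 := fun u => by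
      rw [Real.fourier_eq]
      refine integral_eq_zero_of_ae ?_
      filter_upwards [hz] with x hx
      simp [hx]
    simp [hz', hq0]
  set A := I.toReal with hA
  have hA0 : 0 < A := ENNReal.toReal_pos hI0 hItop
  have hIA : I = ENNReal.ofReal A := (ENNReal.ofReal_toReal hItop).symm
  -- At level t the function is cut where `Λ` crosses t. Where `Λ x < t` and g is nonzero, |g|^{r-1}
  -- > 2A/t, so this part has L¹ norm at most (t/2A)·A = t/2. Its transform never exceeds t/2, and
  -- only the part with `t ≤ Λ x`, controlled by Plancherel, matters for the level set. At zeros of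
  -- g the convention for powers of 0 gives `Λ x = 0`, which is harmless.
  set Λ : ℝ → ℝ := fun x => 2 * A * ‖g x‖ ^ (-(r - 1)) with hΛ
  have hΛm : Measurable Λ := by fun_prop
  have hΛ0 : ∀ x, 0 ≤ Λ x := fun x => by positivity
  have hB : ∀ t, MeasurableSet {x | t ≤ Λ x} := fun t => measurableSet_le measurable_const hΛm
  have hlevel : ∀ t : ℝ, 0 < t → volume {u | t < ‖𝓕 g u‖} ≤
      ENNReal.ofReal (4 * t ^ (-2 : ℝ)) * ∫⁻ x in {x | t ≤ Λ x}, ‖g x‖ₑ ^ (2 : ℝ) := by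
    intro t ht
    have h := meas_lt_norm_fourier_indicator_mul_le hg hg2 (hB t)
      (measurable_const (a := (1 : ℝ))) ht
    simp only [Real.one_rpow, ENNReal.ofReal_one, mul_one] at h
    rw [show (fun _ : ℝ => (1 : ℝ≥0∞)) = 1 from rfl, withDensity_one] at h
    refine (measure_mono ?_).trans h
    intro u hu
    have hu' : t < ‖𝓕 g u‖ := hu
    have hsmall : ‖𝓕 ({x | t ≤ Λ x}ᶜ.indicator g) u‖ ≤ t / 2 := by
      rw [← ENNReal.ofReal_le_ofReal_iff (by positivity), ofReal_norm]
      refine (enorm_fourier_le_lintegral _ u).trans ?_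
      calc ∫⁻ s, ‖{x | t ≤ Λ x}ᶜ.indicator g s‖ₑ
          ≤ ∫⁻ s, ENNReal.ofReal (t / (2 * A)) * ‖g s‖ₑ ^ r := by
            refine lintegral_mono fun s => ?_
            by_cases hs : s ∈ {x | t ≤ Λ x}ᶜ
            · rw [indicator_of_mem hs, enorm_rpow_eq_ofReal _ hr0.le,
                ← ENNReal.ofReal_mul (by positivity), ← ofReal_norm]
              refine ENNReal.ofReal_le_ofReal ?_
              have hs' : Λ s < t := not_le.1 hs
              rcases (norm_nonneg (g s)).eq_or_lt with h0 | h0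
              · rw [← h0]; positivity
              · have e : ‖g s‖ = ‖g s‖ ^ (-(r - 1)) * ‖g s‖ ^ r := by
                  rw [← Real.rpow_add h0]; ring_nf; simp
                conv_lhs => rw [e]
                refine mul_le_mul_of_nonneg_right ?_ (by positivity)
                rw [le_div_iff₀ (by positivity)]
                simp only [hΛ] at hs'
                linarith
            · rw [indicator_of_notMem hs]; simp
        _ = ENNReal.ofReal (t / 2) := by
            rw [lintegral_const_mul _ (by fun_prop), ← hI, hIA,
              ← ENNReal.ofReal_mul (by positivity)]
            congr 1; field_simp
    have := fourier_indicator_add_compl hg (hB t) u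
    have h3 := norm_add_le (𝓕 ({x | t ≤ Λ x}.indicator g) u) (𝓕 ({x | t ≤ Λ x}ᶜ.indicator g) u)
    rw [← this] at h3
    show t / 2 < _
    linarith
  have hc := continuous_fourier_of_integrable hg
  set μ := volume.withDensity fun x => ‖g x‖ₑ ^ (2 : ℝ) with hμ
  have hlayer := lintegral_rpow_eq_lintegral_meas_le_mul μ (ae_of_all _ hΛ0) hΛm.aemeasurable hm
  have hlayer' : ∫⁻ t in Ioi 0, μ {x | t ≤ Λ x} * ENNReal.ofReal (t ^ (q - 2 - 1)) =
      ENNReal.ofReal ((q - 2)⁻¹) * ∫⁻ x, ENNReal.ofReal (Λ x ^ (q - 2)) ∂μ := by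
    rw [hlayer, ← mul_assoc, ← ENNReal.ofReal_mul (by positivity), inv_mul_cancel₀ hm.ne',
      ENNReal.ofReal_one, one_mul]
  -- The powers of |g| add up to 2 - (r-1)(q-2) = r, by conjugacy of r and q.
  have hΛint : ∫⁻ x, ENNReal.ofReal (Λ x ^ (q - 2)) ∂μ ≤ ENNReal.ofReal ((2 * A) ^ (q - 2)) * I := by
    rw [hμ, lintegral_withDensity_eq_lintegral_mul _ (by fun_prop) (by fun_prop), hI,
      ← lintegral_const_mul _ (by fun_prop)]
    refine lintegral_mono fun x => ?_
    simp only [Pi.mul_apply]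
    rw [enorm_rpow_eq_ofReal _ two_pos.le, enorm_rpow_eq_ofReal _ hr0.le,
      ← ENNReal.ofReal_mul (by positivity), ← ENNReal.ofReal_mul (by positivity)]
    refine ENNReal.ofReal_le_ofReal ?_
    rcases (norm_nonneg (g x)).eq_or_lt with h0 | h0
    · rw [← h0, Real.zero_rpow two_ne_zero, zero_mul]; positivity
    · simp only [hΛ]
      rw [Real.mul_rpow (by positivity) (by positivity), ← Real.rpow_mul h0.le, mul_left_comm,
        ← Real.rpow_add h0]
      refine le_of_eq ?_
      congr 2
      linarith [hrq.mul_eq_add]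
  calc ∫⁻ u, ‖𝓕 g u‖ₑ ^ q = ∫⁻ u, ENNReal.ofReal (‖𝓕 g u‖ ^ q) := by
        simp_rw [enorm_rpow_eq_ofReal _ hq0.le]
    _ = ENNReal.ofReal q *
          ∫⁻ t in Ioi 0, volume {u | t < ‖𝓕 g u‖} * ENNReal.ofReal (t ^ (q - 1)) :=
        lintegral_rpow_eq_lintegral_meas_lt_mul _ (ae_of_all _ fun _ => norm_nonneg _)
          hc.norm.measurable.aemeasurable hq0
    _ ≤ ENNReal.ofReal q *
          ∫⁻ t in Ioi 0, ENNReal.ofReal 4 *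
            (μ {x | t ≤ Λ x} * ENNReal.ofReal (t ^ (q - 2 - 1))) := by
        gcongr 1
        refine setLIntegral_mono' measurableSet_Ioi fun t ht => ?_
        have ht' : 0 < t := ht
        refine (mul_le_mul_left (hlevel t ht) _).trans_eq ?_
        rw [hμ, withDensity_apply _ (hB t), mul_right_comm, ← ENNReal.ofReal_mul (by positivity),
          mul_comm (∫⁻ x in {x | t ≤ Λ x}, ‖g x‖ₑ ^ (2 : ℝ)), ← mul_assoc,
          ← ENNReal.ofReal_mul (by positivity), mul_assoc, ← Real.rpow_add ht']
        ring_nf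
    _ = ENNReal.ofReal (q * 4) *
          ∫⁻ t in Ioi 0, μ {x | t ≤ Λ x} * ENNReal.ofReal (t ^ (q - 2 - 1)) := by
        rw [lintegral_const_mul' _ _ ENNReal.ofReal_ne_top, ← mul_assoc,
          ← ENNReal.ofReal_mul hq0.le]
    _ ≤ ENNReal.ofReal (q * 4) * (ENNReal.ofReal ((q - 2)⁻¹) *
          (ENNReal.ofReal ((2 * A) ^ (q - 2)) * I)) := by
        rw [hlayer']; gcongr
    _ = _ := by
        rw [hqr, ENNReal.rpow_add _ _ hI0 hItop, ENNReal.rpow_one, ← mul_assoc, ← mul_assoc,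
          ← mul_assoc]
        congr 1
        rw [hIA, ENNReal.ofReal_rpow_of_pos hA0]
        change _ = ENNReal.ofReal _ * _
        rw [← ENNReal.ofReal_mul (by positivity), ← ENNReal.ofReal_mul (by positivity),
          ← ENNReal.ofReal_mul (by positivity), Real.mul_rpow two_pos.le hA0.le]
        ring_nf

/-! ### Paley's inequality -/

theorem lintegral_Ioi_ofReal_rpow {a c : ℝ} (ha : a < -1) (hc : 0 < c) :
    ∫⁻ x in Ioi c, ENNReal.ofReal (x ^ a) = ENNReal.ofReal (c ^ (a + 1) / (-(a + 1))) := by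
  rw [← ofReal_integral_eq_lintegral_ofReal (integrableOn_Ioi_rpow_of_lt ha hc),
    integral_Ioi_rpow_of_lt ha hc]
  · congr 1
    rw [div_neg, neg_div]
  · refine (ae_restrict_mem measurableSet_Ioi).mono fun x hx => ?_
    exact Real.rpow_nonneg (hc.trans hx).le _

theorem setLIntegral_rpow_neg_two_abs_sub_le (u₀ : ℝ) {c : ℝ} (hc : 0 < c) :
    ∫⁻ u in {u | c < |u - u₀|}, ENNReal.ofReal (|u - u₀| ^ (-2 : ℝ)) ≤ ENNReal.ofReal (2 / c) := by
  have hm : MeasurableSet {u : ℝ | c < |u|} := measurableSet_lt measurable_const (by fun_prop)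
  have hI := lintegral_Ioi_ofReal_rpow (a := -2) (by norm_num) hc
  have hval : c ^ (-2 + 1 : ℝ) / (-(-2 + 1)) = 1 / c := by
    norm_num [Real.rpow_neg_one]
  rw [hval] at hI
  have hpos : ∫⁻ u in Ioi c, ENNReal.ofReal (|u| ^ (-2 : ℝ)) = ENNReal.ofReal (1 / c) := by
    rw [← hI]
    refine setLIntegral_congr_fun measurableSet_Ioi fun u hu => ?_
    simp only [abs_of_pos (hc.trans hu)]
  have hneg : ∫⁻ u in Iio (-c), ENNReal.ofReal (|u| ^ (-2 : ℝ)) = ENNReal.ofReal (1 / c) := by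
    rw [← hpos, ← lintegral_indicator measurableSet_Iio, ← lintegral_indicator measurableSet_Ioi,
      ← lintegral_neg_eq_self]
    refine lintegral_congr fun u => ?_
    by_cases hu : c < u
    · rw [indicator_of_mem (show -u ∈ Iio (-c) from neg_lt_neg hu),
        indicator_of_mem (show u ∈ Ioi c from hu), abs_neg]
    · rw [indicator_of_notMem (by simpa using hu), indicator_of_notMem (by simpa using hu)]
  calc ∫⁻ u in {u | c < |u - u₀|}, ENNReal.ofReal (|u - u₀| ^ (-2 : ℝ))
      = ∫⁻ u, ({u : ℝ | c < |u|}.indicator fun u => ENNReal.ofReal (|u| ^ (-2 : ℝ))) (u - u₀) := by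
        rw [← lintegral_indicator (measurableSet_lt measurable_const (by fun_prop))]
        refine lintegral_congr fun u => ?_
        by_cases hu : c < |u - u₀| <;> simp [indicator, hu]
    _ = ∫⁻ u in {u : ℝ | c < |u|}, ENNReal.ofReal (|u| ^ (-2 : ℝ)) := by
        rw [lintegral_sub_right_eq_self, lintegral_indicator hm]
    _ ≤ ∫⁻ u in Ioi c ∪ Iio (-c), ENNReal.ofReal (|u| ^ (-2 : ℝ)) := by
        refine lintegral_mono_set fun u hu => ?_
        rcases lt_abs.1 (show c < |u| from hu) with h | h
        · exact Or.inl h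
        · exact Or.inr (by simpa using neg_lt_neg h)
    _ ≤ ENNReal.ofReal (1 / c) + ENNReal.ofReal (1 / c) := by
        refine (lintegral_union_le _ _ _).trans ?_
        rw [hpos, hneg]
    _ = ENNReal.ofReal (2 / c) := by
        rw [← ENNReal.ofReal_add (by positivity) (by positivity)]; ring_nf

/-- The weak-type `(1, 1)` bound in Paley's inequality, for the part of `g` on `A`. -/
theorem meas_lt_norm_fourier_indicator_mul_abs_sub_le {g : ℝ → ℂ} (hg : Integrable g)
    {A : Set ℝ} (hA : MeasurableSet A) (u₀ : ℝ) {t : ℝ} (ht : 0 < t) :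
    (volume.withDensity fun u => ENNReal.ofReal (|u - u₀| ^ (-2 : ℝ)))
        {u | t / 2 < ‖𝓕 (A.indicator g) u‖ * |u - u₀|} ≤
      ENNReal.ofReal (4 / t) * ∫⁻ x in A, ‖g x‖ₑ := by
  have hJ : ∫⁻ x, ‖A.indicator g x‖ₑ = ∫⁻ x in A, ‖g x‖ₑ := by
    simpa using lintegral_enorm_indicator_rpow g hA one_pos
  set J := ∫⁻ x in A, ‖g x‖ₑ with hJdef
  have hJtop : J ≠ ∞ := hJ ▸ (hg.indicator hA).2.ne
  have hbd : ∀ u, ‖𝓕 (A.indicator g) u‖ ≤ J.toReal := fun u => by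
    have := enorm_fourier_le_lintegral (A.indicator g) u
    rw [hJ, ← ofReal_norm] at this
    exact (ENNReal.ofReal_le_iff_le_toReal hJtop).1 this
  rcases eq_or_ne J 0 with h0 | h0
  · have : {u | t / 2 < ‖𝓕 (A.indicator g) u‖ * |u - u₀|} = ∅ := by
      ext u
      have h1 := hbd u
      have h2 : ‖𝓕 (A.indicator g) u‖ = 0 := le_antisymm (by simpa [h0] using h1) (norm_nonneg _)
      simp [h2, (half_pos ht).le]
    simp [this]
  have hJ0 : 0 < J.toReal := ENNReal.toReal_pos h0 hJtop
  have hc : 0 < t / (2 * J.toReal) := by positivity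
  -- Since the transform is bounded by its L¹ norm J, the level set lies in the tail |u - u₀| >
  -- t/(2J), and the measure |u - u₀|^{-2} du of this tail is at most 4J/t.
  calc (volume.withDensity fun u => ENNReal.ofReal (|u - u₀| ^ (-2 : ℝ)))
        {u | t / 2 < ‖𝓕 (A.indicator g) u‖ * |u - u₀|}
      ≤ (volume.withDensity fun u => ENNReal.ofReal (|u - u₀| ^ (-2 : ℝ)))
        {u | t / (2 * J.toReal) < |u - u₀|} := by
        refine measure_mono fun u hu => ?_
        have hu' : t / 2 < ‖𝓕 (A.indicator g) u‖ * |u - u₀| := hu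
        have := mul_le_mul_of_nonneg_right (hbd u) (abs_nonneg (u - u₀))
        rw [mem_ofPred_eq, div_lt_iff₀ (by positivity)]
        linarith
    _ ≤ ENNReal.ofReal (2 / (t / (2 * J.toReal))) := by
        rw [withDensity_apply _ (measurableSet_lt measurable_const (by fun_prop))]
        exact setLIntegral_rpow_neg_two_abs_sub_le u₀ hc
    _ = ENNReal.ofReal (4 / t) * J := by
        conv_rhs => rw [← ENNReal.ofReal_toReal hJtop]
        rw [← ENNReal.ofReal_mul (by positivity)]
        congr 1
        field_simp
        ring

/-- The L² half of the Marcinkiewicz argument. By Fubini, for fixed x the variable t runs over t ≥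
|g(x)|, and the integral of t^{r-3} converges at infinity because r < 2, to |g(x)|^{r-2}/(2-r). -/
theorem lintegral_rpow_mul_setLIntegral_sq_le {g : ℝ → ℂ} (hg : Measurable g) {r : ℝ}
    (hr0 : 0 < r) (hr2 : r < 2) :
    ∫⁻ t in Ioi (0 : ℝ), ENNReal.ofReal (t ^ (r - 3)) *
        ∫⁻ x in {x | ‖g x‖ ≤ t}, ‖g x‖ₑ ^ (2 : ℝ) ≤
      ENNReal.ofReal (1 / (2 - r)) * ∫⁻ x, ‖g x‖ₑ ^ r := by
  have hset : MeasurableSet {z : ℝ × ℝ | ‖g z.2‖ ≤ z.1} :=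
    measurableSet_le (by fun_prop) (by fun_prop)
  set K : ℝ → ℝ → ℝ≥0∞ := fun t x => {z : ℝ × ℝ | ‖g z.2‖ ≤ z.1}.indicator
    (fun z => ENNReal.ofReal (z.1 ^ (r - 3)) * ‖g z.2‖ₑ ^ (2 : ℝ)) (t, x) with hK
  have hKm : Measurable (Function.uncurry K) := by
    have : Measurable ({z : ℝ × ℝ | ‖g z.2‖ ≤ z.1}.indicator
      (fun z => ENNReal.ofReal (z.1 ^ (r - 3)) * ‖g z.2‖ₑ ^ (2 : ℝ))) :=
      Measurable.indicator (by fun_prop) hset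
    exact this
  calc ∫⁻ t in Ioi (0 : ℝ), ENNReal.ofReal (t ^ (r - 3)) *
        ∫⁻ x in {x | ‖g x‖ ≤ t}, ‖g x‖ₑ ^ (2 : ℝ)
      = ∫⁻ t in Ioi (0 : ℝ), ∫⁻ x, K t x := by
        refine lintegral_congr fun t => ?_
        rw [← lintegral_const_mul' _ _ ENNReal.ofReal_ne_top,
          ← lintegral_indicator (measurableSet_le hg.norm measurable_const)]
        refine lintegral_congr fun x => ?_
        by_cases hx : ‖g x‖ ≤ t <;> simp [hK, indicator, hx]
    _ = ∫⁻ x, ∫⁻ t in Ioi (0 : ℝ), K t x := lintegral_lintegral_swap hKm.aemeasurable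
    _ ≤ ∫⁻ x, ENNReal.ofReal (1 / (2 - r)) * ‖g x‖ₑ ^ r := by
        refine lintegral_mono fun x => ?_
        rcases (norm_nonneg (g x)).eq_or_lt with h0 | h0
        · have hz : g x = 0 := norm_eq_zero.1 h0.symm
          simp [hK, hz, indicator, hr0]
        · calc ∫⁻ t in Ioi (0 : ℝ), K t x
              ≤ ∫⁻ t in Ici ‖g x‖, ENNReal.ofReal (t ^ (r - 3)) * ‖g x‖ₑ ^ (2 : ℝ) := by
                rw [← lintegral_indicator measurableSet_Ioi, ← lintegral_indicator measurableSet_Ici]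
                refine lintegral_mono fun t => ?_
                by_cases ht : ‖g x‖ ≤ t
                · have h1 : t ∈ Ioi (0 : ℝ) := h0.trans_le ht
                  simp [hK, indicator, ht, h0.trans_le ht]
                · by_cases h1 : 0 < t <;> simp [hK, indicator, ht, h1]
            _ = ENNReal.ofReal (1 / (2 - r)) * ‖g x‖ₑ ^ r := by
                rw [setLIntegral_congr Ioi_ae_eq_Ici.symm, lintegral_mul_const _ (by fun_prop),
                  lintegral_Ioi_ofReal_rpow (by linarith) h0, enorm_rpow_eq_ofReal _ two_pos.le,
                  enorm_rpow_eq_ofReal _ hr0.le, ← ENNReal.ofReal_mul, ← ENNReal.ofReal_mul]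
                · congr 1
                  rw [div_mul_eq_mul_div, ← Real.rpow_add h0]
                  ring_nf
                · exact one_div_nonneg.2 (by linarith)
                · exact div_nonneg (by positivity) (by linarith)
    _ = _ := lintegral_const_mul _ (by fun_prop)

/-- Paley's inequality. -/
theorem exists_lintegral_enorm_fourier_rpow_mul_le {r : ℝ} (hr1 : 1 < r) (hr2 : r < 2) :
    ∃ C : ℝ≥0, ∀ g : ℝ → ℂ, Measurable g → Integrable g → MemLp g 2 → ∀ u₀ : ℝ,
      ∫⁻ u, ‖𝓕 g u‖ₑ ^ r * ENNReal.ofReal (|u - u₀| ^ (r - 2)) ≤ C * ∫⁻ s, ‖g s‖ₑ ^ r := by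
  have hr0 : 0 < r := by linarith
  refine ⟨Real.toNNReal (r * (4 * (r - 1)⁻¹ + 4 * (1 / (2 - r)))), fun g hgm hg hg2 u₀ => ?_⟩
  set I := ∫⁻ s, ‖g s‖ₑ ^ r with hI
  -- With respect to ν, the operator g ↦ |u - u₀| ĝ(u) is of weak type (1, 1) and isometric on L².
  -- Truncation of g at height t interpolates between the two; the factor |u - u₀|^r from the
  -- operator and |u - u₀|^{-2} from ν combine into the weight |u - u₀|^{r-2}.
  set ν := volume.withDensity fun u : ℝ => ENNReal.ofReal (|u - u₀| ^ (-2 : ℝ)) with hν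
  have hc := continuous_fourier_of_integrable hg
  set F : ℝ → ℝ := fun u => ‖𝓕 g u‖ * |u - u₀| with hF
  have hFm : Measurable F := by have := hc.measurable; fun_prop
  have hF0 : ∀ u, 0 ≤ F u := fun u => by positivity
  have hB : ∀ t, MeasurableSet {x | ‖g x‖ ≤ t} := fun t => measurableSet_le hgm.norm measurable_const
  have hcompl : ∀ t, {x | ‖g x‖ ≤ t}ᶜ = {x | t < ‖g x‖} := fun t => by ext; simp
  have hlevel : ∀ t : ℝ, 0 < t → ν {u | t < F u} ≤
      ENNReal.ofReal (4 / t) * (∫⁻ x in {x | t < ‖g x‖}, ‖g x‖ₑ) +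
      ENNReal.ofReal (4 * t ^ (-2 : ℝ)) * ∫⁻ x in {x | ‖g x‖ ≤ t}, ‖g x‖ₑ ^ (2 : ℝ) := by
    intro t ht
    have h1 := meas_lt_norm_fourier_indicator_mul_abs_sub_le hg (hB t).compl u₀ ht
    have h2 := meas_lt_norm_fourier_indicator_mul_le hg hg2 (hB t)
      (w := fun u => |u - u₀|) (by fun_prop) ht
    rw [hcompl] at h1
    refine le_trans ?_ (add_le_add h1 h2)
    refine (measure_mono ?_).trans (measure_union_le _ _)
    intro u hu
    have hu' : t < ‖𝓕 g u‖ * |u - u₀| := hu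
    have h3 := norm_add_le (𝓕 ({x | ‖g x‖ ≤ t}.indicator g) u)
      (𝓕 ({x | ‖g x‖ ≤ t}ᶜ.indicator g) u)
    rw [← fourier_indicator_add_compl hg (hB t) u, hcompl] at h3
    by_contra hcon
    simp only [mem_union, mem_ofPred_eq, not_or, not_lt] at hcon
    have := mul_le_mul_of_nonneg_right h3 (abs_nonneg (u - u₀))
    linarith [add_mul ‖𝓕 ({x | ‖g x‖ ≤ t}.indicator g) u‖
      ‖𝓕 ({x | t < ‖g x‖}.indicator g) u‖ |u - u₀|]
  set μ := volume.withDensity fun x => ‖g x‖ₑ with hμ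
  have hlayer := lintegral_rpow_eq_lintegral_meas_lt_mul μ (ae_of_all _ fun x => norm_nonneg (g x))
    hgm.norm.aemeasurable (sub_pos.2 hr1)
  have hlayer' : ∫⁻ t in Ioi 0, μ {x | t < ‖g x‖} * ENNReal.ofReal (t ^ (r - 1 - 1)) =
      ENNReal.ofReal ((r - 1)⁻¹) * I := by
    have e : ∫⁻ x, ENNReal.ofReal (‖g x‖ ^ (r - 1)) ∂μ = I := by
      rw [hμ, lintegral_withDensity_eq_lintegral_mul _ (by fun_prop) (by fun_prop), hI]
      refine lintegral_congr fun x => ?_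
      rw [Pi.mul_apply, ← enorm_rpow_eq_ofReal _ (by linarith)]
      rcases eq_or_ne (‖g x‖ₑ) 0 with h | h
      · simp [h, hr0]
      · conv_lhs => rw [← ENNReal.rpow_one ‖g x‖ₑ, ← ENNReal.rpow_mul, one_mul,
          ← ENNReal.rpow_add _ _ h (by simp)]
        ring_nf
    rw [← e, hlayer, ← mul_assoc, ← ENNReal.ofReal_mul (inv_nonneg.2 (by linarith)),
      inv_mul_cancel₀ (by linarith), ENNReal.ofReal_one, one_mul]
  calc ∫⁻ u, ‖𝓕 g u‖ₑ ^ r * ENNReal.ofReal (|u - u₀| ^ (r - 2))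
      = ∫⁻ u, ENNReal.ofReal (F u ^ r) ∂ν := by
        rw [hν, lintegral_withDensity_eq_lintegral_mul _ (by fun_prop) (by fun_prop)]
        refine lintegral_congr_ae ?_
        have hne : ∀ᵐ u : ℝ, u ≠ u₀ := by simp [ae_iff]
        filter_upwards [hne] with u hu
        have hpos : 0 < |u - u₀| := abs_pos.2 (sub_ne_zero.2 hu)
        rw [Pi.mul_apply, enorm_rpow_eq_ofReal _ hr0.le, ← ENNReal.ofReal_mul (by positivity),
          ← ENNReal.ofReal_mul (by positivity)]
        congr 1
        simp only [hF]
        rw [Real.mul_rpow (norm_nonneg _) hpos.le, mul_left_comm, ← Real.rpow_add hpos]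
        ring_nf
    _ = ENNReal.ofReal r * ∫⁻ t in Ioi 0, ν {u | t < F u} * ENNReal.ofReal (t ^ (r - 1)) :=
        lintegral_rpow_eq_lintegral_meas_lt_mul _ (ae_of_all _ hF0) hFm.aemeasurable hr0
    _ ≤ ENNReal.ofReal r *
          ∫⁻ t in Ioi 0, (ENNReal.ofReal 4 *
            (μ {x | t < ‖g x‖} * ENNReal.ofReal (t ^ (r - 1 - 1))) +
            ENNReal.ofReal 4 * (ENNReal.ofReal (t ^ (r - 3)) *
              ∫⁻ x in {x | ‖g x‖ ≤ t}, ‖g x‖ₑ ^ (2 : ℝ))) := by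
        gcongr 1
        refine setLIntegral_mono' measurableSet_Ioi fun t ht => ?_
        have ht' : 0 < t := ht
        refine (mul_le_mul_left (hlevel t ht) _).trans_eq ?_
        rw [add_mul, hμ, withDensity_apply _ (measurableSet_lt measurable_const hgm.norm)]
        congr 1
        · rw [mul_right_comm, ← ENNReal.ofReal_mul (by positivity),
            mul_comm (∫⁻ x in {x | t < ‖g x‖}, ‖g x‖ₑ), ← mul_assoc,
            ← ENNReal.ofReal_mul (by positivity), Real.rpow_sub_one ht'.ne' (r - 1)]
          congr 2
          ring
        · rw [mul_right_comm, ← ENNReal.ofReal_mul (by positivity), ← mul_assoc,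
            ← ENNReal.ofReal_mul (by positivity), mul_assoc, ← Real.rpow_add ht']
          ring_nf
    _ = ENNReal.ofReal r * (ENNReal.ofReal 4 *
            (∫⁻ t in Ioi 0, μ {x | t < ‖g x‖} * ENNReal.ofReal (t ^ (r - 1 - 1))) +
            ENNReal.ofReal 4 * ∫⁻ t in Ioi (0 : ℝ), ENNReal.ofReal (t ^ (r - 3)) *
              ∫⁻ x in {x | ‖g x‖ ≤ t}, ‖g x‖ₑ ^ (2 : ℝ)) := by
        have hanti : Antitone fun t : ℝ => μ {x | t < ‖g x‖} :=
          fun s t hst => measure_mono fun x hx => hst.trans_lt hx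
        have hmeas : Measurable fun t : ℝ => ENNReal.ofReal 4 *
            (μ {x | t < ‖g x‖} * ENNReal.ofReal (t ^ (r - 1 - 1))) :=
          (hanti.measurable.mul (by fun_prop)).const_mul _
        rw [lintegral_add_left hmeas, lintegral_const_mul' _ _ ENNReal.ofReal_ne_top,
          lintegral_const_mul' _ _ ENNReal.ofReal_ne_top]
    _ ≤ ENNReal.ofReal r * (ENNReal.ofReal 4 * (ENNReal.ofReal ((r - 1)⁻¹) * I) +
            ENNReal.ofReal 4 * (ENNReal.ofReal (1 / (2 - r)) * I)) := by
        rw [hlayer']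
        gcongr
        exact lintegral_rpow_mul_setLIntegral_sq_le hgm hr0 hr2
    _ = _ := by
        have h1 : 0 ≤ (r - 1)⁻¹ := inv_nonneg.2 (by linarith)
        have h2 : 0 ≤ 1 / (2 - r) := one_div_nonneg.2 (by linarith)
        rw [← mul_assoc, ← mul_assoc, ← add_mul, ← mul_assoc,
          ← ENNReal.ofReal_mul (by norm_num), ← ENNReal.ofReal_mul (by norm_num),
          ← ENNReal.ofReal_add (by positivity) (by positivity), ← ENNReal.ofReal_mul hr0.le]
        rfl

/-! ### Bounds for the Fourier transform composed with a function -/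

/-- The composition of the Fourier transform with `H` is bounded from `Lʳ(ℝ)` to `Lᴾ(S)`
on `L¹ ∩ L²`. -/
def FourierCompBound (H : ℝ → ℝ) (S : Set ℝ) (P r : ℝ) : Prop :=
  ∃ C : ℝ≥0, ∀ g : ℝ → ℂ, Measurable g → Integrable g → MemLp g 2 →
    ∫⁻ σ in S, ‖𝓕 g (H σ)‖ₑ ^ P ≤ C * (∫⁻ s, ‖g s‖ₑ ^ r) ^ (P / r)

namespace FourierCompBound

variable {H : ℝ → ℝ} {S T : Set ℝ} {P Q r : ℝ}

theorem of_measure_zero (hS : volume S = 0) : FourierCompBound H S P r :=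
  ⟨0, fun g _ _ _ => by rw [setLIntegral_measure_zero _ _ hS]; exact zero_le⟩

theorem mono (h : FourierCompBound H T P r) (hST : S ⊆ T) : FourierCompBound H S P r := by
  obtain ⟨C, hC⟩ := h
  exact ⟨C, fun g h1 h2 h3 => (lintegral_mono_set hST).trans (hC g h1 h2 h3)⟩

theorem union (hS : FourierCompBound H S P r) (hT : FourierCompBound H T P r) :
    FourierCompBound H (S ∪ T) P r := by
  obtain ⟨C, hC⟩ := hS
  obtain ⟨D, hD⟩ := hT
  refine ⟨C + D, fun g h1 h2 h3 => (lintegral_union_le _ _ _).trans ?_⟩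
  rw [ENNReal.coe_add, add_mul]
  exact add_le_add (hC g h1 h2 h3) (hD g h1 h2 h3)

/-- On sets of finite measure the exponent `P` may be lowered. -/
theorem of_le (h : FourierCompBound H S Q r) (hH : Continuous H) (hS : volume S ≠ ∞) (hP : 0 < P)
    (hPQ : P ≤ Q) : FourierCompBound H S P r := by
  obtain ⟨C, hC⟩ := h
  have hQ : 0 < Q := hP.trans_le hPQ
  have hθ : 0 ≤ P / Q := by positivity
  have hθ' : 0 ≤ 1 - P / Q := by
    rw [sub_nonneg, div_le_one hQ]; exact hPQ
  refine ⟨C ^ (P / Q) * (volume S).toNNReal ^ (1 - P / Q), fun g h1 h2 h3 => ?_⟩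
  have hF : Measurable fun σ => ‖𝓕 g (H σ)‖ₑ ^ Q :=
    (((continuous_fourier_of_integrable h2).comp hH).enorm.measurable).pow_const _
  have hold := ENNReal.lintegral_mul_norm_pow_le (μ := volume.restrict S) hF.aemeasurable
    (aemeasurable_const (b := (1 : ℝ≥0∞))) hθ hθ' (by ring)
  calc ∫⁻ σ in S, ‖𝓕 g (H σ)‖ₑ ^ P
      = ∫⁻ σ in S, (‖𝓕 g (H σ)‖ₑ ^ Q) ^ (P / Q) * 1 ^ (1 - P / Q) := by
        refine lintegral_congr fun σ => ?_
        rw [ENNReal.one_rpow, mul_one, ← ENNReal.rpow_mul, mul_div_cancel₀ _ hQ.ne']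
    _ ≤ (∫⁻ σ in S, ‖𝓕 g (H σ)‖ₑ ^ Q) ^ (P / Q) * (volume S) ^ (1 - P / Q) := by
        simpa using hold
    _ ≤ (C * (∫⁻ s, ‖g s‖ₑ ^ r) ^ (Q / r)) ^ (P / Q) * (volume S) ^ (1 - P / Q) := by
        gcongr; exact hC g h1 h2 h3
    _ = _ := by
        rw [ENNReal.mul_rpow_of_nonneg _ _ hθ, ← ENNReal.rpow_mul, ENNReal.coe_mul,
          ENNReal.coe_rpow_of_nonneg _ hθ, ENNReal.coe_rpow_of_nonneg _ hθ',
          ENNReal.coe_toNNReal hS]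
        have : Q / r * (P / Q) = P / r := by field_simp
        rw [this]; ring

end FourierCompBound

/-! ### Change of variables away from critical points -/

theorem lintegral_mul_comp_le_of_injOn {H H' : ℝ → ℝ} {S : Set ℝ} (hS : MeasurableSet S)
    (hH : ∀ x ∈ S, HasDerivAt H (H' x) x) (hinj : InjOn H S) (φ : ℝ → ℝ≥0∞) :
    ∫⁻ x in S, ENNReal.ofReal |H' x| * φ (H x) ≤ ∫⁻ u, φ u := by
  rw [← lintegral_image_eq_lintegral_abs_deriv_mul hS
    (fun x hx => (hH x hx).hasDerivWithinAt) hinj]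
  exact setLIntegral_le_lintegral _ _

theorem ne_of_hasDerivAt_ne_zero {H H' : ℝ → ℝ} (hH : ∀ x, HasDerivAt H (H' x) x) {x y : ℝ}
    (hxy : x < y) (h : ∀ z ∈ Ioo x y, H' z ≠ 0) : H x ≠ H y := fun he => by
  obtain ⟨z, hz, hz0⟩ := exists_hasDerivAt_eq_zero hxy
    (fun z _ => (hH z).continuousAt.continuousWithinAt) he (fun z _ => hH z)
  exact h z hz hz0

theorem injOn_of_hasDerivAt_ne_zero {H H' : ℝ → ℝ} (hH : ∀ x, HasDerivAt H (H' x) x) {S : Set ℝ}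
    (hS : S.OrdConnected) (h : ∀ z ∈ S, H' z ≠ 0) : InjOn H S := by
  intro x hx y hy he
  rcases lt_trichotomy x y with hxy | hxy | hxy
  · exact absurd he (ne_of_hasDerivAt_ne_zero hH hxy
      fun z hz => h z (hS.out hx hy (Ioo_subset_Icc_self hz)))
  · exact hxy
  · exact absurd he.symm (ne_of_hasDerivAt_ne_zero hH hxy
      fun z hz => h z (hS.out hy hx (Ioo_subset_Icc_self hz)))

theorem exists_lintegral_enorm_fourier_rpow_le_of_le_two {r q : ℝ} (hrq : r.HolderConjugate q)
    (hr2 : r ≤ 2) :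
    ∃ C : ℝ≥0, ∀ g : ℝ → ℂ, Measurable g → Integrable g → MemLp g 2 →
      ∫⁻ u, ‖𝓕 g u‖ₑ ^ q ≤ C * (∫⁻ s, ‖g s‖ₑ ^ r) ^ (q / r) := by
  rcases hr2.lt_or_eq with h | rfl
  · exact exists_lintegral_enorm_fourier_rpow_le hrq h
  · have hq : q = 2 := by linarith [hrq.mul_eq_add]
    subst hq
    refine ⟨1, fun g _ h1 h2 => ?_⟩
    rw [lintegral_enorm_fourier_sq h1 h2]
    simp

/-- The weighted bound by change of variables, where `|H'| ≥ w`. -/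
theorem exists_setLIntegral_fourier_comp_mul_le {r q : ℝ} (hrq : r.HolderConjugate q)
    (hr2 : r ≤ 2) {H H' w : ℝ → ℝ} {S : Set ℝ} (hS : MeasurableSet S)
    (hH : ∀ x ∈ S, HasDerivAt H (H' x) x) (hinj : InjOn H S) (hw : ∀ x ∈ S, w x ≤ |H' x|) :
    ∃ C : ℝ≥0, ∀ g : ℝ → ℂ, Measurable g → Integrable g → MemLp g 2 →
      ∫⁻ x in S, ‖𝓕 g (H x)‖ₑ ^ q * ENNReal.ofReal (w x) ≤
        C * (∫⁻ s, ‖g s‖ₑ ^ r) ^ (q / r) := by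
  obtain ⟨C, hC⟩ := exists_lintegral_enorm_fourier_rpow_le_of_le_two hrq hr2
  refine ⟨C, fun g h1 h2 h3 => le_trans ?_ (hC g h1 h2 h3)⟩
  refine le_trans ?_ (lintegral_mul_comp_le_of_injOn hS hH hinj fun u => ‖𝓕 g u‖ₑ ^ q)
  refine setLIntegral_mono' hS fun x hx => ?_
  rw [mul_comm]
  gcongr
  exact hw x hx

theorem exists_nhds_fourierCompBound_of_ne_zero {r q : ℝ} (hrq : r.HolderConjugate q)
    (hr2 : r ≤ 2) {H H' : ℝ → ℝ} (hH : ∀ x, HasDerivAt H (H' x) x) (hH' : Continuous H') {x : ℝ}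
    (hx : H' x ≠ 0) : ∃ U ∈ 𝓝 x, FourierCompBound H U q r := by
  have hpos : 0 < |H' x| := abs_pos.2 hx
  have hev : ∀ᶠ y in 𝓝 x, |H' x| / 2 < |H' y| :=
    hH'.abs.continuousAt.eventually (lt_mem_nhds (half_lt_self hpos))
  obtain ⟨δ, hδ, hball⟩ := Metric.eventually_nhds_iff_ball.1 hev
  rw [Real.ball_eq_Ioo] at hball
  refine ⟨Ioo (x - δ) (x + δ), Ioo_mem_nhds (by linarith) (by linarith), ?_⟩
  obtain ⟨C, hC⟩ := exists_setLIntegral_fourier_comp_mul_le hrq hr2 measurableSet_Ioo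
    (fun y _ => hH y) (injOn_of_hasDerivAt_ne_zero hH ordConnected_Ioo
      fun z hz => abs_pos.1 ((half_pos hpos).trans (hball z hz)))
    (w := fun _ => |H' x| / 2) fun y hy => (hball y hy).le
  refine ⟨(Real.toNNReal (|H' x| / 2))⁻¹ * C, fun g h1 h2 h3 => ?_⟩
  have h := hC g h1 h2 h3
  rw [lintegral_mul_const' _ _ ENNReal.ofReal_ne_top, mul_comm] at h
  have hne : Real.toNNReal (|H' x| / 2) ≠ 0 := by simpa using hpos
  rw [ENNReal.coe_mul, ENNReal.coe_inv hne, mul_assoc, mul_comm, ← div_eq_mul_inv,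
    ENNReal.le_div_iff_mul_le (Or.inl (by simpa using hne)) (Or.inl ENNReal.coe_ne_top), mul_comm]
  exact h

/-! ### Nondegenerate critical points -/

/-- `S` lies on one side of a nondegenerate critical point `x₀` of `H`. -/
structure IsFoldSide (H H' : ℝ → ℝ) (S : Set ℝ) (x₀ c K R : ℝ) : Prop where
  measurableSet : MeasurableSet S
  hasDerivAt : ∀ x ∈ S, HasDerivAt H (H' x) x
  injOn : InjOn H S
  ne : ∀ x ∈ S, x ≠ x₀
  subset : S ⊆ Ioo (x₀ - R) (x₀ + R)
  pos : 0 < c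
  pos' : 0 < K
  le_deriv : ∀ x ∈ S, c * |x - x₀| ≤ |H' x|
  abs_sub_le : ∀ x ∈ S, |H x - H x₀| ≤ K * |x - x₀| ^ 2
  apply_ne : ∀ x ∈ S, H x ≠ H x₀

namespace IsFoldSide

variable {H H' : ℝ → ℝ} {S : Set ℝ} {x₀ c K R : ℝ}

/-- Hausdorff–Young in the variable u = H x; the Jacobian supplies the weight, since |H'| ≥ c|x -
x₀|. -/
theorem exists_young (h : IsFoldSide H H' S x₀ c K R) {r q : ℝ} (hrq : r.HolderConjugate q)
    (hr2 : r ≤ 2) :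
    ∃ C : ℝ≥0, ∀ g : ℝ → ℂ, Measurable g → Integrable g → MemLp g 2 →
      ∫⁻ x in S, ‖𝓕 g (H x)‖ₑ ^ q * ENNReal.ofReal |x - x₀| ≤
        C * (∫⁻ s, ‖g s‖ₑ ^ r) ^ (q / r) := by
  obtain ⟨C, hC⟩ := exists_setLIntegral_fourier_comp_mul_le hrq hr2 h.measurableSet h.hasDerivAt
    h.injOn h.le_deriv
  refine ⟨Real.toNNReal c⁻¹ * C, fun g h1 h2 h3 => ?_⟩
  rw [ENNReal.coe_mul, mul_assoc]
  refine le_trans ?_ (mul_le_mul_right (hC g h1 h2 h3) _)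
  rw [← lintegral_const_mul' _ _ ENNReal.coe_ne_top]
  refine lintegral_mono fun x => le_of_eq ?_
  change _ = ENNReal.ofReal c⁻¹ * _
  rw [mul_left_comm, ← ENNReal.ofReal_mul (inv_nonneg.2 h.pos.le), inv_mul_cancel_left₀ h.pos.ne']

/-- Paley's inequality centred at the critical value `H x₀`. As r - 2 < 0, the upper bound K|x -
x₀|² for |H x - H x₀| bounds the Paley weight from below by a multiple of |x - x₀|^{2r-4}; the
Jacobian contributes one more power. -/
theorem exists_paley (h : IsFoldSide H H' S x₀ c K R) {r : ℝ} (hr1 : 1 < r) (hr2 : r < 2) :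
    ∃ C : ℝ≥0, ∀ g : ℝ → ℂ, Measurable g → Integrable g → MemLp g 2 →
      ∫⁻ x in S, ‖𝓕 g (H x)‖ₑ ^ r * ENNReal.ofReal (|x - x₀| ^ (2 * r - 3)) ≤
        C * ∫⁻ s, ‖g s‖ₑ ^ r := by
  obtain ⟨C, hC⟩ := exists_lintegral_enorm_fourier_rpow_mul_le hr1 hr2
  have hd : 0 < (K ^ (r - 2) * c)⁻¹ := by have := h.pos; have := h.pos'; positivity
  refine ⟨Real.toNNReal (K ^ (r - 2) * c)⁻¹ * C, fun g h1 h2 h3 => ?_⟩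
  rw [ENNReal.coe_mul, mul_assoc]
  refine le_trans ?_ (mul_le_mul_right ((lintegral_mul_comp_le_of_injOn h.measurableSet
    h.hasDerivAt h.injOn _).trans (hC g h1 h2 h3 (H x₀))) _)
  rw [← lintegral_const_mul' _ _ ENNReal.coe_ne_top]
  refine setLIntegral_mono' h.measurableSet fun x hx => ?_
  change _ ≤ ENNReal.ofReal _ * _
  have hw : 0 < |x - x₀| := abs_pos.2 (sub_ne_zero.2 (h.ne x hx))
  have hHx : 0 < |H x - H x₀| := abs_pos.2 (sub_ne_zero.2 (h.apply_ne x hx))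
  rw [mul_left_comm (ENNReal.ofReal |H' x|), mul_left_comm (ENNReal.ofReal (_)⁻¹), ← ENNReal.ofReal_mul (abs_nonneg _),
    ← ENNReal.ofReal_mul hd.le]
  gcongr
  have e1 : (K * |x - x₀| ^ 2) ^ (r - 2) ≤ |H x - H x₀| ^ (r - 2) :=
    Real.rpow_le_rpow_of_nonpos hHx (h.abs_sub_le x hx) (by linarith)
  have e2 : |x - x₀| ^ (2 * r - 3) * (K ^ (r - 2) * c) =
      c * |x - x₀| * (K * |x - x₀| ^ 2) ^ (r - 2) := by
    rw [Real.mul_rpow h.pos'.le (by positivity), ← Real.rpow_two, ← Real.rpow_mul hw.le,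
      show 2 * r - 3 = 1 + 2 * (r - 2) by ring, Real.rpow_add hw, Real.rpow_one]
    ring
  rw [inv_mul_eq_div, le_div_iff₀ (inv_pos.1 hd), e2]
  exact mul_le_mul (h.le_deriv x hx) e1 (by have := h.pos'; positivity) (abs_nonneg _)

end IsFoldSide

theorem setLIntegral_abs_sub_rpow_lt_top (x₀ R : ℝ) {a : ℝ} (ha : -1 < a) :
    ∫⁻ x in Ioo (x₀ - R) (x₀ + R), ENNReal.ofReal (|x - x₀| ^ a) < ∞ := by
  rcases le_or_gt R 0 with hR | hR
  · rw [Ioo_eq_empty (by linarith)]; simp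
  have h_int : IntegrableOn (fun x : ℝ => |x| ^ a) (Ioo (-R) R) := by
    have h1 : IntervalIntegrable (fun x : ℝ => x ^ a) volume 0 R :=
      intervalIntegral.intervalIntegrable_rpow' ha
    have h2 : IntervalIntegrable (fun x : ℝ => |x| ^ a) volume 0 R := by
      refine h1.congr fun x hx => ?_
      rw [uIoc_of_le hR.le] at hx
      simp only [abs_of_pos hx.1]
    have h3 : IntervalIntegrable (fun x : ℝ => |x| ^ a) volume (-R) 0 := by
      have := (h2.comp_sub_left 0).symm
      simpa using this
    have h4 := h3.trans h2
    rw [intervalIntegrable_iff_integrableOn_Ioo_of_le (by linarith)] at h4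
    exact h4
  have e : ∫⁻ x in Ioo (x₀ - R) (x₀ + R), ENNReal.ofReal (|x - x₀| ^ a) =
      ∫⁻ x in Ioo (-R) R, ENNReal.ofReal (|x| ^ a) := by
    rw [← lintegral_indicator measurableSet_Ioo, ← lintegral_indicator measurableSet_Ioo,
      ← lintegral_sub_right_eq_self ((Ioo (-R) R).indicator _) x₀]
    refine lintegral_congr fun x => ?_
    have : x ∈ Ioo (x₀ - R) (x₀ + R) ↔ x - x₀ ∈ Ioo (-R) R := by
      simp only [mem_Ioo]; constructor <;> rintro ⟨h1, h2⟩ <;> constructor <;> linarith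
    by_cases hx : x ∈ Ioo (x₀ - R) (x₀ + R)
    · rw [indicator_of_mem hx, indicator_of_mem (this.1 hx)]
    · rw [indicator_of_notMem hx, indicator_of_notMem (fun h => hx (this.2 h))]
  rw [e]
  refine lt_of_le_of_lt (lintegral_mono fun x => ?_) h_int.2
  rw [Real.enorm_eq_ofReal (by positivity)]

namespace IsFoldSide

variable {H H' : ℝ → ℝ} {S : Set ℝ} {x₀ c K R : ℝ}

/-- Hölder's inequality takes the weight out of `exists_young` at the price of the integral of |x -
x₀|^{-P/(q-P)}, whose exponent exceeds -1 exactly when P < q/2. -/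
theorem fourierCompBound_of_lt (h : IsFoldSide H H' S x₀ c K R) (hH : Continuous H) {r q P : ℝ}
    (hrq : r.HolderConjugate q) (hr2 : r ≤ 2) (hP : 0 < P) (hPq : P < q / 2) :
    FourierCompBound H S P r := by
  have hq : 0 < q := hrq.symm.pos
  obtain ⟨C, hC⟩ := h.exists_young hrq hr2
  set D := ∫⁻ x in S, ENNReal.ofReal (|x - x₀| ^ (-(P / (q - P)))) with hD
  have hqP : 0 < q - P := by linarith
  have hDtop : D ≠ ∞ := by
    refine ((lintegral_mono_set h.subset).trans_lt
      (setLIntegral_abs_sub_rpow_lt_top x₀ R ?_)).ne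
    rw [neg_lt_neg_iff, div_lt_one hqP]; linarith
  have hθ : 0 ≤ P / q := by positivity
  have hθ' : 0 ≤ 1 - P / q := by
    rw [sub_nonneg, div_le_one hq]; linarith
  refine ⟨C ^ (P / q) * D.toNNReal ^ (1 - P / q), fun g h1 h2 h3 => ?_⟩
  have hF : Measurable fun x => ‖𝓕 g (H x)‖ₑ ^ q * ENNReal.ofReal |x - x₀| :=
    ((((continuous_fourier_of_integrable h2).comp hH).enorm.measurable).pow_const _).mul
      (by fun_prop)
  have hG : Measurable fun x => ENNReal.ofReal (|x - x₀| ^ (-(P / (q - P)))) := by fun_prop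
  calc ∫⁻ x in S, ‖𝓕 g (H x)‖ₑ ^ P
      = ∫⁻ x in S, (‖𝓕 g (H x)‖ₑ ^ q * ENNReal.ofReal |x - x₀|) ^ (P / q) *
          ENNReal.ofReal (|x - x₀| ^ (-(P / (q - P)))) ^ (1 - P / q) := by
        refine setLIntegral_congr_fun h.measurableSet fun x hx => ?_
        have hw : 0 < |x - x₀| := abs_pos.2 (sub_ne_zero.2 (h.ne x hx))
        rw [ENNReal.mul_rpow_of_nonneg _ _ hθ, ← ENNReal.rpow_mul, mul_div_cancel₀ _ hq.ne',
          ENNReal.ofReal_rpow_of_pos hw, ENNReal.ofReal_rpow_of_pos (by positivity),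
          mul_assoc, ← ENNReal.ofReal_mul (by positivity), ← Real.rpow_mul hw.le,
          ← Real.rpow_add hw]
        have : P / q + -(P / (q - P)) * (1 - P / q) = 0 := by field_simp; ring
        rw [this]; simp
    _ ≤ (∫⁻ x in S, ‖𝓕 g (H x)‖ₑ ^ q * ENNReal.ofReal |x - x₀|) ^ (P / q) * D ^ (1 - P / q) :=
        ENNReal.lintegral_mul_norm_pow_le hF.aemeasurable hG.aemeasurable hθ hθ' (by ring)
    _ ≤ (C * (∫⁻ s, ‖g s‖ₑ ^ r) ^ (q / r)) ^ (P / q) * D ^ (1 - P / q) := by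
        gcongr; exact hC g h1 h2 h3
    _ = _ := by
        rw [ENNReal.mul_rpow_of_nonneg _ _ hθ, ← ENNReal.rpow_mul, ENNReal.coe_mul,
          ENNReal.coe_rpow_of_nonneg _ hθ, ENNReal.coe_rpow_of_nonneg _ hθ',
          ENNReal.coe_toNNReal hDtop]
        have : q / r * (P / q) = P / r := by field_simp
        rw [this]; ring

/-- At P = q/2 the Hölder integral just diverges. Instead the Paley bound is taken to the power θ
and the Young bound to the power 1 - θ, with θ solving (2r-3)θ + (1-θ) = 0 so that the weights
cancel. The powers of |ĝ| then add up to rθ + q(1-θ) = q/2. The requirement θ ≤ 1 means r ≤ 3/2,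
that is, q ≥ 3. -/
theorem fourierCompBound_half (h : IsFoldSide H H' S x₀ c K R) (hH : Continuous H) {r q : ℝ}
    (hrq : r.HolderConjugate q) (hq : 3 ≤ q) : FourierCompBound H S (q / 2) r := by
  have hr1 : 1 < r := hrq.lt
  have hr0 : 0 < r := hrq.pos
  have hmul := hrq.mul_eq_add
  have hr2 : r ≤ 3 / 2 := by nlinarith
  obtain ⟨C, hC⟩ := h.exists_young hrq (by linarith)
  obtain ⟨D, hD⟩ := h.exists_paley hr1 (by linarith)
  set θ := 1 / (2 * (2 - r)) with hθd
  have hr2' : 0 < 2 - r := by linarith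
  have hθ : 0 ≤ θ := by positivity
  have hθ' : 0 ≤ 1 - θ := by
    rw [sub_nonneg, hθd, div_le_one (by positivity)]; linarith
  have hθr : θ * (2 - r) = 1 / 2 := by rw [hθd]; field_simp
  have hexp : r * θ + q * (1 - θ) = q / 2 := by
    have : (r * θ + q * (1 - θ) - q / 2) * (2 - r) = 0 := by
      linear_combination (r - q) * hθr - (1 / 2) * hmul
    have := (mul_eq_zero.1 this).resolve_right hr2'.ne'
    linarith
  refine ⟨D ^ θ * C ^ (1 - θ), fun g h1 h2 h3 => ?_⟩
  have hcont := ((continuous_fourier_of_integrable h2).comp hH).enorm.measurable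
  have hF : Measurable fun x => ‖𝓕 g (H x)‖ₑ ^ q * ENNReal.ofReal |x - x₀| :=
    (hcont.pow_const _).mul (by fun_prop)
  have hG : Measurable fun x => ‖𝓕 g (H x)‖ₑ ^ r * ENNReal.ofReal (|x - x₀| ^ (2 * r - 3)) :=
    (hcont.pow_const _).mul (by fun_prop)
  calc ∫⁻ x in S, ‖𝓕 g (H x)‖ₑ ^ (q / 2)
      = ∫⁻ x in S, (‖𝓕 g (H x)‖ₑ ^ r * ENNReal.ofReal (|x - x₀| ^ (2 * r - 3))) ^ θ *
          (‖𝓕 g (H x)‖ₑ ^ q * ENNReal.ofReal |x - x₀|) ^ (1 - θ) := by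
        refine setLIntegral_congr_fun h.measurableSet fun x hx => ?_
        have hw : 0 < |x - x₀| := abs_pos.2 (sub_ne_zero.2 (h.ne x hx))
        rw [ENNReal.mul_rpow_of_nonneg _ _ hθ, ENNReal.mul_rpow_of_nonneg _ _ hθ',
          ← ENNReal.rpow_mul, ← ENNReal.rpow_mul, mul_mul_mul_comm,
          ← ENNReal.rpow_add_of_nonneg _ _ (by positivity)
            (mul_nonneg hrq.symm.nonneg hθ'), hexp,
          ENNReal.ofReal_rpow_of_pos hw, ENNReal.ofReal_rpow_of_pos (by positivity),
          ← ENNReal.ofReal_mul (by positivity), ← Real.rpow_mul hw.le,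
          ← Real.rpow_add hw]
        have : (2 * r - 3) * θ + (1 - θ) = 0 := by linear_combination -2 * hθr
        rw [this]; simp
    _ ≤ (∫⁻ x in S, ‖𝓕 g (H x)‖ₑ ^ r * ENNReal.ofReal (|x - x₀| ^ (2 * r - 3))) ^ θ *
          (∫⁻ x in S, ‖𝓕 g (H x)‖ₑ ^ q * ENNReal.ofReal |x - x₀|) ^ (1 - θ) :=
        ENNReal.lintegral_mul_norm_pow_le hG.aemeasurable hF.aemeasurable hθ hθ' (by ring)
    _ ≤ (D * ∫⁻ s, ‖g s‖ₑ ^ r) ^ θ * (C * (∫⁻ s, ‖g s‖ₑ ^ r) ^ (q / r)) ^ (1 - θ) := by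
        gcongr
        · exact hD g h1 h2 h3
        · exact hC g h1 h2 h3
    _ = _ := by
        rw [ENNReal.mul_rpow_of_nonneg _ _ hθ, ENNReal.mul_rpow_of_nonneg _ _ hθ',
          ← ENNReal.rpow_mul, mul_mul_mul_comm, ← ENNReal.rpow_add_of_nonneg _ _ hθ
            (mul_nonneg (div_nonneg hrq.symm.nonneg hr0.le) hθ'), ENNReal.coe_mul,
          ENNReal.coe_rpow_of_nonneg _ hθ, ENNReal.coe_rpow_of_nonneg _ hθ']
        congr 2
        rw [← hexp]; field_simp

end IsFoldSide

/-- Differentiability of H' at x₀ alone gives |H'(x) - d(x - x₀)| ≤ (|d|/2)|x - x₀| nearby, which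
pins |H'| between multiples of |x - x₀|. The mean value inequality then yields the quadratic bound,
and Rolle's theorem the injectivity on each side. No third derivative is needed, so C² curves are
allowed. -/
theorem exists_isFoldSide {H H' : ℝ → ℝ} (hH : ∀ x, HasDerivAt H (H' x) x) {x₀ d : ℝ}
    (hx₀ : H' x₀ = 0) (hd : HasDerivAt H' d x₀) (hd0 : d ≠ 0) :
    ∃ c K R : ℝ, 0 < R ∧ IsFoldSide H H' (Ioo (x₀ - R) x₀) x₀ c K R ∧
      IsFoldSide H H' (Ioo x₀ (x₀ + R)) x₀ c K R := by
  have hpos : 0 < |d| := abs_pos.2 hd0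
  have hev := hd.isLittleO.def (half_pos hpos)
  obtain ⟨R, hR, hball⟩ := Metric.eventually_nhds_iff_ball.1 hev
  simp only [hx₀, sub_zero, Real.ball_eq_Ioo, smul_eq_mul, Real.norm_eq_abs] at hball
  have hlow : ∀ x ∈ Ioo (x₀ - R) (x₀ + R), |d| / 2 * |x - x₀| ≤ |H' x| := fun x hx => by
    have h1 := hball x hx
    have h2 := abs_sub_abs_le_abs_sub ((x - x₀) * d) (H' x)
    rw [abs_sub_comm, abs_mul] at h2
    linarith
  have hup : ∀ x ∈ Ioo (x₀ - R) (x₀ + R), |H' x| ≤ 2 * |d| * |x - x₀| := fun x hx => by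
    have h1 := hball x hx
    have h2 := abs_sub_abs_le_abs_sub (H' x) ((x - x₀) * d)
    rw [abs_mul] at h2
    nlinarith [abs_nonneg (x - x₀)]
  have hquad : ∀ x ∈ Ioo (x₀ - R) (x₀ + R), |H x - H x₀| ≤ 2 * |d| * |x - x₀| ^ 2 := by
    intro x hx
    have hx₀mem : x₀ ∈ Ioo (x₀ - R) (x₀ + R) := ⟨by linarith, by linarith⟩
    have := (convex_uIcc x₀ x).norm_image_sub_le_of_norm_hasDerivWithin_le (f := H) (f' := H')
      (C := 2 * |d| * |x - x₀|) (fun y _ => (hH y).hasDerivWithinAt) ?_ left_mem_uIcc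
      right_mem_uIcc
    · rw [Real.norm_eq_abs, Real.norm_eq_abs] at this
      nlinarith
    · intro y hy
      have hy' := ordConnected_Ioo.uIcc_subset hx₀mem hx hy
      rw [Real.norm_eq_abs]
      refine (hup y hy').trans ?_
      exact mul_le_mul_of_nonneg_left (abs_sub_left_of_mem_uIcc hy) (by positivity)
  have hne : ∀ x ∈ Ioo (x₀ - R) (x₀ + R), x ≠ x₀ → H' x ≠ 0 := fun x hx hxx => by
    have := hlow x hx
    have h2 : 0 < |x - x₀| := abs_pos.2 (sub_ne_zero.2 hxx)
    exact abs_pos.1 ((by positivity : 0 < |d| / 2 * |x - x₀|).trans_le this)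
  have sL : Ioo (x₀ - R) x₀ ⊆ Ioo (x₀ - R) (x₀ + R) := Ioo_subset_Ioo_right (by linarith)
  have sR : Ioo x₀ (x₀ + R) ⊆ Ioo (x₀ - R) (x₀ + R) := Ioo_subset_Ioo_left (by linarith)
  refine ⟨|d| / 2, 2 * |d|, R, hR, ?_, ?_⟩
  · exact
    { measurableSet := measurableSet_Ioo
      hasDerivAt := fun x _ => hH x
      injOn := injOn_of_hasDerivAt_ne_zero hH ordConnected_Ioo fun z hz => hne z (sL hz) hz.2.ne
      ne := fun x hx => hx.2.ne
      subset := sL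
      pos := by positivity
      pos' := by positivity
      le_deriv := fun x hx => hlow x (sL hx)
      abs_sub_le := fun x hx => hquad x (sL hx)
      apply_ne := fun x hx => ne_of_hasDerivAt_ne_zero hH hx.2 fun z hz =>
        hne z (sL ⟨hx.1.trans hz.1, hz.2⟩) hz.2.ne }
  · exact
    { measurableSet := measurableSet_Ioo
      hasDerivAt := fun x _ => hH x
      injOn := injOn_of_hasDerivAt_ne_zero hH ordConnected_Ioo fun z hz => hne z (sR hz) hz.1.ne'
      ne := fun x hx => hx.1.ne'
      subset := sR
      pos := by positivity
      pos' := by positivity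
      le_deriv := fun x hx => hlow x (sR hx)
      abs_sub_le := fun x hx => hquad x (sR hx)
      apply_ne := fun x hx => (ne_of_hasDerivAt_ne_zero hH hx.1 fun z hz =>
        hne z (sR ⟨hz.1, hz.2.trans hx.2⟩) hz.1.ne').symm }

theorem FourierCompBound.of_isCompact {H : ℝ → ℝ} {S : Set ℝ} {P r : ℝ} (hS : IsCompact S)
    (h : ∀ x ∈ S, ∃ U ∈ 𝓝 x, FourierCompBound H U P r) : FourierCompBound H S P r :=
  hS.induction_on (p := fun T => FourierCompBound H T P r) (.of_measure_zero measure_empty)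
    (fun _ _ hst ht => ht.mono hst) (fun _ _ hs ht => hs.union ht)
    fun x hx => let ⟨U, hU, h⟩ := h x hx; ⟨U, mem_nhdsWithin_of_mem_nhds hU, h⟩

theorem fourierCompBound_of_deriv_ne_zero {r q : ℝ} (hrq : r.HolderConjugate q) (hr2 : r ≤ 2)
    {H H' : ℝ → ℝ} (hH : ∀ x, HasDerivAt H (H' x) x) (hH' : Continuous H') {S : Set ℝ}
    (hS : IsCompact S) (h : ∀ x ∈ S, H' x ≠ 0) : FourierCompBound H S q r :=
  .of_isCompact hS fun x hx => exists_nhds_fourierCompBound_of_ne_zero hrq hr2 hH hH' (h x hx)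

theorem fourierCompBound_of_nondegenerate {r q P : ℝ} (hrq : r.HolderConjugate q) (hr2 : r ≤ 2)
    (hP : 0 < P) (hPq : P < q / 2 ∨ 3 ≤ q ∧ P ≤ q / 2) {H H' H'' : ℝ → ℝ}
    (hH : ∀ x, HasDerivAt H (H' x) x) (hH' : ∀ x, HasDerivAt H' (H'' x) x) {S : Set ℝ}
    (hS : IsCompact S) (h : ∀ x ∈ S, H' x = 0 → H'' x ≠ 0) : FourierCompBound H S P r := by
  have hHc : Continuous H := continuous_iff_continuousAt.2 fun x => (hH x).continuousAt
  have hHc' : Continuous H' := continuous_iff_continuousAt.2 fun x => (hH' x).continuousAt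
  have hq : 0 < q := hrq.symm.pos
  refine .of_isCompact hS fun x hx => ?_
  by_cases hx0 : H' x = 0
  · obtain ⟨c, K, R, hR, hL, hRt⟩ := exists_isFoldSide hH hx0 (hH' x) (h x hx hx0)
    have key : ∀ T : Set ℝ, volume T ≠ ∞ → IsFoldSide H H' T x c K R → FourierCompBound H T P r := by
      intro T hT hf
      rcases hPq with h1 | ⟨h1, h2⟩
      · exact hf.fourierCompBound_of_lt hHc hrq hr2 hP h1
      · exact (hf.fourierCompBound_half hHc hrq h1).of_le hHc hT hP h2
    refine ⟨Ioo (x - R) (x + R), Ioo_mem_nhds (by linarith) (by linarith), ?_⟩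
    refine (((key _ (by simp) hL).union (key _ (by simp) hRt)).union
      (.of_measure_zero (S := {x}) (by simp))).mono fun y hy => ?_
    rcases lt_trichotomy y x with hyx | hyx | hyx
    · exact Or.inl (Or.inl ⟨hy.1, hyx⟩)
    · exact Or.inr hyx
    · exact Or.inl (Or.inr ⟨hyx, hy.2⟩)
  · obtain ⟨U, hU, hb⟩ := exists_nhds_fourierCompBound_of_ne_zero hrq hr2 hH hHc' hx0
    obtain ⟨δ, hδ, hball⟩ := Metric.mem_nhds_iff.1 hU
    -- The neighbourhood is shrunk to a ball because lowering the exponent from q to P requires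
    -- finite measure.
    refine ⟨Metric.ball x δ, Metric.ball_mem_nhds x hδ, (hb.mono hball).of_le hHc ?_ hP ?_⟩
    · exact measure_ball_lt_top.ne
    · rcases hPq with h1 | ⟨_, h1⟩ <;> linarith

/-! ### The extension operator on a line and its adjoint -/

noncomputable section

theorem inner_plane (x y : Plane) : inner ℝ x y = x 0 * y 0 + x 1 * y 1 := by
  simp [PiLp.inner_apply, Fin.sum_univ_two, mul_comm]

theorem norm_rot (v : Plane) : ‖rot v‖ = ‖v‖ := by
  simp [EuclideanSpace.norm_eq, rot, Fin.sum_univ_two, add_comm]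

theorem inner_rot_left (v w : Plane) : inner ℝ (rot v) w = -inner ℝ v (rot w) := by
  simp [inner_plane, rot]

theorem inner_rot_self (v : Plane) : inner ℝ v (rot v) = 0 := by
  rw [inner_plane]; simp [rot]; ring

theorem norm_exp_two_pi_I_mul (x : ℝ) : ‖Complex.exp (2 * Real.pi * Complex.I * (x : ℝ))‖ = 1 := by
  rw [show (2 * Real.pi * Complex.I * (x : ℝ) : ℂ) = ((2 * Real.pi * x : ℝ) : ℂ) * Complex.I by
    push_cast; ring]
  exact Complex.norm_exp_ofReal_mul_I _

theorem enorm_exp_two_pi_I_mul (x : ℝ) :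
    ‖Complex.exp (2 * Real.pi * Complex.I * (x : ℝ))‖ₑ = 1 := by
  rw [← ofReal_norm, norm_exp_two_pi_I_mul, ENNReal.ofReal_one]

namespace CompactC2Curve

variable (Γ : CompactC2Curve)

theorem continuous_γ : Continuous Γ.γ := Γ.contDiff.continuous

theorem contDiff_deriv : ContDiff ℝ 1 (deriv Γ.γ) := by
  have h : ContDiff ℝ (1 + 1) Γ.γ := by
    have := Γ.contDiff; norm_num; exact this
  exact (contDiff_succ_iff_deriv.1 h).2.2

theorem continuous_deriv : Continuous (deriv Γ.γ) := Γ.contDiff_deriv.continuous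

theorem hasDerivAt_γ (s : ℝ) : HasDerivAt Γ.γ (deriv Γ.γ s) s :=
  (Γ.contDiff.differentiable (by norm_num) s).hasDerivAt

theorem hasDerivAt_deriv (s : ℝ) : HasDerivAt (deriv Γ.γ) (deriv (deriv Γ.γ) s) s :=
  (Γ.contDiff_deriv.differentiable (by norm_num) s).hasDerivAt

/-- The arc length measure in the parameter interval. -/
def paramMeasure : Measure ℝ :=
  (volume.restrict (Icc Γ.a Γ.b)).withDensity fun s => ‖deriv Γ.γ s‖ₑ

theorem arcLength_eq_map : Γ.arcLength = Γ.paramMeasure.map Γ.γ := rfl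

theorem exists_norm_deriv_le : ∃ L : ℝ, 0 < L ∧ ∀ s ∈ Icc Γ.a Γ.b, ‖deriv Γ.γ s‖ ≤ L := by
  obtain ⟨L, hL⟩ := isCompact_Icc.exists_bound_of_continuousOn
    (Γ.continuous_deriv.continuousOn (s := Icc Γ.a Γ.b))
  exact ⟨max L 1, by positivity, fun s hs => (hL s hs).trans (le_max_left _ _)⟩

theorem exists_le_norm_deriv : ∃ c : ℝ, 0 < c ∧ ∀ s ∈ Icc Γ.a Γ.b, c ≤ ‖deriv Γ.γ s‖ := by
  obtain ⟨x, hx, hmin⟩ := isCompact_Icc.exists_isMinOn (nonempty_Icc.2 Γ.lt.le)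
    (Γ.continuous_deriv.norm.continuousOn (s := Icc Γ.a Γ.b))
  exact ⟨_, norm_pos_iff.2 (Γ.regular x hx), fun s hs => hmin hs⟩

theorem exists_paramMeasure_le :
    ∃ L : ℝ≥0, Γ.paramMeasure ≤ (L : ℝ≥0∞) • volume.restrict (Icc Γ.a Γ.b) := by
  obtain ⟨L, -, hL⟩ := Γ.exists_norm_deriv_le
  refine ⟨Real.toNNReal L, ?_⟩
  rw [paramMeasure, ← withDensity_const]
  refine withDensity_mono ((ae_restrict_mem measurableSet_Icc).mono fun s hs => ?_)
  simp only [← ofReal_norm]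
  exact ENNReal.ofReal_le_ofReal (hL s hs)

instance : IsFiniteMeasure Γ.paramMeasure := by
  obtain ⟨L, hL⟩ := Γ.exists_paramMeasure_le
  refine ⟨(hL univ).trans_lt ?_⟩
  rw [Measure.smul_apply, smul_eq_mul]
  exact ENNReal.mul_lt_top ENNReal.coe_lt_top (measure_lt_top _ _)

instance : IsFiniteMeasure Γ.arcLength := by
  rw [arcLength_eq_map]; infer_instance

variable {Γ}

theorem eLpNorm_arcLength {f : Plane → ℂ} (hf : Continuous f) (p : ℝ≥0∞) :
    eLpNorm f p Γ.arcLength = eLpNorm (f ∘ Γ.γ) p Γ.paramMeasure := by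
  rw [arcLength_eq_map, eLpNorm_map_measure hf.aestronglyMeasurable
    Γ.continuous_γ.measurable.aemeasurable]

theorem extension_eq {f : Plane → ℂ} (hf : Continuous f) (x : Plane) :
    Γ.extension f x = ∫ s, f (Γ.γ s) *
      Complex.exp (2 * Real.pi * Complex.I * (inner ℝ (Γ.γ s) x : ℝ)) ∂Γ.paramMeasure := by
  rw [extension, arcLength_eq_map, integral_map Γ.continuous_γ.measurable.aemeasurable]
  exact Continuous.aestronglyMeasurable (by fun_prop)

theorem enorm_extension_le (f : Plane → ℂ) (x : Plane) :
    ‖Γ.extension f x‖ₑ ≤ eLpNorm f 1 Γ.arcLength := by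
  rw [extension, eLpNorm_one_eq_lintegral_enorm]
  refine (enorm_integral_le_lintegral_enorm _).trans_eq (lintegral_congr fun ξ => ?_)
  rw [enorm_mul, enorm_exp_two_pi_I_mul, mul_one]

theorem integrable_comp (f : SchwartzMap Plane ℂ) : Integrable (f ∘ Γ.γ) Γ.paramMeasure := by
  exact Integrable.of_bound (f.continuous.comp Γ.continuous_γ).aestronglyMeasurable
    ‖f.toBoundedContinuousFunction‖
    (ae_of_all _ fun s => f.toBoundedContinuousFunction.norm_coe_le_norm (Γ.γ s))

theorem continuous_extension (f : SchwartzMap Plane ℂ) : Continuous (Γ.extension f) := by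
  have : Γ.extension f = fun x => ∫ s, f (Γ.γ s) *
      Complex.exp (2 * Real.pi * Complex.I * (inner ℝ (Γ.γ s) x : ℝ)) ∂Γ.paramMeasure :=
    funext fun x => extension_eq f.continuous x
  rw [this]
  have hγ := Γ.continuous_γ
  refine continuous_of_dominated (bound := fun s => ‖f (Γ.γ s)‖) ?_ ?_ ?_ ?_
  · intro x
    have := f.continuous
    exact Continuous.aestronglyMeasurable (by fun_prop)
  · intro x
    refine ae_of_all _ fun s => ?_
    rw [norm_mul, norm_exp_two_pi_I_mul, mul_one]
  · exact (integrable_comp f).norm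
  · exact ae_of_all _ fun s => by fun_prop

/-- The pairing of the extension on a line with `g` is the pairing of `f` with the Fourier
transform of `g` along the curve. -/
theorem integral_extension_mul (f : SchwartzMap Plane ℂ) (ω : Plane) (t : ℝ) {g : ℝ → ℂ}
    (hg : Integrable g) :
    ∫ s, Γ.extension f (t • ω + s • rot ω) * g s =
      ∫ σ, f (Γ.γ σ) * Complex.exp (2 * Real.pi * Complex.I * (t * inner ℝ (Γ.γ σ) ω : ℝ)) *
        𝓕 g (inner ℝ (rot (Γ.γ σ)) ω) ∂Γ.paramMeasure := by
  have hγ := Γ.continuous_γ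
  have hfc := f.continuous
  have h_int : Integrable (Function.uncurry fun s σ => f (Γ.γ σ) *
      Complex.exp (2 * Real.pi * Complex.I * (inner ℝ (Γ.γ σ) (t • ω + s • rot ω) : ℝ)) * g s)
      (volume.prod Γ.paramMeasure) := by
    have h1 := (Integrable.mul_prod hg (integrable_comp (Γ := Γ) f))
    have h2 := h1.bdd_mul (c := 1) (f := fun z : ℝ × ℝ => Complex.exp (2 * Real.pi * Complex.I *
      (inner ℝ (Γ.γ z.2) (t • ω + z.1 • rot ω) : ℝ)))
      (Continuous.aestronglyMeasurable (by fun_prop))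
      (ae_of_all _ fun z => (norm_exp_two_pi_I_mul _).le)
    refine h2.congr (ae_of_all _ fun z => ?_)
    simp only [Function.uncurry, Function.comp]
    ring
  calc ∫ s, Γ.extension f (t • ω + s • rot ω) * g s
      = ∫ s, ∫ σ, f (Γ.γ σ) * Complex.exp (2 * Real.pi * Complex.I *
          (inner ℝ (Γ.γ σ) (t • ω + s • rot ω) : ℝ)) * g s ∂Γ.paramMeasure := by
        refine integral_congr_ae (ae_of_all _ fun s => ?_)
        simp only [extension_eq f.continuous]
        rw [integral_mul_const]
    _ = ∫ σ, (∫ s, f (Γ.γ σ) * Complex.exp (2 * Real.pi * Complex.I *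
          (inner ℝ (Γ.γ σ) (t • ω + s • rot ω) : ℝ)) * g s) ∂Γ.paramMeasure :=
        integral_integral_swap h_int
    _ = _ := by
        refine integral_congr_ae (ae_of_all _ fun σ => ?_)
        simp only
        rw [Real.fourier_eq', ← integral_const_mul]
        refine integral_congr_ae (ae_of_all _ fun s => ?_)
        simp only [smul_eq_mul]
        -- The phase splits into a part depending on t only and a part linear in s. The latter is
        -- the Fourier kernel at the frequency ⟨rot γ(σ), ω⟩, whose sign comes from ⟨rot γ, ω⟩ =
        -- -⟨γ, rot ω⟩.
        have e : (2 * Real.pi * Complex.I * (inner ℝ (Γ.γ σ) (t • ω + s • rot ω) : ℝ) : ℂ) =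
            2 * Real.pi * Complex.I * (t * inner ℝ (Γ.γ σ) ω : ℝ) +
            (-2 * Real.pi * inner ℝ s (inner ℝ (rot (Γ.γ σ)) ω) : ℝ) * Complex.I := by
          rw [inner_rot_left]
          simp only [inner_add_right, real_inner_smul_right, RCLike.inner_apply, conj_trivial]
          push_cast
          ring
        rw [e, Complex.exp_add]
        ring

end CompactC2Curve

/-! ### Duality in L^q on the line -/

/-- An `L^q` bound by duality, tested on bounded functions of bounded support. -/
theorem lintegral_rpow_le_of_forall_integral_mul_le {r q : ℝ} (hrq : r.HolderConjugate q)
    (hq : 2 ≤ q) {F : ℝ → ℂ} (hF : Continuous F) {D : ℝ≥0∞}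
    (h : ∀ g : ℝ → ℂ, Measurable g → Integrable g → MemLp g 2 →
      ‖∫ s, F s * g s‖ₑ ≤ D * (∫⁻ s, ‖g s‖ₑ ^ r) ^ (1 / r)) :
    (∫⁻ s, ‖F s‖ₑ ^ q) ^ (1 / q) ≤ D := by
  have hq0 : 0 < q := by linarith
  have hr0 : 0 < r := hrq.pos
  have hbound : ∀ n : ℕ, ∫⁻ s in Icc (-(n : ℝ)) n, ‖F s‖ₑ ^ q ≤ D ^ q := by
    intro n
    set I := ∫⁻ s in Icc (-(n : ℝ)) n, ‖F s‖ₑ ^ q with hI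
    -- The extremizer of the duality pairing, cut off to a bounded interval so that I is finite and
    -- can be cancelled later. Continuity of |F|^{q-2} at the zeros of F uses q ≥ 2.
    set g : ℝ → ℂ := (Icc (-(n : ℝ)) n).indicator
      fun s => (starRingEnd ℂ) (F s) * ((‖F s‖ ^ (q - 2) : ℝ) : ℂ) with hg
    have hgc : Continuous fun s => (starRingEnd ℂ) (F s) * ((‖F s‖ ^ (q - 2) : ℝ) : ℂ) := by
      refine (Complex.continuous_conj.comp hF).mul (Complex.continuous_ofReal.comp ?_)
      exact hF.norm.rpow_const fun s => Or.inr (by linarith)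
    have hgm : Measurable g := hgc.measurable.indicator measurableSet_Icc
    have hgi : Integrable g := (integrable_indicator_iff measurableSet_Icc).2
      hgc.continuousOn.integrableOn_Icc
    obtain ⟨B, hB⟩ := isCompact_Icc.exists_bound_of_continuousOn
      (hgc.continuousOn (s := Icc (-(n : ℝ)) n))
    have hg2 : MemLp g 2 := by
      refine (memLp_indicator_iff_restrict measurableSet_Icc).2 ?_
      exact MemLp.of_bound hgc.aestronglyMeasurable B
        ((ae_restrict_mem measurableSet_Icc).mono fun s hs => hB s hs)
    have hnorm : ∀ s, ‖F s‖ * (‖F s‖ * ‖F s‖ ^ (q - 2)) = ‖F s‖ ^ q := fun s => by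
      rcases (norm_nonneg (F s)).eq_or_lt with h0 | h0
      · rw [← h0, Real.zero_rpow hq0.ne']; ring
      · conv_rhs => rw [show q = 1 + (1 + (q - 2)) by ring, Real.rpow_add h0, Real.rpow_add h0,
          Real.rpow_one]
    have hItop : I ≠ ∞ := by
      have : IntegrableOn (fun s => ‖F s‖ ^ q) (Icc (-(n : ℝ)) n) :=
        (hF.norm.rpow_const fun s => Or.inr hq0.le).continuousOn.integrableOn_Icc
      rw [hI]
      refine ne_of_lt (lt_of_le_of_lt (lintegral_mono fun s => ?_) this.2)
      rw [enorm_rpow_eq_ofReal _ hq0.le, Real.enorm_eq_ofReal (by positivity)]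
    have h1 : ∫ s, F s * g s = (I.toReal : ℂ) := by
      have : ∀ s, F s * g s =
          (Icc (-(n : ℝ)) n).indicator (fun s => ((‖F s‖ ^ q : ℝ) : ℂ)) s := fun s => by
        by_cases hs : s ∈ Icc (-(n : ℝ)) n
        · simp only [hg, indicator_of_mem hs]
          rw [← mul_assoc, Complex.mul_conj, ← hnorm s, Complex.normSq_eq_norm_sq]
          push_cast
          ring
        · simp only [hg, indicator_of_notMem hs, mul_zero]
      simp_rw [this]
      rw [integral_indicator measurableSet_Icc, integral_complex_ofReal,
        integral_eq_lintegral_of_nonneg_ae (ae_of_all _ fun s => by positivity)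
          (hF.norm.rpow_const fun s => Or.inr hq0.le).aestronglyMeasurable]
      simp_rw [← enorm_rpow_eq_ofReal _ hq0.le]
      rfl
    have h2 : ∫⁻ s, ‖g s‖ₑ ^ r = I := by
      rw [lintegral_enorm_indicator_rpow _ measurableSet_Icc hr0, hI]
      refine lintegral_congr fun s => ?_
      rw [enorm_rpow_eq_ofReal _ hr0.le, enorm_rpow_eq_ofReal _ hq0.le]
      congr 1
      rw [norm_mul, RCLike.norm_conj, Complex.norm_real, Real.norm_of_nonneg (by positivity)]
      rcases (norm_nonneg (F s)).eq_or_lt with h0 | h0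
      · rw [← h0, Real.zero_rpow hq0.ne', zero_mul, Real.zero_rpow hr0.ne']
      · conv_lhs => rw [← Real.rpow_one_add' h0.le (by linarith), ← Real.rpow_mul h0.le]
        congr 1
        linarith [hrq.mul_eq_add]
    have h3 := h g hgm hgi hg2
    rw [h1, h2, ← ofReal_norm, Complex.norm_real, Real.norm_of_nonneg ENNReal.toReal_nonneg,
      ENNReal.ofReal_toReal hItop] at h3
    rcases eq_or_ne I 0 with h0 | h0
    · rw [h0]; exact zero_le
    · have h4 : I ^ (1 / q) ≤ D := by
        have hne : I ^ (1 / r) ≠ 0 := by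
          simp [ENNReal.rpow_eq_zero_iff, h0, hItop]
        have hne' : I ^ (1 / r) ≠ ∞ := ENNReal.rpow_ne_top_of_nonneg (by positivity) hItop
        rw [← ENNReal.mul_le_mul_iff_left hne hne', ← ENNReal.rpow_add _ _ h0 hItop]
        have : 1 / q + 1 / r = 1 := by
          have := hrq.inv_add_inv_eq_one
          simp only [one_div]; linarith
        rwa [this, ENNReal.rpow_one]
      calc I = (I ^ (1 / q)) ^ q := by
            rw [← ENNReal.rpow_mul, one_div_mul_cancel hq0.ne', ENNReal.rpow_one]
        _ ≤ D ^ q := by gcongr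
  have hlim : ∫⁻ s, ‖F s‖ₑ ^ q ≤ D ^ q := by
    have hcov : AECover (volume : Measure ℝ) atTop fun n : ℕ => Icc (-(n : ℝ)) n :=
      aecover_Icc (tendsto_neg_atTop_atBot.comp tendsto_natCast_atTop_atTop)
        tendsto_natCast_atTop_atTop
    exact le_of_tendsto' (hcov.lintegral_tendsto_of_countably_generated
      (hF.enorm.measurable.pow_const q).aemeasurable) hbound
  calc (∫⁻ s, ‖F s‖ₑ ^ q) ^ (1 / q) ≤ (D ^ q) ^ (1 / q) := by gcongr
    _ = D := by rw [← ENNReal.rpow_mul, mul_one_div_cancel hq0.ne', ENNReal.rpow_one]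

end

/-! ### Coordinates on the strip, and reduction of (S) and (R) to a one-variable bound -/

noncomputable section

theorem orthonormal_self_rot {ω : Plane} (hω : ‖ω‖ = 1) : Orthonormal ℝ ![ω, rot ω] := by
  rw [orthonormal_iff_ite]
  intro i j
  fin_cases i <;> fin_cases j <;>
    simp [inner_rot_self, hω, norm_rot, real_inner_comm]

/-- The coordinates adapted to the direction `ω` preserve Lebesgue measure. -/
theorem measurePreserving_smul_add_smul_rot {ω : Plane} (hω : ‖ω‖ = 1) :
    MeasurePreserving (fun z : ℝ × ℝ => z.1 • ω + z.2 • rot ω) (volume.prod volume) volume := by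
  have hcard : Fintype.card (Fin 2) = Module.finrank ℝ Plane := by simp
  set b := (basisOfOrthonormalOfCardEqFinrank (orthonormal_self_rot hω) hcard).toOrthonormalBasis
    (by simpa using orthonormal_self_rot hω) with hb
  have h1 : MeasurePreserving (MeasurableEquiv.finTwoArrow (α := ℝ)).symm
      (volume.prod volume) volume := (volume_preserving_finTwoArrow ℝ).symm
  have h2 := PiLp.volume_preserving_toLp (Fin 2)
  have h3 := (b.measurePreserving_repr_symm.comp h2).comp h1
  convert h3 using 1
  funext z
  have hz := (b.sum_repr_symm (WithLp.toLp 2 ![z.1, z.2])).symm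
  simp only [Function.comp]
  refine Eq.trans ?_ hz.symm
  simp [Fin.sum_univ_two, hb]

theorem inner_smul_add_smul_rot {ω : Plane} (hω : ‖ω‖ = 1) (t s : ℝ) :
    inner ℝ (t • ω + s • rot ω) ω = t := by
  rw [inner_add_left, real_inner_smul_left, real_inner_smul_left, inner_rot_left, inner_rot_self,
    real_inner_self_eq_norm_sq, hω]
  ring

theorem measurableSet_strip (ω : Plane) (t : ℝ) : MeasurableSet (strip ω t) :=
  measurableSet_le (by fun_prop) measurable_const

theorem smul_add_smul_rot_mem_strip {ω : Plane} (hω : ‖ω‖ = 1) {t t' s : ℝ} :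
    t' • ω + s • rot ω ∈ strip ω t ↔ t' ∈ Icc (t - 1 / 2) (t + 1 / 2) := by
  rw [strip, mem_ofPred_eq, inner_smul_add_smul_rot hω, abs_le, mem_Icc]
  constructor <;> rintro ⟨h1, h2⟩ <;> constructor <;> linarith

theorem setLIntegral_strip {ω : Plane} (hω : ‖ω‖ = 1) (t : ℝ) {φ : Plane → ℝ≥0∞}
    (hφ : Measurable φ) :
    ∫⁻ x in strip ω t, φ x =
      ∫⁻ t' in Icc (t - 1 / 2) (t + 1 / 2), ∫⁻ s : ℝ, φ (t' • ω + s • rot ω) := by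
  rw [← lintegral_indicator (measurableSet_strip ω t),
    ← (measurePreserving_smul_add_smul_rot hω).lintegral_comp
      (hφ.indicator (measurableSet_strip ω t)),
    lintegral_prod (fun z : ℝ × ℝ => (strip ω t).indicator φ (z.1 • ω + z.2 • rot ω))
      ((hφ.indicator (measurableSet_strip ω t)).comp
        (measurePreserving_smul_add_smul_rot hω).measurable).aemeasurable,
    ← lintegral_indicator measurableSet_Icc]
  refine lintegral_congr fun t' => ?_
  by_cases h : t' ∈ Icc (t - 1 / 2) (t + 1 / 2)
  · rw [indicator_of_mem h]
    refine lintegral_congr fun s => ?_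
    rw [indicator_of_mem ((smul_add_smul_rot_mem_strip hω).2 h)]
  · rw [indicator_of_notMem h]
    refine (lintegral_congr fun s => ?_).trans lintegral_zero
    rw [indicator_of_notMem fun h' => h ((smul_add_smul_rot_mem_strip hω).1 h')]

theorem radonRoot_of_ne_top {F : Plane → ℂ} (hF : Continuous F) {q : ℝ≥0∞} (hq : q ≠ ∞)
    (ω : Plane) (t : ℝ) :
    radonRoot F q ω t =
      (∫⁻ s : ℝ, ‖F (t • ω + s • rot ω)‖ₑ ^ q.toReal) ^ (1 / q.toReal) := by
  rw [radonRoot, if_neg hq, radon, lineMeasure, lintegral_map (by fun_prop) (by fun_prop)]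

theorem eLpNorm_strip {ω : Plane} (hω : ‖ω‖ = 1) {F : Plane → ℂ} (hF : Continuous F) {q : ℝ≥0∞}
    (hq0 : q ≠ 0) (hq : q ≠ ∞) (t : ℝ) :
    eLpNorm F q (volume.restrict (strip ω t)) =
      (∫⁻ t' in Icc (t - 1 / 2) (t + 1 / 2), ∫⁻ s : ℝ,
        ‖F (t' • ω + s • rot ω)‖ₑ ^ q.toReal) ^ (1 / q.toReal) := by
  rw [eLpNorm_eq_lintegral_rpow_enorm_toReal hq0 hq,
    setLIntegral_strip hω t (hF.enorm.measurable.pow_const _)]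

variable {Γ : CompactC2Curve} {ω : Plane} {p q : ℝ≥0∞}

theorem exists_enorm_extension_le (Γ : CompactC2Curve) {p : ℝ≥0∞} (hp : 1 ≤ p) :
    ∃ C : ℝ≥0, ∀ (f : SchwartzMap Plane ℂ) (x : Plane),
      ‖Γ.extension f x‖ₑ ≤ C * eLpNorm f p Γ.arcLength := by
  have hexp : 0 ≤ 1 / (1 : ℝ≥0∞).toReal - 1 / p.toReal := by
    rcases eq_or_ne p ∞ with rfl | hpt
    · simp
    · have : 1 ≤ p.toReal := by
        simpa using ENNReal.toReal_mono hpt hp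
      rw [ENNReal.toReal_one, sub_nonneg, one_div_one]
      exact (div_le_one (by linarith)).2 this
  refine ⟨(Γ.arcLength univ ^ (1 / (1 : ℝ≥0∞).toReal - 1 / p.toReal)).toNNReal, fun f x => ?_⟩
  rw [ENNReal.coe_toNNReal (ENNReal.rpow_ne_top_of_nonneg hexp (measure_ne_top _ _)), mul_comm]
  exact (CompactC2Curve.enorm_extension_le f x).trans
    (eLpNorm_le_eLpNorm_mul_rpow_measure_univ hp f.continuous.aestronglyMeasurable)

theorem radonEstimate_top (hp : 1 ≤ p) : RadonEstimate Γ ω p ∞ := by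
  obtain ⟨C, hC⟩ := exists_enorm_extension_le Γ hp
  refine ⟨C, fun f t => ?_⟩
  rw [radonRoot, if_pos rfl]
  exact essSup_le_of_ae_le _ (ae_of_all _ fun x => hC f x)

theorem stripEstimate_top (hp : 1 ≤ p) : StripEstimate Γ ω p ∞ := by
  obtain ⟨C, hC⟩ := exists_enorm_extension_le Γ hp
  refine ⟨C, fun f t => ?_⟩
  rw [eLpNorm_exponent_top]
  exact essSup_le_of_ae_le _ (ae_of_all _ fun x => hC f x)

/-- The strip has width one, so the integral of the q-th power over it is an average of the
integrals over parallel lines, all bounded by the same constant. -/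
theorem RadonEstimate.stripEstimate (h : RadonEstimate Γ ω p q) (hω : ‖ω‖ = 1) (hp : 1 ≤ p)
    (hq : 1 ≤ q) : StripEstimate Γ ω p q := by
  rcases eq_or_ne q ∞ with rfl | hqt
  · exact stripEstimate_top hp
  have hq0 : q ≠ 0 := (zero_lt_one.trans_le hq).ne'
  have hqr : 0 < q.toReal := ENNReal.toReal_pos hq0 hqt
  obtain ⟨C, hC⟩ := h
  refine ⟨C, fun f t => ?_⟩
  have hF := CompactC2Curve.continuous_extension (Γ := Γ) f
  rw [eLpNorm_strip hω hF hq0 hqt, one_div q.toReal, ENNReal.rpow_inv_le_iff hqr]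
  calc ∫⁻ t' in Icc (t - 1 / 2) (t + 1 / 2), ∫⁻ s : ℝ, ‖Γ.extension f (t' • ω + s • rot ω)‖ₑ ^ q.toReal
      ≤ ∫⁻ t' in Icc (t - 1 / 2) (t + 1 / 2), (C * eLpNorm f p Γ.arcLength) ^ q.toReal := by
        refine lintegral_mono fun t' => ?_
        have := hC f t'
        rwa [radonRoot_of_ne_top hF hqt, one_div, ENNReal.rpow_inv_le_iff hqr] at this
    _ = (C * eLpNorm f p Γ.arcLength) ^ q.toReal := by
        rw [setLIntegral_const, Real.volume_Icc, show t + 1 / 2 - (t - 1 / 2) = 1 by ring]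
        simp

theorem StripEstimate.stripEstimateAt (h : StripEstimate Γ ω p q) (t : ℝ) :
    StripEstimateAt Γ ω p q t :=
  let ⟨C, hC⟩ := h
  ⟨C, fun f => hC f t⟩

/-- After passing to the adjoint, Hölder's inequality with the conjugate exponents P and p separates
f from ĝ ∘ H. The phase in t has modulus one, hence a constant uniform in t. -/
theorem radonEstimate_of_fourierCompBound {r Q P : ℝ} (hrq : r.HolderConjugate Q) (hQ : 2 ≤ Q)
    (hP : 0 < P) (hpP : (ENNReal.ofReal P).HolderConjugate p)
    (h : FourierCompBound (fun σ => inner ℝ (rot (Γ.γ σ)) ω) (Icc Γ.a Γ.b) P r) :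
    RadonEstimate Γ ω p (ENNReal.ofReal Q) := by
  obtain ⟨C, hC⟩ := h
  obtain ⟨L, hL⟩ := Γ.exists_paramMeasure_le
  refine ⟨(L * C) ^ (1 / P), fun f t => ?_⟩
  have hF := CompactC2Curve.continuous_extension (Γ := Γ) f
  rw [radonRoot_of_ne_top hF ENNReal.ofReal_ne_top, ENNReal.toReal_ofReal (by linarith)]
  refine lintegral_rpow_le_of_forall_integral_mul_le hrq hQ (by fun_prop) fun g hgm hg hg2 => ?_
  have hγ := Γ.continuous_γ
  have hH : Continuous fun σ => inner ℝ (rot (Γ.γ σ)) ω := by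
    simp only [inner_rot_left]; fun_prop
  have hG : Continuous fun σ => 𝓕 g (inner ℝ (rot (Γ.γ σ)) ω) :=
    (continuous_fourier_of_integrable hg).comp hH
  have hr0 : 0 < r := hrq.pos
  calc ‖∫ s : ℝ, Γ.extension f (t • ω + s • rot ω) * g s‖ₑ
      ≤ ∫⁻ σ, ‖𝓕 g (inner ℝ (rot (Γ.γ σ)) ω) * f (Γ.γ σ)‖ₑ ∂Γ.paramMeasure := by
        rw [CompactC2Curve.integral_extension_mul f ω t hg]
        refine (enorm_integral_le_lintegral_enorm _).trans_eq (lintegral_congr fun σ => ?_)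
        rw [enorm_mul, enorm_mul, enorm_mul, enorm_exp_two_pi_I_mul, mul_one, mul_comm]
    _ ≤ eLpNorm (fun σ => 𝓕 g (inner ℝ (rot (Γ.γ σ)) ω)) (ENNReal.ofReal P) Γ.paramMeasure *
          eLpNorm (f ∘ Γ.γ) p Γ.paramMeasure := by
        have := eLpNorm_smul_le_mul_eLpNorm (r := 1)
          (f.continuous.comp Γ.continuous_γ).aestronglyMeasurable
          (hG.aestronglyMeasurable (μ := Γ.paramMeasure)) (p := ENNReal.ofReal P) (q := p)
        rw [eLpNorm_one_eq_lintegral_enorm] at this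
        exact this
    _ ≤ ((L * C : ℝ≥0∞) * (∫⁻ s, ‖g s‖ₑ ^ r) ^ (P / r)) ^ (1 / P) *
          eLpNorm f p Γ.arcLength := by
        rw [CompactC2Curve.eLpNorm_arcLength f.continuous]
        gcongr
        rw [eLpNorm_eq_lintegral_rpow_enorm_toReal (by simpa using hP) ENNReal.ofReal_ne_top,
          ENNReal.toReal_ofReal hP.le]
        gcongr
        refine (lintegral_mono' hL le_rfl).trans ?_
        rw [lintegral_smul_measure, smul_eq_mul, mul_assoc]
        gcongr
        exact hC g hgm hg hg2
    _ = _ := by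
        rw [ENNReal.mul_rpow_of_nonneg _ _ (by positivity), ← ENNReal.rpow_mul,
          ENNReal.coe_rpow_of_nonneg _ (by positivity), ENNReal.coe_mul]
        have : P / r * (1 / P) = 1 / r := by field_simp
        rw [this]; ring

namespace CompactC2Curve

theorem hasDerivAt_inner_rot (Γ : CompactC2Curve) (ω : Plane) (s : ℝ) :
    HasDerivAt (fun σ => inner ℝ (rot (Γ.γ σ)) ω) (inner ℝ (rot (deriv Γ.γ s)) ω) s := by
  simp only [inner_rot_left]
  have h := ((Γ.hasDerivAt_γ s).inner ℝ (hasDerivAt_const s (rot ω))).neg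
  rw [inner_zero_right, zero_add] at h
  exact h

theorem hasDerivAt_inner_rot_deriv (Γ : CompactC2Curve) (ω : Plane) (s : ℝ) :
    HasDerivAt (fun σ => inner ℝ (rot (deriv Γ.γ σ)) ω)
      (inner ℝ (rot (deriv (deriv Γ.γ) s)) ω) s := by
  simp only [inner_rot_left]
  have h := ((Γ.hasDerivAt_deriv s).inner ℝ (hasDerivAt_const s (rot ω))).neg
  rw [inner_zero_right, zero_add] at h
  exact h

theorem inner_normal_ne_zero_iff {s : ℝ} (hs : s ∈ Icc Γ.a Γ.b) :
    inner ℝ (Γ.normal s) ω ≠ 0 ↔ inner ℝ (rot (deriv Γ.γ s)) ω ≠ 0 := by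
  rw [normal, real_inner_smul_left]
  simp [Γ.regular s hs]

/-- If both derivatives of H vanished, γ' and γ'' would both be parallel to ω, so their determinant,
and with it the curvature, would be zero. The curvature hypothesis enters only here: it makes the
critical points of H nondegenerate. -/
theorem inner_rot_deriv_deriv_ne_zero (hω : ω ≠ 0) {s : ℝ} (hcurv : Γ.curvature s ≠ 0)
    (h : inner ℝ (rot (deriv Γ.γ s)) ω = 0) : inner ℝ (rot (deriv (deriv Γ.γ) s)) ω ≠ 0 := by
  intro h'
  refine hcurv ?_
  rw [inner_plane] at h h'
  simp only [rot, PiLp.toLp_apply, Matrix.cons_val_zero, Matrix.cons_val_one] at h h'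
  set v := deriv Γ.γ s
  set w := deriv (deriv Γ.γ) s
  have h0 : ω 0 * (v 0 * w 1 - v 1 * w 0) = 0 := by linear_combination v 0 * (-h') + w 0 * h
  have h1 : ω 1 * (v 0 * w 1 - v 1 * w 0) = 0 := by linear_combination w 1 * h - v 1 * h'
  have hdet : v 0 * w 1 - v 1 * w 0 = 0 := by
    by_contra hne
    refine hω ?_
    ext i
    fin_cases i
    · exact (mul_eq_zero.1 h0).resolve_right hne
    · exact (mul_eq_zero.1 h1).resolve_right hne
  rw [curvature]
  simp only [v, w] at hdet
  rw [hdet, zero_div]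

end CompactC2Curve

end

/-! ### Arithmetic of the exponents and sufficiency -/

noncomputable section

theorem one_div_eq_ofReal {p : ℝ≥0∞} (hp : 1 ≤ p) : 1 / p = ENNReal.ofReal p⁻¹.toReal := by
  rw [ENNReal.ofReal_toReal, one_div]
  exact ENNReal.inv_ne_top.2 (zero_lt_one.trans_le hp).ne'

theorem natCast_div_eq_ofReal {q : ℝ≥0∞} (hq : 1 ≤ q) (hqt : q ≠ ∞) (k : ℕ) :
    k / q = ENNReal.ofReal (k / q.toReal) := by
  have hq0 : 0 < q.toReal := ENNReal.toReal_pos (zero_lt_one.trans_le hq).ne' hqt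
  rw [ENNReal.ofReal_div_of_pos hq0, ENNReal.ofReal_toReal hqt, ENNReal.ofReal_natCast]

theorem one_div_add_div_le_one_iff {p q : ℝ≥0∞} (hp : 1 ≤ p) (hq : 1 ≤ q) (hqt : q ≠ ∞) (k : ℕ) :
    1 / p + k / q ≤ 1 ↔ p⁻¹.toReal + k / q.toReal ≤ 1 := by
  rw [one_div_eq_ofReal hp, natCast_div_eq_ofReal hq hqt,
    ← ENNReal.ofReal_add ENNReal.toReal_nonneg (by positivity), ENNReal.ofReal_le_one]

theorem one_div_add_div_lt_one_iff {p q : ℝ≥0∞} (hp : 1 ≤ p) (hq : 1 ≤ q) (hqt : q ≠ ∞) (k : ℕ) :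
    1 / p + k / q < 1 ↔ p⁻¹.toReal + k / q.toReal < 1 := by
  rw [one_div_eq_ofReal hp, natCast_div_eq_ofReal hq hqt,
    ← ENNReal.ofReal_add ENNReal.toReal_nonneg (by positivity), ENNReal.ofReal_lt_one]

theorem one_le_toReal {q : ℝ≥0∞} (hq : 1 ≤ q) (hqt : q ≠ ∞) : 1 ≤ q.toReal := by
  simpa using ENNReal.toReal_mono hqt hq

theorem holderConjugate_ofReal {p : ℝ≥0∞} (hp : 1 ≤ p) (h1 : p⁻¹.toReal < 1) :
    (ENNReal.ofReal (1 - p⁻¹.toReal)⁻¹).HolderConjugate p := by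
  have e : p⁻¹ = ENNReal.ofReal p⁻¹.toReal := by rw [← one_div_eq_ofReal hp, one_div]
  have h0 : 0 ≤ p⁻¹.toReal := ENNReal.toReal_nonneg
  rw [ENNReal.holderConjugate_iff]
  generalize p⁻¹.toReal = x at *
  rw [e, ENNReal.ofReal_inv_of_pos (by linarith), inv_inv, ← ENNReal.ofReal_add (by linarith) h0]
  simp

theorem inv_toReal_le_inv_toReal {p q : ℝ≥0∞} (hp : 1 ≤ p) (hpq : p ≤ q) :
    q⁻¹.toReal ≤ p⁻¹.toReal :=
  ENNReal.toReal_mono (ENNReal.inv_ne_top.2 (zero_lt_one.trans_le hp).ne') (ENNReal.inv_le_inv.2 hpq)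

variable {Γ : CompactC2Curve} {ω : Plane} {p q : ℝ≥0∞}

/-- Here 1/p + 1/q ≤ 1 says p' ≤ q, so the exponent q given by Hausdorff–Young may be lowered to p'
on the bounded parameter interval; q ≥ 2 is what Hausdorff–Young needs. -/
theorem radonEstimate_of_transversal (ht : Γ.Transversal ω) (hp : 1 ≤ p) (hq : 1 ≤ q)
    (h : 1 / p + 1 / q ≤ 1) (hq2 : 2 ≤ q) : RadonEstimate Γ ω p q := by
  rcases eq_or_ne q ∞ with rfl | hqt
  · exact radonEstimate_top hp
  have hQ2 : 2 ≤ q.toReal := by simpa using ENNReal.toReal_mono hqt hq2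
  have h' : p⁻¹.toReal + 1 / q.toReal ≤ 1 := by
    simpa using (one_div_add_div_le_one_iff hp hq hqt 1).1 (by simpa using h)
  have hq0 : 0 < 1 / q.toReal := by positivity
  have hx : p⁻¹.toReal < 1 := by linarith
  have hP : 0 < (1 - p⁻¹.toReal)⁻¹ := inv_pos.2 (by linarith)
  have hconj := (Real.HolderConjugate.conjExponent (p := q.toReal) (by linarith)).symm
  have hPq : (1 - p⁻¹.toReal)⁻¹ ≤ q.toReal := by
    refine inv_le_of_inv_le₀ (by positivity) ?_
    rw [← one_div]; linarith
  have hHc : Continuous fun σ => inner ℝ (rot (Γ.γ σ)) ω :=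
    continuous_iff_continuousAt.2 fun σ => (Γ.hasDerivAt_inner_rot ω σ).continuousAt
  have hHc' : Continuous fun σ => inner ℝ (rot (deriv Γ.γ σ)) ω :=
    continuous_iff_continuousAt.2 fun σ => (Γ.hasDerivAt_inner_rot_deriv ω σ).continuousAt
  have hr2 : Real.conjExponent q.toReal ≤ 2 := by
    rw [Real.conjExponent, div_le_iff₀ (by linarith)]; linarith
  have hb := (fourierCompBound_of_deriv_ne_zero hconj hr2 (Γ.hasDerivAt_inner_rot ω) hHc'
    (isCompact_Icc (a := Γ.a) (b := Γ.b)) fun s hs =>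
      (CompactC2Curve.inner_normal_ne_zero_iff hs).1 (ht s hs)).of_le hHc (by simp) hP hPq
  have := radonEstimate_of_fourierCompBound hconj hQ2 hP (holderConjugate_ofReal hp hx) hb
  rwa [ENNReal.ofReal_toReal hqt] at this

/-- The condition says p' ≤ q/2, with strict inequality if q < p. For q ≥ 3 the fold bound covers
equality; for q < 3 only strict inequality is covered, and there the hypothesis is strict. -/
theorem radonEstimate_of_curvature_ne_zero (hω : ‖ω‖ = 1)
    (hcurv : ∀ s ∈ Icc Γ.a Γ.b, Γ.curvature s ≠ 0) (hp : 1 ≤ p) (hq : 1 ≤ q)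
    (h : (p ≤ q → 1 / p + 2 / q ≤ 1) ∧ (q < p → 1 / p + 2 / q < 1)) : RadonEstimate Γ ω p q := by
  rcases eq_or_ne q ∞ with rfl | hqt
  · exact radonEstimate_top hp
  have hω0 : ω ≠ 0 := fun h0 => by simp [h0] at hω
  have hQ1 := one_le_toReal hq hqt
  have hx0 : 0 ≤ p⁻¹.toReal := ENNReal.toReal_nonneg
  have h' : p⁻¹.toReal + 2 / q.toReal ≤ 1 := by
    have : 1 / p + (2 : ℕ) / q ≤ 1 := by
      rcases le_or_gt p q with hpq | hpq
      · exact_mod_cast h.1 hpq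
      · exact_mod_cast (h.2 hpq).le
    exact_mod_cast (one_div_add_div_le_one_iff hp hq hqt 2).1 this
  have hq0 : 0 < 2 / q.toReal := by positivity
  have hx : p⁻¹.toReal < 1 := by linarith
  have hP : 0 < (1 - p⁻¹.toReal)⁻¹ := inv_pos.2 (by linarith)
  have hQ2 : 2 ≤ q.toReal := by
    have : 2 / q.toReal ≤ 1 := by linarith
    rwa [div_le_one (by linarith)] at this
  have hconj := (Real.HolderConjugate.conjExponent (p := q.toReal) (by linarith)).symm
  have hr2 : Real.conjExponent q.toReal ≤ 2 := by
    rw [Real.conjExponent, div_le_iff₀ (by linarith)]; linarith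
  have hPq : (1 - p⁻¹.toReal)⁻¹ < q.toReal / 2 ∨
      3 ≤ q.toReal ∧ (1 - p⁻¹.toReal)⁻¹ ≤ q.toReal / 2 := by
    rcases le_or_gt 3 q.toReal with h3 | h3
    · refine Or.inr ⟨h3, inv_le_of_inv_le₀ (by positivity) ?_⟩
      rw [inv_div]; linarith
    · left
      -- If p ≤ q, then 3/q ≤ 1/p + 2/q ≤ 1, contrary to q < 3.
      have hpq : q < p := by
        by_contra hpq
        have h1 := inv_toReal_le_inv_toReal hp (not_lt.1 hpq)
        rw [ENNReal.toReal_inv] at h1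
        have h2 : 3 * q.toReal⁻¹ ≤ 1 := by
          rw [div_eq_mul_inv] at h'; linarith
        rw [← div_eq_mul_inv, div_le_one (by linarith)] at h2
        linarith
      have h4 : 1 / p + (2 : ℕ) / q < 1 := by exact_mod_cast h.2 hpq
      have h5 : p⁻¹.toReal + 2 / q.toReal < 1 := by
        exact_mod_cast (one_div_add_div_lt_one_iff hp hq hqt 2).1 h4
      refine inv_lt_of_inv_lt₀ (by positivity) ?_
      rw [inv_div]; linarith
  have hb := fourierCompBound_of_nondegenerate hconj hr2 hP hPq (Γ.hasDerivAt_inner_rot ω)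
    (Γ.hasDerivAt_inner_rot_deriv ω) (isCompact_Icc (a := Γ.a) (b := Γ.b)) fun s hs h0 =>
      CompactC2Curve.inner_rot_deriv_deriv_ne_zero hω0 (hcurv s hs) h0
  have := radonEstimate_of_fourierCompBound hconj hQ2 hP (holderConjugate_ofReal hp hx) hb
  rwa [ENNReal.ofReal_toReal hqt] at this

end

/-! ### Random signs and Khintchine's inequality -/

noncomputable section

/-- The sign `+1` on `s` and `-1` off `s`. -/
def setSign (s : Finset ℕ) (k : ℕ) : ℝ := if k ∈ s then 1 else -1

theorem abs_setSign (s : Finset ℕ) (k : ℕ) : |setSign s k| = 1 := by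
  unfold setSign; split_ifs <;> simp

/-- The sum of `z k` over `k < N`, with the signs given by `s`. -/
def signedSum (N : ℕ) (z : ℕ → ℂ) (s : Finset ℕ) : ℂ :=
  ∑ k ∈ Finset.range N, (setSign s k : ℂ) * z k

theorem signedSum_succ {N : ℕ} {z : ℕ → ℂ} {s : Finset ℕ} (hs : s ⊆ Finset.range N) :
    signedSum (N + 1) z s = signedSum N z s - z N := by
  have hN : N ∉ s := fun h => by simpa using hs h
  rw [signedSum, Finset.sum_range_succ, signedSum, setSign, if_neg hN]
  push_cast; ring

theorem signedSum_succ_insert (N : ℕ) (z : ℕ → ℂ) (s : Finset ℕ) :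
    signedSum (N + 1) z (insert N s) = signedSum N z s + z N := by
  rw [signedSum, Finset.sum_range_succ, signedSum, setSign, if_pos (Finset.mem_insert_self _ _)]
  congr 1
  · refine Finset.sum_congr rfl fun k hk => ?_
    have : k ≠ N := (Finset.mem_range.1 hk).ne
    simp [setSign, this]
  · simp

theorem sum_powerset_signedSum_succ (N : ℕ) (z : ℕ → ℂ) (φ : ℂ → ℝ) :
    ∑ s ∈ (Finset.range (N + 1)).powerset, φ (signedSum (N + 1) z s) =
      ∑ s ∈ (Finset.range N).powerset, (φ (signedSum N z s - z N) + φ (signedSum N z s + z N)) := by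
  rw [Finset.range_add_one, Finset.sum_powerset_insert (by simp), Finset.sum_add_distrib]
  congr 1
  · refine Finset.sum_congr rfl fun s hs => ?_
    rw [signedSum_succ (Finset.mem_powerset.1 hs)]
  · refine Finset.sum_congr rfl fun s _ => ?_
    rw [signedSum_succ_insert]

theorem norm_sub_sq_add_norm_add_sq (w z : ℂ) :
    ‖w - z‖ ^ 2 + ‖w + z‖ ^ 2 = 2 * (‖w‖ ^ 2 + ‖z‖ ^ 2) := by
  have := parallelogram_law_with_norm ℝ w z
  nlinarith

theorem norm_sub_pow_four_add_norm_add_pow_four_le (w z : ℂ) :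
    ‖w - z‖ ^ 4 + ‖w + z‖ ^ 4 ≤ 2 * (‖w‖ ^ 4 + 6 * (‖w‖ ^ 2 * ‖z‖ ^ 2) + ‖z‖ ^ 4) := by
  have h1 := norm_sub_sq_real w z
  have h2 := norm_add_sq_real w z
  have h3 := abs_real_inner_le_norm w z
  have h4 : (inner ℝ w z) ^ 2 ≤ (‖w‖ * ‖z‖) ^ 2 := sq_le_sq' (abs_le.1 h3).1 (abs_le.1 h3).2
  have e1 : ‖w - z‖ ^ 4 = (‖w - z‖ ^ 2) ^ 2 := by ring
  have e2 : ‖w + z‖ ^ 4 = (‖w + z‖ ^ 2) ^ 2 := by ring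
  rw [e1, e2, h1, h2]
  nlinarith

theorem sum_norm_signedSum_sq (N : ℕ) (z : ℕ → ℂ) :
    ∑ s ∈ (Finset.range N).powerset, ‖signedSum N z s‖ ^ 2 =
      2 ^ N * ∑ k ∈ Finset.range N, ‖z k‖ ^ 2 := by
  induction N with
  | zero => simp [signedSum]
  | succ N ih =>
    rw [sum_powerset_signedSum_succ N z fun w => ‖w‖ ^ 2]
    simp only [norm_sub_sq_add_norm_add_sq]
    rw [← Finset.mul_sum, Finset.sum_add_distrib, ih, Finset.sum_const, Finset.card_powerset,
      Finset.card_range, Finset.sum_range_succ, nsmul_eq_mul]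
    push_cast
    ring

/-- Induction on N: with S the sum of the first N squares, the term 6‖w‖²‖z_N‖² averages to 6S‖z_N‖²
by the second moment identity, which is precisely the cross term of 3(S + ‖z_N‖²)². -/
theorem sum_norm_signedSum_pow_four_le (N : ℕ) (z : ℕ → ℂ) :
    ∑ s ∈ (Finset.range N).powerset, ‖signedSum N z s‖ ^ 4 ≤
      2 ^ N * (3 * (∑ k ∈ Finset.range N, ‖z k‖ ^ 2) ^ 2) := by
  induction N with
  | zero => simp [signedSum]
  | succ N ih =>
    rw [sum_powerset_signedSum_succ N z fun w => ‖w‖ ^ 4]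
    refine (Finset.sum_le_sum fun s _ => norm_sub_pow_four_add_norm_add_pow_four_le _ _).trans ?_
    rw [← Finset.mul_sum, Finset.sum_add_distrib, Finset.sum_add_distrib, Finset.sum_const,
      ← Finset.mul_sum, ← Finset.sum_mul, sum_norm_signedSum_sq, Finset.card_powerset,
      Finset.card_range, Finset.sum_range_succ, nsmul_eq_mul]
    push_cast
    have h2 : (0 : ℝ) < 2 ^ N := by positivity
    rw [pow_succ (2 : ℝ) N]
    nlinarith [mul_nonneg h2.le (by positivity : (0 : ℝ) ≤ ‖z N‖ ^ 4)]

/-- Summed over all signs with A² a suitable multiple of the second moment, the quartic term is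
absorbed into the left side, leaving a lower bound for the q-th moment. For q ≥ 2 the next lemma
plays this part, with a constant as error term. -/
theorem sq_le_rpow_add_pow_four {y A q : ℝ} (hy : 0 ≤ y) (hA : 0 < A) (hq0 : 0 < q) (hq : q ≤ 2) :
    y ^ 2 ≤ A ^ (2 - q) * y ^ q + y ^ 4 / A ^ 2 := by
  rcases le_or_gt y A with h | h
  · have h1 : y ^ 2 ≤ A ^ (2 - q) * y ^ q := by
      rcases hy.eq_or_lt with h0 | h0
      · rw [← h0, Real.zero_rpow hq0.ne']; simp
      · calc y ^ 2 = y ^ (2 - q) * y ^ q := by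
              rw [← Real.rpow_add h0, sub_add_cancel, Real.rpow_two]
          _ ≤ _ := by gcongr
    have : 0 ≤ y ^ 4 / A ^ 2 := by positivity
    linarith
  · have h1 : y ^ 2 ≤ y ^ 4 / A ^ 2 := by
      rw [le_div_iff₀ (by positivity), show y ^ 4 = y ^ 2 * y ^ 2 by ring]
      gcongr
    have : 0 ≤ A ^ (2 - q) * y ^ q := by positivity
    linarith

theorem sq_le_rpow_add_sq {y A q : ℝ} (hy : 0 ≤ y) (hA : 0 < A) (hq : 2 ≤ q) :
    y ^ 2 ≤ A ^ (2 - q) * y ^ q + A ^ 2 := by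
  rcases le_or_gt y A with h | h
  · have h1 : y ^ 2 ≤ A ^ 2 := by gcongr
    have : 0 ≤ A ^ (2 - q) * y ^ q := by positivity
    linarith
  · have h0 : 0 < y := hA.trans h
    have h1 : y ^ 2 ≤ A ^ (2 - q) * y ^ q := by
      calc y ^ 2 = y ^ (2 - q) * y ^ q := by
            rw [← Real.rpow_add h0, sub_add_cancel, Real.rpow_two]
        _ ≤ _ := mul_le_mul_of_nonneg_right
            (Real.rpow_le_rpow_of_nonpos hA h.le (by linarith)) (by positivity)
    have : 0 ≤ A ^ 2 := by positivity
    linarith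

/-- The lower bound in Khintchine's inequality. -/
theorem exists_khintchine_lower {q : ℝ} (hq : 0 < q) :
    ∃ c : ℝ, 0 < c ∧ ∀ (N : ℕ) (z : ℕ → ℂ),
      2 ^ N * (c * (∑ k ∈ Finset.range N, ‖z k‖ ^ 2) ^ (q / 2)) ≤
        ∑ s ∈ (Finset.range N).powerset, ‖signedSum N z s‖ ^ q := by
  have key : ∃ B : ℝ, 0 < B ∧ ∀ (N : ℕ) (z : ℕ → ℂ), 0 < ∑ k ∈ Finset.range N, ‖z k‖ ^ 2 →
      2 ^ N * ((∑ k ∈ Finset.range N, ‖z k‖ ^ 2) / 2) ≤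
        (B * ∑ k ∈ Finset.range N, ‖z k‖ ^ 2) ^ ((2 - q) / 2) *
        ∑ s ∈ (Finset.range N).powerset, ‖signedSum N z s‖ ^ q := by
    have hsqrt : ∀ x : ℝ, 0 ≤ x → x ^ ((2 - q) / 2) = (√x) ^ (2 - q) := fun x hx => by
      rw [Real.sqrt_eq_rpow, ← Real.rpow_mul hx]; ring_nf
    rcases le_total q 2 with h2 | h2
    -- With A² = 6S, the fourth moment bound 3S² makes the error at most S/2, half of the second
    -- moment. For q ≥ 2 the choice A² = S/2 does the same.
    · refine ⟨6, by norm_num, fun N z hS => ?_⟩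
      set S := ∑ k ∈ Finset.range N, ‖z k‖ ^ 2 with hSdef
      have hA : 0 < √(6 * S) := Real.sqrt_pos.2 (by positivity)
      have h := Finset.sum_le_sum fun s (_ : s ∈ (Finset.range N).powerset) =>
        sq_le_rpow_add_pow_four (norm_nonneg (signedSum N z s)) hA hq h2
      rw [sum_norm_signedSum_sq, Finset.sum_add_distrib, ← Finset.mul_sum, ← Finset.sum_div,
        Real.sq_sqrt (by positivity)] at h
      rw [hsqrt _ (by positivity)]
      have h4 : (∑ s ∈ (Finset.range N).powerset, ‖signedSum N z s‖ ^ 4) / (6 * S) ≤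
          2 ^ N * (S / 2) := by
        rw [div_le_iff₀ (by positivity)]
        refine (sum_norm_signedSum_pow_four_le N z).trans_eq ?_
        rw [← hSdef]; ring
      linarith
    · refine ⟨1 / 2, by norm_num, fun N z hS => ?_⟩
      set S := ∑ k ∈ Finset.range N, ‖z k‖ ^ 2 with hSdef
      have hA : 0 < √(1 / 2 * S) := Real.sqrt_pos.2 (by positivity)
      have h := Finset.sum_le_sum fun s (_ : s ∈ (Finset.range N).powerset) =>
        sq_le_rpow_add_sq (norm_nonneg (signedSum N z s)) hA h2
      rw [sum_norm_signedSum_sq, Finset.sum_add_distrib, ← Finset.mul_sum, Finset.sum_const,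
        Finset.card_powerset, Finset.card_range, nsmul_eq_mul, Real.sq_sqrt (by positivity)] at h
      rw [hsqrt _ (by positivity)]
      push_cast at h
      linarith
  obtain ⟨B, hB, hkey⟩ := key
  refine ⟨(2 * B ^ ((2 - q) / 2))⁻¹, by positivity, fun N z => ?_⟩
  set S := ∑ k ∈ Finset.range N, ‖z k‖ ^ 2 with hSdef
  have hS0 : 0 ≤ S := Finset.sum_nonneg fun k _ => by positivity
  rcases hS0.eq_or_lt with h0 | h0
  · rw [← h0, Real.zero_rpow (by positivity), mul_zero, mul_zero]
    exact Finset.sum_nonneg fun s _ => by positivity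
  · have h := hkey N z h0
    rw [← hSdef, Real.mul_rpow hB.le hS0] at h
    have e : S = S ^ ((2 - q) / 2) * S ^ (q / 2) := by
      rw [← Real.rpow_add h0]; ring_nf; simp
    have hpos : 0 < S ^ ((2 - q) / 2) := by positivity
    have hBp : 0 < B ^ ((2 - q) / 2) := by positivity
    set b := B ^ ((2 - q) / 2)
    set σ := S ^ ((2 - q) / 2)
    set τ := S ^ (q / 2)
    set X := ∑ s ∈ (Finset.range N).powerset, ‖signedSum N z s‖ ^ q
    rw [e] at h
    have h' : σ * (2 ^ N * (τ / 2)) ≤ σ * (b * X) := by linarith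
    have h'' := le_of_mul_le_mul_left h' hpos
    calc 2 ^ N * ((2 * b)⁻¹ * τ) = b⁻¹ * (2 ^ N * (τ / 2)) := by
          rw [mul_inv]; ring
      _ ≤ b⁻¹ * (b * X) := by gcongr
      _ = X := inv_mul_cancel_left₀ hBp.ne' X

/-- If all signed sums of the `F k` are bounded in `L^q`, then so is their square function. -/
theorem exists_lintegral_squareFunction_le {q : ℝ} (hq : 0 < q) :
    ∃ c : ℝ, 0 < c ∧ ∀ {α : Type} [MeasurableSpace α] (μ : Measure α) (N : ℕ) (F : ℕ → α → ℂ)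
      (B : ℝ≥0∞), (∀ k, Measurable (F k)) →
      (∀ s, ∫⁻ x, ‖signedSum N (fun k => F k x) s‖ₑ ^ q ∂μ ≤ B) →
      ENNReal.ofReal c * ∫⁻ x, ENNReal.ofReal ((∑ k ∈ Finset.range N, ‖F k x‖ ^ 2) ^ (q / 2)) ∂μ
        ≤ B := by
  obtain ⟨c, hc, hK⟩ := exists_khintchine_lower hq
  refine ⟨c, hc, fun {α} _ μ N F B hF hB => ?_⟩
  have hm : ∀ s, Measurable fun x => signedSum N (fun k => F k x) s := fun s => by
    unfold signedSum
    exact Finset.measurable_fun_sum _ fun k _ => (hF k).const_mul _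
  have h2 : (2 : ℝ≥0∞) ^ N ≠ 0 := by simp
  have h2' : (2 : ℝ≥0∞) ^ N ≠ ∞ := by simp
  rw [← ENNReal.mul_le_mul_iff_right h2 h2']
  calc (2 : ℝ≥0∞) ^ N * (ENNReal.ofReal c *
        ∫⁻ x, ENNReal.ofReal ((∑ k ∈ Finset.range N, ‖F k x‖ ^ 2) ^ (q / 2)) ∂μ)
      = ∫⁻ x, ENNReal.ofReal
          (2 ^ N * (c * (∑ k ∈ Finset.range N, ‖F k x‖ ^ 2) ^ (q / 2))) ∂μ := by
        rw [← lintegral_const_mul' _ _ ENNReal.ofReal_ne_top, ← lintegral_const_mul' _ _ h2']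
        refine lintegral_congr fun x => ?_
        rw [ENNReal.ofReal_mul (by positivity), ENNReal.ofReal_mul hc.le,
          ENNReal.ofReal_pow (by norm_num)]
        simp
    _ ≤ ∫⁻ x, ∑ s ∈ (Finset.range N).powerset, ‖signedSum N (fun k => F k x) s‖ₑ ^ q ∂μ := by
        refine lintegral_mono fun x => ?_
        refine (ENNReal.ofReal_le_ofReal (hK N fun k => F k x)).trans_eq ?_
        rw [ENNReal.ofReal_sum_of_nonneg fun s _ => by positivity]
        refine Finset.sum_congr rfl fun s _ => ?_
        rw [enorm_rpow_eq_ofReal _ hq.le]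
    _ = ∑ s ∈ (Finset.range N).powerset, ∫⁻ x, ‖signedSum N (fun k => F k x) s‖ₑ ^ q ∂μ :=
        lintegral_finsetSum _ fun s _ => (hm s).enorm.pow_const q
    _ ≤ ∑ s ∈ (Finset.range N).powerset, B := Finset.sum_le_sum fun s _ => hB s
    _ = 2 ^ N * B := by simp

/-! ### Linearity and lower bounds for the extension -/

namespace CompactC2Curve

variable {Γ : CompactC2Curve}

theorem integrable_mul_exp (f : SchwartzMap Plane ℂ) (x : Plane) :
    Integrable (fun ξ => f ξ * Complex.exp (2 * Real.pi * Complex.I * (inner ℝ ξ x : ℝ)))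
      Γ.arcLength := by
  have hf := f.continuous
  refine Integrable.of_bound (Continuous.aestronglyMeasurable (by fun_prop))
    ‖f.toBoundedContinuousFunction‖ (ae_of_all _ fun ξ => ?_)
  rw [norm_mul, norm_exp_two_pi_I_mul, mul_one]
  exact f.toBoundedContinuousFunction.norm_coe_le_norm ξ

theorem extension_signedSum (N : ℕ) (f : ℕ → SchwartzMap Plane ℂ) (s : Finset ℕ) (x : Plane) :
    Γ.extension (∑ k ∈ Finset.range N, (setSign s k : ℂ) • f k : SchwartzMap Plane ℂ) x =
      signedSum N (fun k => Γ.extension (f k) x) s := by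
  simp only [extension, signedSum]
  simp_rw [← integral_const_mul]
  rw [← integral_finsetSum _ fun k _ => (integrable_mul_exp (f k) x).const_mul _]
  refine integral_congr_ae (ae_of_all _ fun ξ => ?_)
  simp [_root_.sum_apply, Finset.sum_mul, mul_assoc]

/-- The extension of a nonnegative function is large where the phase is almost stationary. -/
theorem half_integral_le_norm_extension {φ : Plane → ℝ} {f : SchwartzMap Plane ℂ}
    (hf : ∀ ξ, f ξ = φ ξ) (hφ : ∀ ξ, 0 ≤ φ ξ) (ξ₀ x : Plane)
    (h : ∀ s ∈ Icc Γ.a Γ.b, φ (Γ.γ s) ≠ 0 → |inner ℝ (Γ.γ s - ξ₀) x| ≤ 1 / 6) :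
    (∫ ξ, φ ξ ∂Γ.arcLength) / 2 ≤ ‖Γ.extension f x‖ := by
  have hφc : Continuous φ := by
    have : φ = fun ξ => (f ξ).re := funext fun ξ => by rw [hf]; simp
    rw [this]; exact Complex.continuous_re.comp f.continuous
  have hγ := Γ.continuous_γ
  have e1 : Complex.exp (2 * Real.pi * Complex.I * (-inner ℝ ξ₀ x : ℝ)) * Γ.extension f x =
      ∫ s, (φ (Γ.γ s) : ℂ) * Complex.exp (2 * Real.pi * Complex.I *
        (inner ℝ (Γ.γ s - ξ₀) x : ℝ)) ∂Γ.paramMeasure := by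
    rw [extension_eq f.continuous, ← integral_const_mul]
    refine integral_congr_ae (ae_of_all _ fun s => ?_)
    simp only [hf]
    rw [mul_left_comm, ← Complex.exp_add, inner_sub_left]
    congr 2
    push_cast
    ring
  have h_int : Integrable (fun s => (φ (Γ.γ s) : ℂ)) Γ.paramMeasure := by
    simpa [Function.comp_def, hf] using integrable_comp (Γ := Γ) f
  have h_int2 : Integrable (fun s => (φ (Γ.γ s) : ℂ) * Complex.exp (2 * Real.pi * Complex.I *
        (inner ℝ (Γ.γ s - ξ₀) x : ℝ))) Γ.paramMeasure := by
    refine h_int.mul_bdd (c := 1) (Continuous.aestronglyMeasurable (by fun_prop))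
      (ae_of_all _ fun s => (norm_exp_two_pi_I_mul _).le)
  have e2 : ‖Γ.extension f x‖ = ‖∫ s, (φ (Γ.γ s) : ℂ) * Complex.exp (2 * Real.pi * Complex.I *
        (inner ℝ (Γ.γ s - ξ₀) x : ℝ)) ∂Γ.paramMeasure‖ := by
    rw [← e1, norm_mul, norm_exp_two_pi_I_mul, one_mul]
  have e3 : ∫ ξ, φ ξ ∂Γ.arcLength = ∫ s, φ (Γ.γ s) ∂Γ.paramMeasure := by
    rw [arcLength_eq_map, integral_map hγ.measurable.aemeasurable hφc.aestronglyMeasurable]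
  have hmem : ∀ᵐ s ∂Γ.paramMeasure, s ∈ Icc Γ.a Γ.b :=
    (withDensity_absolutelyContinuous _ _).ae_le (ae_restrict_mem measurableSet_Icc)
  rw [e2, e3, ← integral_div]
  refine le_trans ?_ (Complex.re_le_norm _)
  rw [← RCLike.re_eq_complex_re, ← integral_re h_int2]
  refine integral_mono_ae (h_int.re.div_const 2) h_int2.re ?_
  filter_upwards [hmem] with s hs
  simp only [RCLike.re_eq_complex_re]
  rw [show (2 * Real.pi * Complex.I * (inner ℝ (Γ.γ s - ξ₀) x : ℝ) : ℂ) =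
    ((2 * Real.pi * inner ℝ (Γ.γ s - ξ₀) x : ℝ) : ℂ) * Complex.I by push_cast; ring,
    Complex.re_ofReal_mul, Complex.exp_ofReal_mul_I_re]
  rcases eq_or_ne (φ (Γ.γ s)) 0 with h0 | h0
  · simp [h0]
  · have h1 := h s hs h0
    -- A phase of at most 1/6 in absolute value is an angle of at most π/3.
    have h2 : 1 / 2 ≤ Real.cos (2 * Real.pi * inner ℝ (Γ.γ s - ξ₀) x) := by
      rw [← Real.cos_pi_div_three, ← Real.cos_abs (2 * Real.pi * _)]
      refine Real.cos_le_cos_of_nonneg_of_le_pi (abs_nonneg _) (by linarith [Real.pi_pos]) ?_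
      rw [abs_mul, abs_of_pos (by positivity : 0 < 2 * Real.pi)]
      nlinarith [Real.pi_pos]
    have h3 := hφ (Γ.γ s)
    nlinarith

end CompactC2Curve

end

/-! ### Local geometry of the curve: contact with lines, and arc length of balls -/

noncomputable section

theorem eventually_mul_abs_sub_le_norm_sub {E : Type*} [NormedAddCommGroup E] [NormedSpace ℝ E]
    {f : ℝ → E} {v : E} {τ : ℝ} (hf : HasDerivAt f v τ) (hv : v ≠ 0) :
    ∀ᶠ s in 𝓝 τ, ‖v‖ / 2 * |s - τ| ≤ ‖f s - f τ‖ := by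
  filter_upwards [hf.isLittleO.def (half_pos (norm_pos_iff.2 hv))] with s hs
  have h1 := norm_sub_norm_le ((s - τ) • v) (f s - f τ)
  rw [norm_sub_rev ((s - τ) • v), norm_smul, Real.norm_eq_abs] at h1
  rw [Real.norm_eq_abs] at hs
  linarith

theorem eventually_abs_sub_le_of_deriv_eq_zero {φ φ' : ℝ → ℝ} {d τ : ℝ}
    (hφ : ∀ s, HasDerivAt φ (φ' s) s) (hφ' : HasDerivAt φ' d τ) (h0 : φ' τ = 0) :
    ∃ K, 0 < K ∧ ∀ᶠ s in 𝓝 τ, |φ s - φ τ| ≤ K * |s - τ| ^ 2 := by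
  have hO := hφ'.isBigO_sub
  obtain ⟨K, hK, hO⟩ := hO.exists_pos
  refine ⟨K, hK, ?_⟩
  obtain ⟨δ, hδ, hball⟩ := Metric.eventually_nhds_iff_ball.1 hO.bound
  refine Metric.eventually_nhds_iff_ball.2 ⟨δ, hδ, fun s hs => ?_⟩
  rw [Real.ball_eq_Ioo] at hball hs
  have hτ : τ ∈ Ioo (τ - δ) (τ + δ) := ⟨by linarith, by linarith⟩
  have := (convex_uIcc τ s).norm_image_sub_le_of_norm_hasDerivWithin_le (f := φ) (f' := φ')
    (C := K * |s - τ|) (fun y _ => (hφ y).hasDerivWithinAt) ?_ left_mem_uIcc right_mem_uIcc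
  · rw [Real.norm_eq_abs, Real.norm_eq_abs] at this
    rw [sq, ← mul_assoc]; exact this
  · intro y hy
    have h1 := hball y (ordConnected_Ioo.uIcc_subset hτ hs hy)
    rw [h0, sub_zero, Real.norm_eq_abs, Real.norm_eq_abs] at h1
    rw [Real.norm_eq_abs]
    exact h1.trans (mul_le_mul_of_nonneg_left (abs_sub_left_of_mem_uIcc hy) hK.le)

namespace CompactC2Curve

variable {Γ : CompactC2Curve} {ω : Plane}

/-- Two distinct parameters in [a, b] share an image only at the endpoints of a closed curve, where
periodicity identifies the derivatives. Thus tangency to ω at a point does not depend on the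
parameter chosen for it. -/
theorem deriv_eq_of_apply_eq {s τ : ℝ} (hs : s ∈ Icc Γ.a Γ.b) (hτ : τ ∈ Icc Γ.a Γ.b)
    (h : Γ.γ s = Γ.γ τ) : deriv Γ.γ s = deriv Γ.γ τ := by
  rcases Γ.simple with hinj | ⟨hper, hinj⟩
  · rw [hinj hs hτ h]
  · have hdper : Function.Periodic (deriv Γ.γ) (Γ.b - Γ.a) := fun x => by
      rw [← deriv_comp_add_const]
      congr 1
      funext y
      exact hper y
    have red : ∀ x ∈ Icc Γ.a Γ.b, ∃ y ∈ Ico Γ.a Γ.b, Γ.γ y = Γ.γ x ∧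
        deriv Γ.γ y = deriv Γ.γ x := by
      intro x hx
      rcases hx.2.lt_or_eq with h1 | h1
      · exact ⟨x, ⟨hx.1, h1⟩, rfl, rfl⟩
      · refine ⟨Γ.a, ⟨le_rfl, Γ.lt⟩, ?_, ?_⟩
        · have := hper Γ.a
          rw [add_sub_cancel] at this
          rw [h1, this]
        · have := hdper Γ.a
          rw [add_sub_cancel] at this
          rw [h1, this]
    obtain ⟨s', hs', h1, h2⟩ := red s hs
    obtain ⟨τ', hτ', h3, h4⟩ := red τ hτ
    rw [← h2, ← h4, hinj hs' hτ' (by rw [h1, h3, h])]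

theorem abs_inner_rot_le (hω : ‖ω‖ = 1) (v : Plane) : |inner ℝ (rot v) ω| ≤ ‖v‖ := by
  have := abs_real_inner_le_norm (rot v) ω
  rwa [norm_rot, hω, mul_one] at this

theorem rot_sub (v w : Plane) : rot (v - w) = rot v - rot w := by
  ext i; fin_cases i <;> simp [rot]; ring

/-- At a point where the tangent is parallel to `ω`, the curve deviates quadratically from its
tangent line. -/
theorem exists_abs_inner_rot_sub_le_sq (hω : ‖ω‖ = 1) {s₀ : ℝ} (hs₀ : s₀ ∈ Icc Γ.a Γ.b)
    (h0 : inner ℝ (rot (deriv Γ.γ s₀)) ω = 0) :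
    ∃ K, 0 < K ∧ ∀ s ∈ Icc Γ.a Γ.b,
      |inner ℝ (rot (Γ.γ s - Γ.γ s₀)) ω| ≤ K * ‖Γ.γ s - Γ.γ s₀‖ ^ 2 := by
  refine isCompact_Icc.induction_on (p := fun T => ∃ K, 0 < K ∧ ∀ s ∈ T,
      |inner ℝ (rot (Γ.γ s - Γ.γ s₀)) ω| ≤ K * ‖Γ.γ s - Γ.γ s₀‖ ^ 2) ?_ ?_ ?_ ?_
  · exact ⟨1, one_pos, fun s hs => hs.elim⟩
  · rintro S T hST ⟨K, hK, h⟩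
    exact ⟨K, hK, fun s hs => h s (hST hs)⟩
  · rintro S T ⟨K, hK, h⟩ ⟨K', hK', h'⟩
    refine ⟨K + K', by positivity, fun s hs => ?_⟩
    have hn : 0 ≤ ‖Γ.γ s - Γ.γ s₀‖ ^ 2 := by positivity
    rcases hs with hs | hs
    · nlinarith [h s hs]
    · nlinarith [h' s hs]
  · intro τ hτ
    -- Near a parameter with the same image as s₀ the bound is second-order Taylor expansion
    -- combined with |γ(s) - γ(τ)| ≳ |s - τ|. Near any other parameter the distance to `Γ.γ s₀` is
    -- bounded below, and the trivial linear bound suffices.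
    by_cases hne : Γ.γ τ = Γ.γ s₀
    · have hd : deriv Γ.γ τ = deriv Γ.γ s₀ := deriv_eq_of_apply_eq hτ hs₀ hne
      have hreg := Γ.regular τ hτ
      have h1 := eventually_mul_abs_sub_le_norm_sub (Γ.hasDerivAt_γ τ) hreg
      obtain ⟨K, hK, h2⟩ := eventually_abs_sub_le_of_deriv_eq_zero (Γ.hasDerivAt_inner_rot ω)
        (Γ.hasDerivAt_inner_rot_deriv ω τ) (by rw [hd]; exact h0)
      have hc : 0 < ‖deriv Γ.γ τ‖ / 2 := half_pos (norm_pos_iff.2 hreg)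
      refine ⟨_, mem_nhdsWithin_of_mem_nhds (h1.and h2), K / (‖deriv Γ.γ τ‖ / 2) ^ 2,
        by positivity, fun s hs => ?_⟩
      obtain ⟨hs1, hs2⟩ := hs
      rw [← hne, rot_sub, inner_sub_left]
      refine hs2.trans ?_
      rw [div_mul_eq_mul_div, le_div_iff₀ (by positivity), mul_assoc, ← mul_pow]
      gcongr
      linarith
    · have hpos : 0 < ‖Γ.γ τ - Γ.γ s₀‖ := norm_pos_iff.2 (sub_ne_zero.2 hne)
      have hcont : Continuous fun s => ‖Γ.γ s - Γ.γ s₀‖ := (Γ.continuous_γ.sub continuous_const).norm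
      have hev : ∀ᶠ s in 𝓝 τ, ‖Γ.γ τ - Γ.γ s₀‖ / 2 < ‖Γ.γ s - Γ.γ s₀‖ :=
        hcont.continuousAt.eventually (lt_mem_nhds (half_lt_self hpos))
      refine ⟨_, mem_nhdsWithin_of_mem_nhds hev, 1 / (‖Γ.γ τ - Γ.γ s₀‖ / 2), by positivity,
        fun s hs => ?_⟩
      have hs' : ‖Γ.γ τ - Γ.γ s₀‖ / 2 < ‖Γ.γ s - Γ.γ s₀‖ := hs
      refine (abs_inner_rot_le hω _).trans ?_
      rw [div_mul_eq_mul_div, le_div_iff₀ (by positivity)]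
      nlinarith

/-- Near a preimage of the centre, |γ(s) - γ(τ)| ≳ |s - τ| confines s to an interval of length O(ρ).
Near any other parameter small balls miss the curve, and for the remaining radii a large constant is
enough. -/
theorem exists_arcLength_closedBall_le (Γ : CompactC2Curve) (s₀ : ℝ) :
    ∃ C : ℝ, 0 < C ∧ ∀ ρ, 0 < ρ →
      Γ.arcLength (Metric.closedBall (Γ.γ s₀) ρ) ≤ ENNReal.ofReal (C * ρ) := by
  have key : ∃ C : ℝ, 0 < C ∧ ∀ ρ, 0 < ρ →
      volume (Icc Γ.a Γ.b ∩ {s | ‖Γ.γ s - Γ.γ s₀‖ ≤ ρ}) ≤ ENNReal.ofReal (C * ρ) := by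
    refine isCompact_Icc.induction_on (p := fun T => ∃ C : ℝ, 0 < C ∧ ∀ ρ, 0 < ρ →
      volume (T ∩ {s | ‖Γ.γ s - Γ.γ s₀‖ ≤ ρ}) ≤ ENNReal.ofReal (C * ρ)) ?_ ?_ ?_ ?_
    · exact ⟨1, one_pos, fun ρ _ => by simp⟩
    · rintro S T hST ⟨C, hC, h⟩
      exact ⟨C, hC, fun ρ hρ => (measure_mono (inter_subset_inter_left _ hST)).trans (h ρ hρ)⟩
    · rintro S T ⟨C, hC, h⟩ ⟨C', hC', h'⟩
      refine ⟨C + C', by positivity, fun ρ hρ => ?_⟩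
      rw [union_inter_distrib_right, add_mul, ENNReal.ofReal_add (by positivity) (by positivity)]
      exact (measure_union_le _ _).trans (add_le_add (h ρ hρ) (h' ρ hρ))
    · intro τ hτ
      by_cases hne : Γ.γ τ = Γ.γ s₀
      · have hreg := Γ.regular τ hτ
        have h1 := eventually_mul_abs_sub_le_norm_sub (Γ.hasDerivAt_γ τ) hreg
        have hc : 0 < ‖deriv Γ.γ τ‖ / 2 := half_pos (norm_pos_iff.2 hreg)
        set c := ‖deriv Γ.γ τ‖ / 2
        refine ⟨_, mem_nhdsWithin_of_mem_nhds h1, 2 / c, by positivity, fun ρ hρ => ?_⟩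
        have hsub : {s | c * |s - τ| ≤ ‖Γ.γ s - Γ.γ τ‖} ∩ {s | ‖Γ.γ s - Γ.γ s₀‖ ≤ ρ} ⊆
            Metric.closedBall τ (ρ / c) := by
          rintro s ⟨hs1, hs2⟩
          have hs1' : c * |s - τ| ≤ ‖Γ.γ s - Γ.γ τ‖ := hs1
          have hs2' : ‖Γ.γ s - Γ.γ s₀‖ ≤ ρ := hs2
          rw [hne] at hs1'
          rw [Metric.mem_closedBall, Real.dist_eq, le_div_iff₀ hc]
          linarith
        refine (measure_mono hsub).trans_eq ?_
        rw [Real.volume_closedBall]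
        congr 1; ring
      · have hpos : 0 < ‖Γ.γ τ - Γ.γ s₀‖ := norm_pos_iff.2 (sub_ne_zero.2 hne)
        set e := ‖Γ.γ τ - Γ.γ s₀‖ / 2 with he
        have hcont : Continuous fun s => ‖Γ.γ s - Γ.γ s₀‖ :=
          (Γ.continuous_γ.sub continuous_const).norm
        have hev : ∀ᶠ s in 𝓝 τ, e < ‖Γ.γ s - Γ.γ s₀‖ :=
          hcont.continuousAt.eventually (lt_mem_nhds (half_lt_self hpos))
        refine ⟨_, mem_nhdsWithin_of_mem_nhds (hev.and (Metric.ball_mem_nhds τ one_pos)), 2 / e,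
          by positivity, fun ρ hρ => ?_⟩
        rcases le_or_gt ρ e with hρe | hρe
        · refine (measure_mono (t := ∅) fun s hs => ?_).trans (by simp)
          have h1 : e < ‖Γ.γ s - Γ.γ s₀‖ := hs.1.1
          have h2 : ‖Γ.γ s - Γ.γ s₀‖ ≤ ρ := hs.2
          linarith
        · refine (measure_mono (t := Metric.ball τ 1) fun s hs => hs.1.2).trans ?_
          rw [Real.volume_ball]
          refine ENNReal.ofReal_le_ofReal ?_
          have he0 : 0 < e := half_pos hpos
          rw [div_mul_eq_mul_div, le_div_iff₀ he0]
          linarith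
  obtain ⟨C, hC, h⟩ := key
  obtain ⟨L, hL⟩ := Γ.exists_paramMeasure_le
  refine ⟨(L + 1) * C, by positivity, fun ρ hρ => ?_⟩
  rw [arcLength_eq_map, Measure.map_apply Γ.continuous_γ.measurable Metric.isClosed_closedBall.measurableSet]
  refine (hL _).trans ?_
  have hms : MeasurableSet (Γ.γ ⁻¹' Metric.closedBall (Γ.γ s₀) ρ) :=
    Γ.continuous_γ.measurable Metric.isClosed_closedBall.measurableSet
  rw [Measure.smul_apply, smul_eq_mul, Measure.restrict_apply hms, inter_comm]
  have hset : Γ.γ ⁻¹' Metric.closedBall (Γ.γ s₀) ρ = {s | ‖Γ.γ s - Γ.γ s₀‖ ≤ ρ} := by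
    ext s; simp [dist_eq_norm]
  rw [hset, mul_assoc, ENNReal.ofReal_mul (by positivity)]
  gcongr
  · rw [← ENNReal.ofReal_coe_nnreal]
    exact ENNReal.ofReal_le_ofReal (by linarith)
  · exact h ρ hρ

/-- With L a bound for the speed, a parameter interval of length ρ/L adjacent to s is mapped into
the ball. It is taken to the right or to the left of s according to the half of [a, b] containing s,
so centres at the ends of an arc are included; r₀ is the largest radius for which such an interval
fits. -/
theorem exists_le_arcLength_closedBall (Γ : CompactC2Curve) :
    ∃ c r₀ : ℝ, 0 < c ∧ 0 < r₀ ∧ ∀ s ∈ Icc Γ.a Γ.b, ∀ ρ, 0 < ρ → ρ ≤ r₀ →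
      ENNReal.ofReal (c * ρ) ≤ Γ.arcLength (Metric.closedBall (Γ.γ s) ρ) := by
  obtain ⟨L, hL0, hL⟩ := Γ.exists_norm_deriv_le
  obtain ⟨c, hc0, hc⟩ := Γ.exists_le_norm_deriv
  have hab := Γ.lt
  have hlip : ∀ s ∈ Icc Γ.a Γ.b, ∀ τ ∈ Icc Γ.a Γ.b, ‖Γ.γ τ - Γ.γ s‖ ≤ L * |τ - s| :=
    fun s hs τ hτ => (convex_Icc Γ.a Γ.b).norm_image_sub_le_of_norm_hasDerivWithin_le
      (fun y _ => (Γ.hasDerivAt_γ y).hasDerivWithinAt) hL hs hτ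
  refine ⟨c / L, L * ((Γ.b - Γ.a) / 2), by positivity, by nlinarith, fun s hs ρ hρ hρ0 => ?_⟩
  have hδ : ρ / L ≤ (Γ.b - Γ.a) / 2 := by rw [div_le_iff₀ hL0]; linarith
  have hδ0 : 0 < ρ / L := by positivity
  obtain ⟨u, hsub, hdist⟩ : ∃ u, Icc u (u + ρ / L) ⊆ Icc Γ.a Γ.b ∧
      ∀ x ∈ Icc u (u + ρ / L), |x - s| ≤ ρ / L := by
    rcases le_total s ((Γ.a + Γ.b) / 2) with h | h
    · refine ⟨s, Icc_subset_Icc hs.1 (by linarith), fun x hx => ?_⟩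
      rw [abs_le]; constructor <;> linarith [hx.1, hx.2]
    · refine ⟨s - ρ / L, Icc_subset_Icc (by linarith) (by linarith [hs.2]), fun x hx => ?_⟩
      rw [abs_le]; constructor <;> linarith [hx.1, hx.2]
  have hms : MeasurableSet (Γ.γ ⁻¹' Metric.closedBall (Γ.γ s) ρ) :=
    Γ.continuous_γ.measurable Metric.isClosed_closedBall.measurableSet
  rw [arcLength_eq_map, Measure.map_apply Γ.continuous_γ.measurable
    Metric.isClosed_closedBall.measurableSet]
  calc ENNReal.ofReal (c / L * ρ) = ∫⁻ x in Icc u (u + ρ / L), ENNReal.ofReal c := by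
        rw [setLIntegral_const, Real.volume_Icc, ← ENNReal.ofReal_mul hc0.le]
        congr 1; ring
    _ ≤ ∫⁻ x in Icc u (u + ρ / L), ‖deriv Γ.γ x‖ₑ := by
        refine setLIntegral_mono' measurableSet_Icc fun x hx => ?_
        rw [← ofReal_norm]
        exact ENNReal.ofReal_le_ofReal (hc x (hsub hx))
    _ = Γ.paramMeasure (Icc u (u + ρ / L)) := by
        rw [paramMeasure, withDensity_apply _ measurableSet_Icc,
          Measure.restrict_restrict measurableSet_Icc, inter_eq_left.2 hsub]
    _ ≤ Γ.paramMeasure (Γ.γ ⁻¹' Metric.closedBall (Γ.γ s) ρ) := by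
        refine measure_mono fun x hx => ?_
        rw [mem_preimage, Metric.mem_closedBall, dist_eq_norm]
        refine (hlip s hs x (hsub hx)).trans ?_
        have := hdist x hx
        rw [le_div_iff₀ hL0] at this
        linarith

end CompactC2Curve

/-! ### Bump functions, and lower bounds on the strip -/

/-- A smooth annular cutoff. -/
theorem exists_schwartz_annulus (ξ₀ : Plane) {ρ r : ℝ} (hρ : 0 < ρ) (hr : 0 < r) :
    ∃ (φ : Plane → ℝ) (f : SchwartzMap Plane ℂ), (∀ ξ, f ξ = φ ξ) ∧ (∀ ξ, 0 ≤ φ ξ) ∧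
      (∀ ξ, φ ξ ≤ 1) ∧ (∀ ξ, φ ξ ≠ 0 → ρ < ‖ξ - ξ₀‖ ∧ ‖ξ - ξ₀‖ < r) ∧
      ∀ ξ, 2 * ρ ≤ ‖ξ - ξ₀‖ → ‖ξ - ξ₀‖ ≤ r / 2 → φ ξ = 1 := by
  let A : ContDiffBump ξ₀ := ⟨ρ, 2 * ρ, hρ, by linarith⟩
  let B : ContDiffBump ξ₀ := ⟨r / 2, r, by linarith, by linarith⟩
  have hsm : ContDiff ℝ ((⊤ : ℕ∞) : WithTop ℕ∞) fun ξ => ((B ξ * (1 - A ξ) : ℝ) : ℂ) :=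
    Complex.ofRealCLM.contDiff.comp (B.contDiff.mul (contDiff_const.sub A.contDiff))
  have hcs : HasCompactSupport fun ξ => ((B ξ * (1 - A ξ) : ℝ) : ℂ) := by
    have h1 : HasCompactSupport fun ξ => B ξ * (1 - A ξ) := B.hasCompactSupport.mul_right
    exact h1.comp_left Complex.ofReal_zero
  refine ⟨fun ξ => B ξ * (1 - A ξ), hcs.toSchwartzMap hsm, fun ξ => rfl, fun ξ => ?_, fun ξ => ?_,
    fun ξ h => ⟨?_, ?_⟩, fun ξ h1 h2 => ?_⟩
  · exact mul_nonneg B.nonneg (sub_nonneg.2 A.le_one)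
  · have := A.nonneg (x := ξ); have := A.le_one (x := ξ)
    have := B.nonneg (x := ξ); have := B.le_one (x := ξ)
    nlinarith
  · by_contra hcon
    refine h ?_
    simp only
    rw [A.one_of_mem_closedBall (by simpa [dist_eq_norm, A] using not_lt.1 hcon)]
    simp
  · by_contra hcon
    refine h ?_
    simp only
    rw [B.zero_of_le_dist (by simpa [dist_eq_norm, B] using not_lt.1 hcon), zero_mul]
  · simp only
    rw [B.one_of_mem_closedBall (by simpa [dist_eq_norm, B] using h2),
      A.zero_of_le_dist (by simpa [dist_eq_norm, A] using h1)]
    ring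

end

noncomputable section

variable {Γ : CompactC2Curve} {ω : Plane} {p q : ℝ≥0∞}

theorem sum_mul_volume_le_setLIntegral_strip (hω : ‖ω‖ = 1) (t : ℝ) {φ : Plane → ℝ≥0∞}
    (hφ : Measurable φ) {ι : Type*} (A : Finset ι) (J : ι → Set ℝ) (v : ι → ℝ≥0∞)
    (hJ : ∀ k ∈ A, MeasurableSet (J k)) (hdisj : (A : Set ι).PairwiseDisjoint J)
    (h : ∀ k ∈ A, ∀ t' ∈ Icc (t - 1 / 2) (t + 1 / 2), ∀ s ∈ J k,
      v k ≤ φ (t' • ω + s • rot ω)) :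
    ∑ k ∈ A, v k * volume (J k) ≤ ∫⁻ x in strip ω t, φ x := by
  rw [setLIntegral_strip hω t hφ]
  calc ∑ k ∈ A, v k * volume (J k)
      = ∫⁻ _ in Icc (t - 1 / 2) (t + 1 / 2), ∑ k ∈ A, v k * volume (J k) := by
        rw [setLIntegral_const, Real.volume_Icc, show t + 1 / 2 - (t - 1 / 2) = 1 by ring]
        simp
    _ ≤ _ := by
        refine setLIntegral_mono' measurableSet_Icc fun t' ht' => ?_
        calc ∑ k ∈ A, v k * volume (J k) = ∑ k ∈ A, ∫⁻ _ in J k, v k := by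
              simp_rw [setLIntegral_const]
          _ ≤ ∑ k ∈ A, ∫⁻ s in J k, φ (t' • ω + s • rot ω) :=
              Finset.sum_le_sum fun k hk => setLIntegral_mono' (hJ k hk) fun s hs =>
                h k hk t' ht' s hs
          _ = ∫⁻ s in ⋃ k ∈ A, J k, φ (t' • ω + s • rot ω) :=
              (lintegral_biUnion_finset hdisj hJ _).symm
          _ ≤ _ := setLIntegral_le_lintegral _ _

theorem mul_volume_le_setLIntegral_strip (hω : ‖ω‖ = 1) (t : ℝ) {φ : Plane → ℝ≥0∞}
    (hφ : Measurable φ) {J : Set ℝ} {v : ℝ≥0∞} (hJ : MeasurableSet J)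
    (h : ∀ t' ∈ Icc (t - 1 / 2) (t + 1 / 2), ∀ s ∈ J, v ≤ φ (t' • ω + s • rot ω)) :
    v * volume J ≤ ∫⁻ x in strip ω t, φ x := by
  simpa using sum_mul_volume_le_setLIntegral_strip hω t hφ {()} (fun _ => J) (fun _ => v)
    (fun _ _ => hJ) (by simp) fun _ _ => h

theorem StripEstimateAt.exists_lintegral_le {t : ℝ} (h : StripEstimateAt Γ ω p q t) (hq : 1 ≤ q)
    (hqt : q ≠ ∞) : ∃ C : ℝ, 0 < C ∧ ∀ (f : SchwartzMap Plane ℂ) (B : ℝ), 0 ≤ B →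
      eLpNorm f p Γ.arcLength ≤ ENNReal.ofReal B →
      ∫⁻ x in strip ω t, ‖Γ.extension f x‖ₑ ^ q.toReal ≤ ENNReal.ofReal ((C * B) ^ q.toReal) := by
  obtain ⟨C, hC⟩ := h
  have hq0 : q ≠ 0 := (zero_lt_one.trans_le hq).ne'
  have hqr : 0 < q.toReal := ENNReal.toReal_pos hq0 hqt
  refine ⟨C + 1, by positivity, fun f B hB hfB => ?_⟩
  have h1 := hC f
  rw [eLpNorm_eq_lintegral_rpow_enorm_toReal hq0 hqt, one_div, ENNReal.rpow_inv_le_iff hqr] at h1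
  refine h1.trans ?_
  rw [← ENNReal.ofReal_rpow_of_nonneg (by positivity) hqr.le, ENNReal.ofReal_mul (by positivity)]
  gcongr
  rw [← ENNReal.ofReal_coe_nnreal]
  exact ENNReal.ofReal_le_ofReal (by linarith)

theorem abs_inner_smul_add_smul_rot_le (hω : ‖ω‖ = 1) (ξ : Plane) (t s : ℝ) :
    |inner ℝ ξ (t • ω + s • rot ω)| ≤ |t| * ‖ξ‖ + |s| * |inner ℝ (rot ξ) ω| := by
  rw [inner_add_right, real_inner_smul_right, real_inner_smul_right, inner_rot_left, abs_neg,
    ← abs_mul s]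
  refine (abs_add_le _ _).trans ?_
  gcongr
  rw [abs_mul]
  gcongr
  have := abs_real_inner_le_norm ξ ω
  rwa [hω, mul_one] at this

theorem abs_le_of_mem_Icc_half {t t' : ℝ} (h : t' ∈ Icc (t - 1 / 2) (t + 1 / 2)) :
    |t'| ≤ |t| + 1 := by
  have h1 : |t' - t| ≤ 1 / 2 := by rw [abs_le]; constructor <;> linarith [h.1, h.2]
  have := abs_add_le t (t' - t)
  rw [add_sub_cancel] at this
  linarith

theorem eLpNorm_le_measure_rpow {μ : Measure Plane} {f : Plane → ℂ} {A : Set Plane}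
    (hA : ∀ ξ, f ξ ≠ 0 → ξ ∈ A) (hf : ∀ ξ, ‖f ξ‖ ≤ 1) (p : ℝ≥0∞) :
    eLpNorm f p μ ≤ μ A ^ p⁻¹.toReal := by
  calc eLpNorm f p μ ≤ eLpNorm (A.indicator fun _ => (1 : ℂ)) p μ := by
        refine eLpNorm_mono fun ξ => ?_
        by_cases h : f ξ = 0
        · rw [h, norm_zero]; positivity
        · rw [indicator_of_mem (hA ξ h), norm_one]; exact hf ξ
    _ ≤ ‖(1 : ℂ)‖ₑ * μ A ^ (1 / p.toReal) := eLpNorm_indicator_const_le _ _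
    _ = μ A ^ p⁻¹.toReal := by simp [ENNReal.toReal_inv]

namespace CompactC2Curve

/-- Annular bumps on the curve around a given point, at all small scales. -/
theorem exists_annular_bumps {s₀ : ℝ} (hs₀ : s₀ ∈ Icc Γ.a Γ.b) :
    ∃ M c r₀ : ℝ, 1 < M ∧ 0 < c ∧ 0 < r₀ ∧ ∀ r, 0 < r → r ≤ r₀ →
      ∃ (φ : Plane → ℝ) (f : SchwartzMap Plane ℂ), (∀ ξ, f ξ = φ ξ) ∧ (∀ ξ, 0 ≤ φ ξ) ∧
        (∀ ξ, φ ξ ≤ 1) ∧ (∀ ξ, φ ξ ≠ 0 → r / M < ‖ξ - Γ.γ s₀‖ ∧ ‖ξ - Γ.γ s₀‖ < r) ∧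
        c * r ≤ ∫ ξ, φ ξ ∂Γ.arcLength := by
  obtain ⟨C, hC, hup⟩ := Γ.exists_arcLength_closedBall_le s₀
  obtain ⟨c, r₀, hc, hr₀, hlow⟩ := Γ.exists_le_arcLength_closedBall
  have hM : 0 < 8 * C / c + 2 := by positivity
  refine ⟨8 * C / c + 2, c / 4, r₀, by linarith [(by positivity : 0 < 8 * C / c)], by positivity,
    hr₀, fun r hr hrr => ?_⟩
  -- The ratio M makes the excised ball of radius 2r/M have measure at most cr/4, half of the lower
  -- bound cr/2 for the ball of radius r/2. Removing the centre makes bumps at scales in ratio M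
  -- disjointly supported.
  set M := 8 * C / c + 2 with hMd
  obtain ⟨φ, f, h1, h2, h3, h4, h5⟩ := exists_schwartz_annulus (Γ.γ s₀) (div_pos hr hM) hr
  refine ⟨φ, f, h1, h2, h3, h4, ?_⟩
  set A := Metric.closedBall (Γ.γ s₀) (r / 2)
  set B := Metric.closedBall (Γ.γ s₀) (2 * (r / M))
  have hA : c * (r / 2) ≤ Γ.arcLength.real A := by
    have := hlow s₀ hs₀ (r / 2) (by positivity) (by linarith)
    exact (ENNReal.ofReal_le_iff_le_toReal (measure_ne_top _ _)).1 this
  have hB : Γ.arcLength.real B ≤ C * (2 * (r / M)) :=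
    ENNReal.toReal_le_of_le_ofReal (by positivity) (hup _ (by positivity))
  have hAB : Γ.arcLength.real A ≤ Γ.arcLength.real (A \ B) + Γ.arcLength.real B := by
    refine (measureReal_mono (s₂ := A \ B ∪ B) ?_).trans (measureReal_union_le _ _)
    rw [sdiff_union_self]; exact subset_union_left
  have hms : MeasurableSet (A \ B) :=
    Metric.isClosed_closedBall.measurableSet.diff Metric.isClosed_closedBall.measurableSet
  have hφc : Continuous φ := by
    have : φ = fun ξ => (f ξ).re := funext fun ξ => by rw [h1]; simp
    rw [this]; exact Complex.continuous_re.comp f.continuous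
  have h_int : Γ.arcLength.real (A \ B) ≤ ∫ ξ, φ ξ ∂Γ.arcLength := by
    rw [← integral_indicator_one hms]
    refine integral_mono ((integrable_const (1 : ℝ)).indicator hms) ?_ fun ξ => ?_
    · exact Integrable.of_bound hφc.aestronglyMeasurable 1
        (ae_of_all _ fun ξ => by rw [Real.norm_of_nonneg (h2 ξ)]; exact h3 ξ)
    · by_cases hξ : ξ ∈ A \ B
      · rw [indicator_of_mem hξ, h5 ξ]
        · rfl
        · have := hξ.2
          rw [Metric.mem_closedBall, dist_eq_norm, not_le] at this
          exact this.le
        · have := hξ.1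
          rwa [Metric.mem_closedBall, dist_eq_norm] at this
      · rw [indicator_of_notMem hξ]; exact h2 ξ
  have hCM : C * (2 * (r / M)) ≤ c / 4 * r := by
    rw [show C * (2 * (r / M)) = 2 * C * r / M by ring, div_le_iff₀ hM, hMd]
    have : c / 4 * r * (8 * C / c + 2) = 2 * C * r + c * r / 2 := by field_simp; ring
    rw [this]
    linarith [mul_pos hc hr]
  linarith

/-- On the support the phase relative to γ(s₀) varies by at most (|t| + 1)r ≤ 1/12 in the direction
ω and by |s|·K·r^m ≤ 1/12 across it. The sum 1/6 is the tolerance of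
`half_integral_le_norm_extension`. -/
theorem norm_extension_ge_of_support {φ : Plane → ℝ} {f : SchwartzMap Plane ℂ}
    (hf : ∀ ξ, f ξ = φ ξ) (hφ : ∀ ξ, 0 ≤ φ ξ) (hω : ‖ω‖ = 1) {s₀ K r t t' s : ℝ} {m : ℕ}
    (hr : 0 < r) (hK : 0 < K)
    (hcurve : ∀ s ∈ Icc Γ.a Γ.b,
      |inner ℝ (rot (Γ.γ s - Γ.γ s₀)) ω| ≤ K * ‖Γ.γ s - Γ.γ s₀‖ ^ m)
    (hsupp : ∀ ξ, φ ξ ≠ 0 → ‖ξ - Γ.γ s₀‖ < r) (hrt : (|t| + 1) * r ≤ 1 / 12)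
    (ht' : t' ∈ Icc (t - 1 / 2) (t + 1 / 2)) (hs : |s| ≤ (12 * K)⁻¹ / r ^ m) :
    (∫ ξ, φ ξ ∂Γ.arcLength) / 2 ≤ ‖Γ.extension f (t' • ω + s • rot ω)‖ := by
  refine half_integral_le_norm_extension hf hφ (Γ.γ s₀) _ fun σ hσ h0 => ?_
  have h1 := hsupp _ h0
  refine (abs_inner_smul_add_smul_rot_le hω _ t' s).trans ?_
  have h2 : |t'| * ‖Γ.γ σ - Γ.γ s₀‖ ≤ (|t| + 1) * r := by
    gcongr
    exact abs_le_of_mem_Icc_half ht'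
  have h3 : |s| * |inner ℝ (rot (Γ.γ σ - Γ.γ s₀)) ω| ≤ (12 * K)⁻¹ / r ^ m * (K * r ^ m) := by
    gcongr
    refine (hcurve σ hσ).trans ?_
    gcongr
  have h4 : (12 * K)⁻¹ / r ^ m * (K * r ^ m) = 1 / 12 := by field_simp
  linarith

end CompactC2Curve

theorem le_of_forall_small_mul_rpow_le {A B α β r₁ : ℝ} (hA : 0 < A) (hr₁ : 0 < r₁)
    (h : ∀ r, 0 < r → r ≤ r₁ → A * r ^ α ≤ B * r ^ β) : β ≤ α := by
  by_contra hlt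
  rw [not_le] at hlt
  have hlim : Tendsto (fun r : ℝ => B * r ^ (β - α)) (𝓝[>] 0) (𝓝 0) := by
    have h1 : Tendsto (fun r : ℝ => r ^ (β - α)) (𝓝 0) (𝓝 0) := by
      have := (Real.continuousAt_rpow_const 0 (β - α) (Or.inr (by linarith))).tendsto
      rwa [Real.zero_rpow (by linarith)] at this
    simpa using (h1.mono_left nhdsWithin_le_nhds).const_mul B
  have hev : ∀ᶠ r : ℝ in 𝓝[>] 0, A ≤ B * r ^ (β - α) := by
    filter_upwards [Ioc_mem_nhdsGT hr₁] with r hr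
    have h1 := h r hr.1 hr.2
    have hp : 0 < r ^ α := Real.rpow_pos_of_pos hr.1 _
    have h2 : r ^ β = r ^ (β - α) * r ^ α := by rw [← Real.rpow_add hr.1]; ring_nf
    rw [h2, ← mul_assoc] at h1
    exact le_of_mul_le_mul_right h1 hp
  have := ge_of_tendsto hlim hev
  linarith

/-- The Knapp example at a point of order of contact `m` with a line parallel to `ω`. -/
theorem StripEstimateAt.knapp {t : ℝ} (h : StripEstimateAt Γ ω p q t) (hω : ‖ω‖ = 1) (hq : 1 ≤ q)
    (hqt : q ≠ ∞) {s₀ K : ℝ} {m : ℕ} (hs₀ : s₀ ∈ Icc Γ.a Γ.b) (hK : 0 < K)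
    (hcurve : ∀ s ∈ Icc Γ.a Γ.b,
      |inner ℝ (rot (Γ.γ s - Γ.γ s₀)) ω| ≤ K * ‖Γ.γ s - Γ.γ s₀‖ ^ m) :
    p⁻¹.toReal + m / q.toReal ≤ 1 := by
  obtain ⟨D, hD, hest⟩ := h.exists_lintegral_le hq hqt
  obtain ⟨M, c, r₀, hM, hc, hr₀, hbump⟩ := CompactC2Curve.exists_annular_bumps hs₀
  obtain ⟨C, hC, hup⟩ := Γ.exists_arcLength_closedBall_le s₀
  have hQ := one_le_toReal hq hqt
  set Q := q.toReal
  set x := p⁻¹.toReal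
  have hx : 0 ≤ x := ENNReal.toReal_nonneg
  -- The bump has L^p norm O(r^{1/p}), and its extension is at least of order r on a part of the
  -- strip of length of order r^{-m}. Hence r^{q-m} ≲ r^{q/p} for all small r, which compares the
  -- exponents.
  have hmain : x * Q ≤ Q - m := by
    refine le_of_forall_small_mul_rpow_le (A := (c / 2) ^ Q * (12 * K)⁻¹)
      (B := (D * C ^ x) ^ Q) (r₁ := min r₀ (1 / (12 * (|t| + 1)))) (by positivity)
      (lt_min hr₀ (by positivity)) fun r hr hr1 => ?_
    obtain ⟨φ, f, h1, h2, h3, h4, h5⟩ := hbump r hr (hr1.trans (min_le_left _ _))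
    have hrt : (|t| + 1) * r ≤ 1 / 12 := by
      have := hr1.trans (min_le_right _ _)
      rw [le_div_iff₀ (by positivity)] at this
      linarith
    have hnorm : eLpNorm f p Γ.arcLength ≤ ENNReal.ofReal ((C * r) ^ x) := by
      refine (eLpNorm_le_measure_rpow (A := Metric.closedBall (Γ.γ s₀) r) (fun ξ hξ => ?_)
        (fun ξ => ?_) p).trans ?_
      · rw [Metric.mem_closedBall, dist_eq_norm]
        refine (h4 ξ fun h0 => hξ ?_).2.le
        rw [h1, h0, Complex.ofReal_zero]
      · rw [h1, Complex.norm_real, Real.norm_of_nonneg (h2 ξ)]; exact h3 ξ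
      · rw [← ENNReal.ofReal_rpow_of_nonneg (by positivity) hx]
        gcongr
        exact hup r hr
    have hE := hest f _ (by positivity) hnorm
    have hF := CompactC2Curve.continuous_extension (Γ := Γ) f
    have hlow := mul_volume_le_setLIntegral_strip hω t (φ := fun x => ‖Γ.extension f x‖ₑ ^ Q)
      (hF.enorm.measurable.pow_const _) (J := Icc 0 ((12 * K)⁻¹ / r ^ m))
      (v := ENNReal.ofReal ((c / 2 * r) ^ Q)) measurableSet_Icc fun t' ht' s hs => ?_
    · rw [Real.volume_Icc, sub_zero, ← ENNReal.ofReal_mul (by positivity)] at hlow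
      have hreal := (ENNReal.ofReal_le_ofReal_iff (by positivity)).1 (hlow.trans hE)
      calc (c / 2) ^ Q * (12 * K)⁻¹ * r ^ (Q - m)
          = (c / 2 * r) ^ Q * ((12 * K)⁻¹ / r ^ m) := by
            rw [Real.rpow_sub hr, Real.rpow_natCast, Real.mul_rpow (by positivity) hr.le]
            ring
        _ ≤ (D * (C * r) ^ x) ^ Q := hreal
        _ = (D * C ^ x) ^ Q * r ^ (x * Q) := by
            rw [Real.mul_rpow hC.le hr.le, ← mul_assoc, Real.mul_rpow (by positivity)
              (by positivity), ← Real.rpow_mul hr.le]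
    · rw [enorm_rpow_eq_ofReal _ (by linarith)]
      refine ENNReal.ofReal_le_ofReal (Real.rpow_le_rpow (by positivity) ?_ (by linarith))
      refine le_trans ?_ (CompactC2Curve.norm_extension_ge_of_support h1 h2 hω hr hK hcurve
        (fun ξ hξ => (h4 ξ hξ).2) hrt ht' (by rw [abs_of_nonneg hs.1]; exact hs.2))
      linarith
  have hQ0 : 0 < Q := by linarith
  rw [← mul_le_mul_iff_left₀ hQ0, add_mul, div_mul_cancel₀ _ hQ0.ne']
  linarith

theorem StripEstimateAt.knapp_one {t : ℝ} (h : StripEstimateAt Γ ω p q t) (hω : ‖ω‖ = 1)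
    (hq : 1 ≤ q) (hqt : q ≠ ∞) : p⁻¹.toReal + 1 / q.toReal ≤ 1 := by
  have := h.knapp hω hq hqt (m := 1) (left_mem_Icc.2 Γ.lt.le) one_pos fun s _ => by
    rw [one_mul, pow_one]; exact CompactC2Curve.abs_inner_rot_le hω _
  simpa using this

theorem StripEstimateAt.knapp_two {t : ℝ} (h : StripEstimateAt Γ ω p q t) (hω : ‖ω‖ = 1)
    (hq : 1 ≤ q) (hqt : q ≠ ∞) {s₀ : ℝ} (hs₀ : s₀ ∈ Icc Γ.a Γ.b)
    (h0 : inner ℝ (rot (deriv Γ.γ s₀)) ω = 0) : p⁻¹.toReal + 2 / q.toReal ≤ 1 := by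
  obtain ⟨K, hK, hc⟩ := CompactC2Curve.exists_abs_inner_rot_sub_le_sq hω hs₀ h0
  exact_mod_cast h.knapp hω hq hqt hs₀ hK hc

end

/-! ### Square functions and the necessity of q ≥ 2 in the transversal case -/

noncomputable section

variable {Γ : CompactC2Curve} {ω : Plane} {p q : ℝ≥0∞}

theorem signedSum_eq_of_unique {N : ℕ} {z : ℕ → ℂ} (s : Finset ℕ) {k : ℕ}
    (hk : k ∈ Finset.range N) (h : ∀ j ∈ Finset.range N, j ≠ k → z j = 0) :
    signedSum N z s = setSign s k * z k := by
  rw [signedSum]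
  exact Finset.sum_eq_single k (fun j hj hjk => by rw [h j hj hjk, mul_zero])
    fun h' => absurd hk h'

theorem norm_signedSum_of_unique {N : ℕ} {z : ℕ → ℂ} (s : Finset ℕ) {k : ℕ}
    (hk : k ∈ Finset.range N) (h : ∀ j ∈ Finset.range N, j ≠ k → z j = 0) :
    ‖signedSum N z s‖ = ‖z k‖ := by
  rw [signedSum_eq_of_unique s hk h, norm_mul, Complex.norm_real, Real.norm_eq_abs,
    abs_setSign, one_mul]

/-- Either all terms vanish, or the signed sum of functions with disjoint supports has the norm of
one of its terms. -/
theorem norm_signedSum_of_disjoint {N : ℕ} {z : ℕ → ℂ} (s : Finset ℕ)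
    (h : ∀ j ∈ Finset.range N, ∀ k ∈ Finset.range N, z j ≠ 0 → z k ≠ 0 → j = k) :
    signedSum N z s = 0 ∨ ∃ k ∈ Finset.range N, z k ≠ 0 ∧ ‖signedSum N z s‖ = ‖z k‖ := by
  by_cases hz : ∃ k ∈ Finset.range N, z k ≠ 0
  · obtain ⟨k, hk, hk0⟩ := hz
    refine Or.inr ⟨k, hk, hk0, norm_signedSum_of_unique s hk fun j hj hjk => ?_⟩
    by_contra hj0
    exact hjk (h j hj k hk hj0 hk0)
  · push Not at hz
    left
    exact Finset.sum_eq_zero fun k hk => by rw [hz k hk, mul_zero]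

theorem sum_smul_apply_eq_signedSum (N : ℕ) (f : ℕ → SchwartzMap Plane ℂ) (s : Finset ℕ)
    (ξ : Plane) : (∑ k ∈ Finset.range N, (setSign s k : ℂ) • f k : SchwartzMap Plane ℂ) ξ =
      signedSum N (fun k => f k ξ) s := by
  simp [_root_.sum_apply, signedSum]

/-- The consequence of the strip estimate for the square function of extensions. -/
theorem StripEstimateAt.exists_squareFunction_le {t : ℝ} (h : StripEstimateAt Γ ω p q t)
    (hq : 1 ≤ q) (hqt : q ≠ ∞) :
    ∃ D : ℝ, 0 < D ∧ ∀ (N : ℕ) (f : ℕ → SchwartzMap Plane ℂ) (B : ℝ), 0 ≤ B →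
      (∀ s, eLpNorm (fun ξ => signedSum N (fun k => f k ξ) s) p Γ.arcLength ≤ ENNReal.ofReal B) →
      ∫⁻ x in strip ω t, ENNReal.ofReal
        ((∑ k ∈ Finset.range N, ‖Γ.extension (f k) x‖ ^ 2) ^ (q.toReal / 2)) ≤
        ENNReal.ofReal (D * B ^ q.toReal) := by
  have hQ := one_le_toReal hq hqt
  obtain ⟨C, hC, hest⟩ := h.exists_lintegral_le hq hqt
  obtain ⟨c, hc, hK⟩ := exists_lintegral_squareFunction_le (q := q.toReal) (by linarith)
  refine ⟨c⁻¹ * C ^ q.toReal, by positivity, fun N f B hB hf => ?_⟩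
  have h1 := hK (volume.restrict (strip ω t)) N (fun k => Γ.extension (f k))
    (ENNReal.ofReal ((C * B) ^ q.toReal))
    (fun k => (CompactC2Curve.continuous_extension (f k)).measurable) fun s => ?_
  · have h2 := mul_le_mul_right h1 (ENNReal.ofReal c⁻¹)
    rw [← mul_assoc, ← ENNReal.ofReal_mul (by positivity), inv_mul_cancel₀ hc.ne',
      ENNReal.ofReal_one, one_mul, ← ENNReal.ofReal_mul (by positivity)] at h2
    rw [Real.mul_rpow hC.le hB, ← mul_assoc] at h2
    exact h2
  · simp_rw [← CompactC2Curve.extension_signedSum]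
    refine hest _ B hB ?_
    refine (eLpNorm_congr_ae (ae_of_all _ fun ξ => ?_)).trans_le (hf s)
    exact sum_smul_apply_eq_signedSum N f s ξ

theorem not_forall_natCast_mul_rpow_le {A B α : ℝ} (hA : 0 < A) (hα : 0 < α) (N₀ : ℕ) :
    ¬ ∀ N : ℕ, N₀ ≤ N → A * (N : ℝ) ^ α ≤ B := fun h => by
  have hlim : Tendsto (fun N : ℕ => A * (N : ℝ) ^ α) atTop atTop :=
    ((tendsto_rpow_atTop hα).comp tendsto_natCast_atTop_atTop).const_mul_atTop hA
  obtain ⟨N, hN1, hN2⟩ := ((hlim.eventually_gt_atTop B).and (eventually_ge_atTop N₀)).exists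
  linarith [h N hN2]

/-- Many equidistributed small bumps with random signs rule out `q < 2` in the transversal case. -/
theorem StripEstimateAt.two_le_of_transversal {t : ℝ} (h : StripEstimateAt Γ ω p q t)
    (hω : ‖ω‖ = 1) (ht : Γ.Transversal ω) (hq : 1 ≤ q) (hqt : q ≠ ∞) : 2 ≤ q.toReal := by
  by_contra hlt
  rw [not_le] at hlt
  have hQ := one_le_toReal hq hqt
  obtain ⟨D, hD, hest⟩ := h.exists_squareFunction_le hq hqt
  obtain ⟨c, r₀, hc, hr₀, hlow⟩ := Γ.exists_le_arcLength_closedBall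
  have hab : 0 < Γ.b - Γ.a := sub_pos.2 Γ.lt
  set Q := q.toReal
  have hHc' : Continuous fun σ => |inner ℝ (rot (deriv Γ.γ σ)) ω| :=
    (continuous_iff_continuousAt.2 fun σ =>
      (Γ.hasDerivAt_inner_rot_deriv ω σ).continuousAt).abs
  obtain ⟨σ₀, hσ₀, hmin⟩ := isCompact_Icc.exists_isMinOn (nonempty_Icc.2 Γ.lt.le)
    (hHc'.continuousOn (s := Icc Γ.a Γ.b))
  set d := |inner ℝ (rot (deriv Γ.γ σ₀)) ω| with hd
  have hd0 : 0 < d := abs_pos.2 ((CompactC2Curve.inner_normal_ne_zero_iff hσ₀).1 (ht σ₀ hσ₀))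
  -- Transversality bounds the slope of H below by d, and differences of H are at most distances on
  -- the curve. Equally spaced parameters therefore give points separated by at least d(b - a)/N.
  have hsep : ∀ x ∈ Icc Γ.a Γ.b, ∀ y ∈ Icc Γ.a Γ.b, x < y →
      d * (y - x) ≤ ‖Γ.γ y - Γ.γ x‖ := by
    intro x hx y hy hxy
    obtain ⟨z, hz, hz'⟩ := exists_hasDerivAt_eq_slope (fun σ => inner ℝ (rot (Γ.γ σ)) ω)
      (fun σ => inner ℝ (rot (deriv Γ.γ σ)) ω) hxy
      (fun σ _ => (Γ.hasDerivAt_inner_rot ω σ).continuousAt.continuousWithinAt)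
      (fun σ _ => Γ.hasDerivAt_inner_rot ω σ)
    have h1 : d ≤ |inner ℝ (rot (deriv Γ.γ z)) ω| :=
      hmin ⟨hx.1.trans hz.1.le, hz.2.le.trans hy.2⟩
    rw [hz', ← inner_sub_left, ← CompactC2Curve.rot_sub, abs_div,
      abs_of_pos (sub_pos.2 hxy), le_div_iff₀ (sub_pos.2 hxy)] at h1
    exact h1.trans (CompactC2Curve.abs_inner_rot_le hω _)
  -- Bumps of radius κ/N are then disjoint, and the radius stays in the range of the arc length
  -- lower bound.
  set κ := min (d * (Γ.b - Γ.a) / 2) r₀ with hκ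
  have hκ0 : 0 < κ := lt_min (by positivity) hr₀
  set B := (Γ.arcLength univ ^ p⁻¹.toReal).toReal with hB
  obtain ⟨N₀, hN₀⟩ := exists_nat_ge (12 * κ * (|t| + 1))
  -- Each of the N extensions is at least of order 1/N for 0 ≤ s ≲ N, so the square function is at
  -- least of order N^{-1/2} there and its q-th power integral of order N^{1-q/2}. The signed sums
  -- are bounded by 1, so the upper bound does not depend on N. Taking N above N₀ keeps the phase in
  -- the direction ω within 1/12.
  refine not_forall_natCast_mul_rpow_le (A := (c / 4 * κ) ^ Q * (12 * κ)⁻¹)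
    (B := D * B ^ Q) (α := 1 - Q / 2) (by positivity) (by linarith) (N₀ + 1) fun N hN => ?_
  have hN0 : 0 < (N : ℝ) := by exact_mod_cast (show 0 < N by omega)
  set ρ := κ / N with hρ
  have hρ0 : 0 < ρ := by positivity
  have hN1 : (1 : ℝ) ≤ N := by exact_mod_cast (show 1 ≤ N by omega)
  have hρr₀ : ρ ≤ r₀ := (div_le_self hκ0.le hN1).trans (min_le_right _ _)
  set σ : ℕ → ℝ := fun k => Γ.a + (Γ.b - Γ.a) * (k / N) with hσ
  have hσmem : ∀ k ∈ Finset.range N, σ k ∈ Icc Γ.a Γ.b := fun k hk => by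
    have hk' : (k : ℝ) / N ≤ 1 := by
      rw [div_le_one hN0]; exact_mod_cast (Finset.mem_range.1 hk).le
    have hk0 : 0 ≤ (k : ℝ) / N := by positivity
    constructor <;> simp only [hσ] <;> nlinarith
  have hbump : ∀ k, ∃ (φ : Plane → ℝ) (f : SchwartzMap Plane ℂ), (∀ ξ, f ξ = φ ξ) ∧
      (∀ ξ, 0 ≤ φ ξ) ∧ (∀ ξ, φ ξ ≤ 1) ∧ (∀ ξ, φ ξ ≠ 0 → ‖ξ - Γ.γ (σ k)‖ < ρ) ∧
      (k ∈ Finset.range N → c * (ρ / 2) ≤ ∫ ξ, φ ξ ∂Γ.arcLength) := by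
    intro k
    let A : ContDiffBump (Γ.γ (σ k)) := ⟨ρ / 2, ρ, by linarith, by linarith⟩
    have hsm : ContDiff ℝ ((⊤ : ℕ∞) : WithTop ℕ∞) fun ξ => ((A ξ : ℝ) : ℂ) :=
      Complex.ofRealCLM.contDiff.comp A.contDiff
    have hcs : HasCompactSupport fun ξ => ((A ξ : ℝ) : ℂ) :=
      A.hasCompactSupport.comp_left Complex.ofReal_zero
    refine ⟨A, hcs.toSchwartzMap hsm, fun ξ => rfl, fun ξ => A.nonneg, fun ξ => A.le_one,
      fun ξ hξ => ?_, fun hk => ?_⟩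
    · by_contra hcon
      exact hξ (A.zero_of_le_dist (by simpa [dist_eq_norm, A] using not_lt.1 hcon))
    · have hms : MeasurableSet (Metric.closedBall (Γ.γ (σ k)) (ρ / 2)) :=
        Metric.isClosed_closedBall.measurableSet
      calc c * (ρ / 2) ≤ Γ.arcLength.real (Metric.closedBall (Γ.γ (σ k)) (ρ / 2)) :=
            (ENNReal.ofReal_le_iff_le_toReal (measure_ne_top _ _)).1
              (hlow _ (hσmem k hk) _ (by positivity) (by linarith))
        _ ≤ ∫ ξ, A ξ ∂Γ.arcLength := by
            rw [← integral_indicator_one hms]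
            refine integral_mono ((integrable_const (1 : ℝ)).indicator hms) ?_ fun ξ => ?_
            · exact Integrable.of_bound A.continuous.aestronglyMeasurable 1
                (ae_of_all _ fun ξ => by rw [Real.norm_of_nonneg A.nonneg]; exact A.le_one)
            · by_cases hξ : ξ ∈ Metric.closedBall (Γ.γ (σ k)) (ρ / 2)
              · rw [indicator_of_mem hξ, A.one_of_mem_closedBall hξ]; rfl
              · rw [indicator_of_notMem hξ]; exact A.nonneg
  choose φ f h1 h2 h3 h4 h5 using hbump
  have hφf : ∀ k ξ, f k ξ ≠ 0 → φ k ξ ≠ 0 := fun k ξ hξ h0 => hξ (by rw [h1, h0]; simp)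
  have hlt' : ∀ j ∈ Finset.range N, ∀ k ∈ Finset.range N, ∀ ξ, j < k → φ j ξ ≠ 0 →
      φ k ξ ≠ 0 → False := by
    intro j hj k hk ξ hjk hj0 hk0
    have hjk' : (j : ℝ) + 1 ≤ k := by exact_mod_cast hjk
    have e : σ k - σ j = (Γ.b - Γ.a) * ((k - j) / N) := by simp only [hσ]; ring
    have hge : (Γ.b - Γ.a) * (1 / N) ≤ σ k - σ j := by
      rw [e]
      gcongr
      linarith
    have hpos : 0 < (Γ.b - Γ.a) * (1 / N) := by positivity
    have hs := hsep _ (hσmem j hj) _ (hσmem k hk) (by linarith)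
    have htri : ‖Γ.γ (σ k) - Γ.γ (σ j)‖ ≤ ‖ξ - Γ.γ (σ j)‖ + ‖ξ - Γ.γ (σ k)‖ := by
      have := norm_sub_le (ξ - Γ.γ (σ j)) (ξ - Γ.γ (σ k))
      rwa [sub_sub_sub_cancel_left] at this
    have hρle : 2 * ρ ≤ d * ((Γ.b - Γ.a) * (1 / N)) := by
      have : κ ≤ d * (Γ.b - Γ.a) / 2 := min_le_left _ _
      rw [hρ, show d * ((Γ.b - Γ.a) * (1 / N)) = 2 * ((d * (Γ.b - Γ.a) / 2) / N) by ring]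
      gcongr
    have := mul_le_mul_of_nonneg_left hge hd0.le
    linarith [h4 j ξ hj0, h4 k ξ hk0]
  have hdisj : ∀ ξ, ∀ j ∈ Finset.range N, ∀ k ∈ Finset.range N, f j ξ ≠ 0 → f k ξ ≠ 0 → j = k := by
    intro ξ j hj k hk hj0 hk0
    rcases lt_trichotomy j k with hjk | hjk | hjk
    · exact (hlt' j hj k hk ξ hjk (hφf j ξ hj0) (hφf k ξ hk0)).elim
    · exact hjk
    · exact (hlt' k hk j hj ξ hjk (hφf k ξ hk0) (hφf j ξ hj0)).elim
  have hf1 : ∀ k ξ, ‖f k ξ‖ ≤ 1 := fun k ξ => by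
    rw [h1, Complex.norm_real, Real.norm_of_nonneg (h2 k ξ)]; exact h3 k ξ
  have hest' := hest N f B ENNReal.toReal_nonneg fun s => by
    rw [hB, ENNReal.ofReal_toReal (ENNReal.rpow_ne_top_of_nonneg ENNReal.toReal_nonneg
      (measure_ne_top _ _))]
    refine eLpNorm_le_measure_rpow (fun ξ _ => mem_univ ξ) (fun ξ => ?_) p
    rcases norm_signedSum_of_disjoint s (hdisj ξ) with h0 | ⟨k, _, _, hk⟩
    · rw [h0, norm_zero]; exact zero_le_one
    · rw [hk]; exact hf1 k ξ
  have hFm : Measurable fun x => ENNReal.ofReal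
      ((∑ k ∈ Finset.range N, ‖Γ.extension (f k) x‖ ^ 2) ^ (Q / 2)) := by
    refine Measurable.ennreal_ofReal (Measurable.pow_const ?_ _)
    exact Finset.measurable_fun_sum _ fun k _ =>
      ((CompactC2Curve.continuous_extension (f k)).norm.measurable).pow_const 2
  have hlower := mul_volume_le_setLIntegral_strip hω t hFm
    (J := Icc 0 ((12 * κ)⁻¹ * N)) (v := ENNReal.ofReal ((N * (c / 4 * ρ) ^ 2) ^ (Q / 2)))
    measurableSet_Icc fun t' ht' s hs => ?_
  · rw [Real.volume_Icc, sub_zero, ← ENNReal.ofReal_mul (by positivity)] at hlower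
    have hreal := (ENNReal.ofReal_le_ofReal_iff (by positivity)).1 (hlower.trans hest')
    refine le_of_eq_of_le ?_ hreal
    have e1 : (N : ℝ) * (c / 4 * ρ) ^ 2 = (c / 4 * κ) ^ 2 * (N : ℝ)⁻¹ := by
      rw [hρ]; field_simp
    have e2 : ((c / 4 * κ) ^ 2 * (N : ℝ)⁻¹) ^ (Q / 2) = (c / 4 * κ) ^ Q * ((N : ℝ) ^ (Q / 2))⁻¹ := by
      have hpos : 0 ≤ c / 4 * κ := by positivity
      rw [Real.mul_rpow (sq_nonneg _) (by positivity), ← Real.rpow_natCast (c / 4 * κ) 2,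
        ← Real.rpow_mul hpos, Real.inv_rpow hN0.le]
      congr 2
      push_cast; ring
    rw [e1, e2, Real.rpow_sub hN0, Real.rpow_one]
    ring
  · refine ENNReal.ofReal_le_ofReal (Real.rpow_le_rpow (by positivity) ?_ (by linarith))
    calc (N : ℝ) * (c / 4 * ρ) ^ 2 = ∑ k ∈ Finset.range N, (c / 4 * ρ) ^ 2 := by simp
      _ ≤ _ := by
        refine Finset.sum_le_sum fun k hk => ?_
        gcongr
        refine le_trans ?_ (CompactC2Curve.norm_extension_ge_of_support (s₀ := σ k) (K := 1)
          (m := 1) (t := t) (h1 k) (h2 k) hω hρ0 one_pos (fun s _ => ?_) (h4 k) ?_ ht' ?_)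
        · linarith [h5 k hk]
        · rw [one_mul, pow_one]; exact CompactC2Curve.abs_inner_rot_le hω _
        · rw [hρ, ← mul_div_assoc, div_le_iff₀ hN0]
          have : (N₀ : ℝ) + 1 ≤ N := by exact_mod_cast hN
          linarith
        · rw [abs_of_nonneg hs.1, pow_one]
          refine hs.2.trans_eq ?_
          rw [hρ]; field_simp

end

/-! ### The endpoint for q < p in the non-transversal case -/

noncomputable section

variable {Γ : CompactC2Curve} {ω : Plane} {p q : ℝ≥0∞}

/-- The `L^p` norm of a signed sum of normalized functions supported in disjoint shells. -/
theorem eLpNorm_signedSum_le {μ : Measure Plane} {N : ℕ} {g : ℕ → Plane → ℂ}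
    {r : ℕ → ℝ} {A : ℕ → Set Plane} {C : ℝ} (hp : 1 ≤ p) (hr : ∀ k, 0 < r k) (hC : 0 < C)
    (hg : ∀ k ξ, ‖g k ξ‖ ≤ r k ^ (-p⁻¹.toReal)) (hA : ∀ k ξ, g k ξ ≠ 0 → ξ ∈ A k)
    (hAm : ∀ k, MeasurableSet (A k)) (hμ : ∀ k, μ (A k) ≤ ENNReal.ofReal (C * r k))
    (hdisj : ∀ ξ, ∀ j ∈ Finset.range N, ∀ k ∈ Finset.range N, g j ξ ≠ 0 → g k ξ ≠ 0 → j = k)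
    (s : Finset ℕ) :
    eLpNorm (fun ξ => signedSum N (fun k => g k ξ) s) p μ ≤
      ENNReal.ofReal ((C * N) ^ p⁻¹.toReal) := by
  have hp0 : p ≠ 0 := (zero_lt_one.trans_le hp).ne'
  rcases eq_or_ne p ∞ with rfl | hpt
  · simp only [ENNReal.inv_top, ENNReal.toReal_zero, Real.rpow_zero, neg_zero] at hg ⊢
    refine (eLpNorm_le_measure_rpow (A := univ) (fun ξ _ => mem_univ ξ) (fun ξ => ?_) ∞).trans_eq
      (by simp)
    rcases norm_signedSum_of_disjoint s (hdisj ξ) with h0 | ⟨k, _, _, hk⟩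
    · rw [h0, norm_zero]; exact zero_le_one
    · rw [hk]; exact hg k ξ
  · have hP : 0 < p.toReal := ENNReal.toReal_pos hp0 hpt
    rw [eLpNorm_eq_lintegral_rpow_enorm_toReal hp0 hpt, ENNReal.toReal_inv, one_div,
      ENNReal.rpow_inv_le_iff hP, ENNReal.ofReal_rpow_of_nonneg (by positivity) hP.le,
      ← Real.rpow_mul (by positivity), inv_mul_cancel₀ hP.ne', Real.rpow_one]
    -- At each point at most one term is nonzero, with p-th power at most 1/r_k on a set of measure
    -- at most C·r_k. Every scale thus contributes at most C.
    calc ∫⁻ ξ, ‖signedSum N (fun k => g k ξ) s‖ₑ ^ p.toReal ∂μ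
        ≤ ∫⁻ ξ, ∑ k ∈ Finset.range N, (A k).indicator
            (fun _ => ENNReal.ofReal (r k)⁻¹) ξ ∂μ := by
          refine lintegral_mono fun ξ => ?_
          rcases norm_signedSum_of_disjoint s (hdisj ξ) with h0 | ⟨k, hk, hk0, hkn⟩
          · simp [h0, hP]
          · refine le_trans ?_ (Finset.single_le_sum (f := fun k => (A k).indicator
              (fun _ => ENNReal.ofReal (r k)⁻¹) ξ) (fun _ _ => zero_le) hk)
            simp only
            rw [indicator_of_mem (hA k ξ hk0), enorm_rpow_eq_ofReal _ hP.le, hkn]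
            refine ENNReal.ofReal_le_ofReal ?_
            refine (Real.rpow_le_rpow (norm_nonneg _) (hg k ξ) hP.le).trans_eq ?_
            rw [← Real.rpow_mul (hr k).le, ENNReal.toReal_inv, neg_mul, inv_mul_cancel₀ hP.ne',
              Real.rpow_neg_one]
      _ = ∑ k ∈ Finset.range N, ENNReal.ofReal (r k)⁻¹ * μ (A k) := by
          rw [lintegral_finsetSum _ fun k _ => measurable_const.indicator (hAm k)]
          refine Finset.sum_congr rfl fun k _ => ?_
          rw [lintegral_indicator (hAm k), setLIntegral_const]
      _ ≤ ∑ k ∈ Finset.range N, ENNReal.ofReal C := by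
          refine Finset.sum_le_sum fun k _ => ?_
          refine (mul_le_mul_right (hμ k) _).trans_eq ?_
          rw [← ENNReal.ofReal_mul (inv_nonneg.2 (hr k).le)]
          congr 1
          have := (hr k).ne'
          field_simp
      _ = ENNReal.ofReal (C * N) := by
          rw [Finset.sum_const, Finset.card_range, nsmul_eq_mul, ENNReal.ofReal_mul hC.le,
            ENNReal.ofReal_natCast, mul_comm]

/-- A superposition of Knapp examples at many scales, with random signs, rules out the endpoint
for `q < p` in the non-transversal case. -/
theorem StripEstimateAt.ne_of_lt {t : ℝ} (h : StripEstimateAt Γ ω p q t) (hω : ‖ω‖ = 1)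
    (hp : 1 ≤ p) (hq : 1 ≤ q) (hqp : q < p) {s₀ : ℝ} (hs₀ : s₀ ∈ Icc Γ.a Γ.b)
    (h0 : inner ℝ (rot (deriv Γ.γ s₀)) ω = 0) : p⁻¹.toReal + 2 / q.toReal ≠ 1 := by
  intro hline
  have hqt : q ≠ ∞ := hqp.ne_top
  have hQ := one_le_toReal hq hqt
  obtain ⟨K, hK, hcurve⟩ := CompactC2Curve.exists_abs_inner_rot_sub_le_sq hω hs₀ h0
  obtain ⟨D, hD, hest⟩ := h.exists_squareFunction_le hq hqt
  obtain ⟨M, c, r₀, hM, hc, hr₀, hbump⟩ := CompactC2Curve.exists_annular_bumps hs₀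
  obtain ⟨C, hC, hup⟩ := Γ.exists_arcLength_closedBall_le s₀
  have hxQ : p⁻¹.toReal * q.toReal < 1 := by
    have h1 : p⁻¹.toReal < q⁻¹.toReal :=
      (ENNReal.toReal_lt_toReal (ENNReal.inv_ne_top.2 (zero_lt_one.trans_le hp).ne')
        (ENNReal.inv_ne_top.2 (zero_lt_one.trans_le hq).ne')).2 (ENNReal.inv_lt_inv.2 hqp)
    rw [ENNReal.toReal_inv q] at h1
    have := mul_lt_mul_of_pos_right h1 (show 0 < q.toReal by linarith)
    rwa [inv_mul_cancel₀ (by linarith)] at this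
  set Q := q.toReal
  have hx : 0 ≤ p⁻¹.toReal := ENNReal.toReal_nonneg
  have hQ0 : 0 < Q := by linarith
  have hM0 : 0 < M := by linarith
  set r₁ := min r₀ (1 / (12 * (|t| + 1))) with hr₁
  have hr₁0 : 0 < r₁ := lt_min hr₀ (by positivity)
  -- The bump at scale r_k lives where r_k/M < |ξ - γ(s₀)| < r_k; the ratio M makes these shells
  -- disjoint.
  set r : ℕ → ℝ := fun k => r₁ / M ^ k with hr
  have hrpos : ∀ k, 0 < r k := fun k => by positivity
  have hrle : ∀ k, r k ≤ r₁ := fun k => div_le_self hr₁0.le (one_le_pow₀ hM.le)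
  have hrt : ∀ k, (|t| + 1) * r k ≤ 1 / 12 := fun k => by
    have := (hrle k).trans (min_le_right _ _)
    rw [le_div_iff₀ (by positivity)] at this
    linarith
  have hrlt : ∀ j k, j < k → r k ≤ r j / M := fun j k hjk => by
    simp only [hr]
    rw [div_div, ← pow_succ]
    gcongr
    · exact hM.le
    · omega
  choose! φ f h1 h2 h3 h4 h5 using fun k => hbump (r k) (hrpos k) ((hrle k).trans (min_le_left _ _))
  set g : ℕ → SchwartzMap Plane ℂ := fun k => ((r k ^ (-p⁻¹.toReal) : ℝ) : ℂ) • f k with hg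
  have hgφ : ∀ k ξ, g k ξ = ((r k ^ (-p⁻¹.toReal) * φ k ξ : ℝ) : ℂ) := fun k ξ => by
    simp [hg, h1]
  have hg0 : ∀ k ξ, g k ξ ≠ 0 → φ k ξ ≠ 0 := fun k ξ hξ h0 => hξ (by rw [hgφ, h0]; simp)
  have hrp : ∀ k, 0 < r k ^ (-p⁻¹.toReal) := fun k => Real.rpow_pos_of_pos (hrpos k) _
  have hdisj : ∀ ξ (N : ℕ), ∀ j ∈ Finset.range N, ∀ k ∈ Finset.range N, g j ξ ≠ 0 → g k ξ ≠ 0 →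
      j = k := by
    have key : ∀ ξ j k, j < k → g j ξ ≠ 0 → g k ξ ≠ 0 → False := fun ξ j k hjk hj hk => by
      have e1 := (h4 j ξ (hg0 j ξ hj)).1
      have e2 := (h4 k ξ (hg0 k ξ hk)).2
      linarith [hrlt j k hjk]
    intro ξ N j _ k _ hj hk
    rcases lt_trichotomy j k with hjk | hjk | hjk
    · exact (key ξ j k hjk hj hk).elim
    · exact hjk
    · exact (key ξ k j hjk hk hj).elim
  set η := (12 * K)⁻¹ with hη
  have hη0 : 0 < η := by positivity
  -- The contribution of a single scale, independent of k: the q-th power of the extension is at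
  -- least of order r_k², on an interval of s of length of order r_k^{-2}. The factor 1 - M^{-2}
  -- comes from discarding small s, which makes the intervals of different scales disjoint.
  set v := (c / 2) ^ Q * (η * (1 - (M ^ 2)⁻¹)) with hv
  have hM2 : (M ^ 2)⁻¹ < 1 := inv_lt_one_of_one_lt₀ (one_lt_pow₀ hM two_ne_zero)
  have hv0 : 0 < v := mul_pos (by positivity) (mul_pos hη0 (by linarith))
  -- The N scales add up to Nv, while the q-th power of the norm of a signed sum is O(N^{q/p}).
  -- Since q < p, this fails for large N.
  refine not_forall_natCast_mul_rpow_le (A := v) (B := D * (C ^ p⁻¹.toReal) ^ Q)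
    (α := 1 - p⁻¹.toReal * Q) hv0 (by linarith) 1 fun N hN => ?_
  have hN0 : 0 < (N : ℝ) := by exact_mod_cast hN
  have hest' := hest N g ((C * N) ^ p⁻¹.toReal) (by positivity) fun s =>
    eLpNorm_signedSum_le (C := C) (r := r) (A := fun k => Metric.closedBall (Γ.γ s₀) (r k))
      hp hrpos hC (fun k ξ => by
        rw [hgφ, Complex.norm_real, Real.norm_of_nonneg (mul_nonneg (hrp k).le (h2 k ξ))]
        exact mul_le_of_le_one_right (hrp k).le (h3 k ξ))
      (fun k ξ hξ => by
        rw [Metric.mem_closedBall, dist_eq_norm]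
        exact (h4 k ξ (hg0 k ξ hξ)).2.le)
      (fun k => Metric.isClosed_closedBall.measurableSet) (fun k => hup _ (hrpos k))
      (fun ξ => hdisj ξ N) s
  have hFm : Measurable fun x => ENNReal.ofReal
      ((∑ k ∈ Finset.range N, ‖Γ.extension (g k) x‖ ^ 2) ^ (Q / 2)) := by
    refine Measurable.ennreal_ofReal (Measurable.pow_const ?_ _)
    exact Finset.measurable_fun_sum _ fun k _ =>
      ((CompactC2Curve.continuous_extension (g k)).norm.measurable).pow_const 2
  have hlower := sum_mul_volume_le_setLIntegral_strip hω t hFm (Finset.range N)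
    (fun k => Ioc (η / r k ^ 2 / M ^ 2) (η / r k ^ 2))
    (fun k => ENNReal.ofReal ((c / 2) ^ Q * r k ^ 2)) (fun k _ => measurableSet_Ioc) ?_ ?_
  · have hval : ∀ k, ENNReal.ofReal ((c / 2) ^ Q * r k ^ 2) *
        volume (Ioc (η / r k ^ 2 / M ^ 2) (η / r k ^ 2)) = ENNReal.ofReal v := fun k => by
      rw [Real.volume_Ioc, ← ENNReal.ofReal_mul (by positivity)]
      congr 1
      have := (hrpos k).ne'
      rw [hv]
      field_simp
    simp only [hval] at hlower
    rw [Finset.sum_const, Finset.card_range, nsmul_eq_mul, ← ENNReal.ofReal_natCast,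
      ← ENNReal.ofReal_mul hN0.le] at hlower
    have hreal := (ENNReal.ofReal_le_ofReal_iff (by positivity)).1 (hlower.trans hest')
    rw [Real.mul_rpow hC.le hN0.le, Real.mul_rpow (by positivity) (by positivity),
      ← Real.rpow_mul hN0.le, ← mul_assoc] at hreal
    rw [Real.rpow_sub hN0, Real.rpow_one, ← mul_div_assoc, div_le_iff₀ (by positivity)]
    linarith
  · have key : ∀ j k, j < k → Disjoint (Ioc (η / r j ^ 2 / M ^ 2) (η / r j ^ 2))
        (Ioc (η / r k ^ 2 / M ^ 2) (η / r k ^ 2)) := fun j k hjk => by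
      have hle : η / r j ^ 2 ≤ η / r k ^ 2 / M ^ 2 := by
        rw [div_div, ← mul_pow]
        refine div_le_div_of_nonneg_left hη0.le (by have := hrpos k; positivity) ?_
        have := hrlt j k hjk
        rw [le_div_iff₀ hM0] at this
        have := hrpos k
        gcongr
      rw [Set.disjoint_left]
      intro a ha hb
      linarith [ha.2, hb.1]
    intro j _ k _ hjk
    rcases lt_or_gt_of_ne hjk with hjk | hjk
    · exact key j k hjk
    · exact (key k j hjk).symm
  · intro k hk t' ht' s hs
    refine ENNReal.ofReal_le_ofReal ?_
    have hs0 : 0 ≤ s := le_trans (by have := hrpos k; positivity) hs.1.le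
    have hE : r k ^ (-p⁻¹.toReal) * (c * r k / 2) ≤ ‖Γ.extension (g k) (t' • ω + s • rot ω)‖ := by
      refine le_trans ?_ (CompactC2Curve.norm_extension_ge_of_support (hgφ k)
        (fun ξ => mul_nonneg (hrp k).le (h2 k ξ)) hω (hrpos k) hK hcurve
        (fun ξ hξ => (h4 k ξ (right_ne_zero_of_mul hξ)).2) (hrt k) ht'
        (by rw [abs_of_nonneg hs0]; exact hs.2))
      rw [integral_const_mul]
      have h6 := mul_le_mul_of_nonneg_left (h5 k) (hrp k).le
      linarith
    have hexp : (c / 2) ^ Q * r k ^ 2 = (r k ^ (-p⁻¹.toReal) * (c * r k / 2)) ^ Q := by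
      have e1 : r k ^ (-p⁻¹.toReal) * (c * r k / 2) = c / 2 * r k ^ (1 - p⁻¹.toReal) := by
        rw [show 1 - p⁻¹.toReal = -p⁻¹.toReal + 1 by ring, Real.rpow_add (hrpos k), Real.rpow_one]
        ring
      -- The endpoint equation 1/p + 2/q = 1 enters here and makes the contributions of all scales
      -- equal.
      have e2 : (1 - p⁻¹.toReal) * Q = 2 := by
        rw [← hline]; field_simp; ring
      rw [e1, Real.mul_rpow (by positivity) (Real.rpow_nonneg (hrpos k).le _),
        ← Real.rpow_mul (hrpos k).le, e2, Real.rpow_two]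
    rw [hexp]
    have hpos : 0 ≤ r k ^ (-p⁻¹.toReal) * (c * r k / 2) :=
      mul_nonneg (hrp k).le (by have := hrpos k; positivity)
    calc (r k ^ (-p⁻¹.toReal) * (c * r k / 2)) ^ Q
        ≤ ‖Γ.extension (g k) (t' • ω + s • rot ω)‖ ^ Q := Real.rpow_le_rpow hpos hE hQ0.le
      _ = (‖Γ.extension (g k) (t' • ω + s • rot ω)‖ ^ 2) ^ (Q / 2) := by
          rw [← Real.rpow_natCast, ← Real.rpow_mul (norm_nonneg _)]
          congr 1; push_cast; ring
      _ ≤ _ := by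
          gcongr
          exact Finset.single_le_sum
            (f := fun k => ‖Γ.extension (g k) (t' • ω + s • rot ω)‖ ^ 2)
            (fun _ _ => by positivity) hk

theorem StripEstimateAt.condition_of_transversal {t : ℝ} (h : StripEstimateAt Γ ω p q t)
    (hω : ‖ω‖ = 1) (ht : Γ.Transversal ω) (hp : 1 ≤ p) (hq : 1 ≤ q) :
    1 / p + 1 / q ≤ 1 ∧ 2 ≤ q := by
  rcases eq_or_ne q ∞ with rfl | hqt
  · simpa using hp
  · refine ⟨?_, ?_⟩
    · have := (one_div_add_div_le_one_iff hp hq hqt 1).2 (by simpa using h.knapp_one hω hq hqt)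
      simpa using this
    · have := h.two_le_of_transversal hω ht hq hqt
      rw [← ENNReal.ofReal_toReal hqt]
      simpa using ENNReal.ofReal_le_ofReal this

theorem StripEstimateAt.condition_of_not_transversal {t : ℝ} (h : StripEstimateAt Γ ω p q t)
    (hω : ‖ω‖ = 1) (ht : ¬ Γ.Transversal ω) (hp : 1 ≤ p) (hq : 1 ≤ q) :
    (p ≤ q → 1 / p + 2 / q ≤ 1) ∧ (q < p → 1 / p + 2 / q < 1) := by
  rcases eq_or_ne q ∞ with rfl | hqt
  · simpa using hp
  simp only [CompactC2Curve.Transversal, not_forall] at ht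
  obtain ⟨s₀, hs₀, hn⟩ := ht
  have h0 : inner ℝ (rot (deriv Γ.γ s₀)) ω = 0 := by
    by_contra hne
    exact hn ((CompactC2Curve.inner_normal_ne_zero_iff hs₀).2 hne)
  have hk := h.knapp_two hω hq hqt hs₀ h0
  refine ⟨fun _ => ?_, fun hqp => ?_⟩
  · exact_mod_cast (one_div_add_div_le_one_iff hp hq hqt 2).2 (by exact_mod_cast hk)
  · have := lt_of_le_of_ne hk (h.ne_of_lt hω hp hq hqp hs₀ h0)
    exact_mod_cast (one_div_add_div_lt_one_iff hp hq hqt 2).2 (by exact_mod_cast this)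

end

/-! ### The equivalences -/

theorem theorem1 (Γ : CompactC2Curve)
    (hcurv : ∀ s ∈ Set.Icc Γ.a Γ.b, Γ.curvature s ≠ 0)
    (ω : Plane) (hω : ‖ω‖ = 1)
    (p q : ℝ≥0∞) (hp : 1 ≤ p) (hq : 1 ≤ q) :
    (Γ.Transversal ω →
      (StripEstimate Γ ω p q ↔ (1 / p + 1 / q ≤ 1 ∧ 2 ≤ q)) ∧
      (∀ t : ℝ, StripEstimateAt Γ ω p q t ↔ (1 / p + 1 / q ≤ 1 ∧ 2 ≤ q)) ∧
      (RadonEstimate Γ ω p q ↔ (1 / p + 1 / q ≤ 1 ∧ 2 ≤ q))) ∧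
    (¬ Γ.Transversal ω →
      (StripEstimate Γ ω p q ↔
        ((p ≤ q → 1 / p + 2 / q ≤ 1) ∧ (q < p → 1 / p + 2 / q < 1))) ∧
      (∀ t : ℝ, StripEstimateAt Γ ω p q t ↔
        ((p ≤ q → 1 / p + 2 / q ≤ 1) ∧ (q < p → 1 / p + 2 / q < 1))) ∧
      (RadonEstimate Γ ω p q ↔
        ((p ≤ q → 1 / p + 2 / q ≤ 1) ∧ (q < p → 1 / p + 2 / q < 1)))) := by
  -- All equivalences follow from one cycle: the exponent condition gives (R), which gives (S),
  -- which gives (S) on a single strip, which gives back the condition. Where the uniform estimates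
  -- are specialized, t = 0 is an arbitrary choice.
  have key : ∀ P : Prop, (P → RadonEstimate Γ ω p q) →
      (∀ t, StripEstimateAt Γ ω p q t → P) →
      (StripEstimate Γ ω p q ↔ P) ∧ (∀ t : ℝ, StripEstimateAt Γ ω p q t ↔ P) ∧
        (RadonEstimate Γ ω p q ↔ P) := by
    intro P hsuff hnec
    have hRS := fun h : RadonEstimate Γ ω p q => h.stripEstimate hω hp hq
    exact ⟨⟨fun h => hnec 0 (h.stripEstimateAt 0), fun h => hRS (hsuff h)⟩,
      fun t => ⟨hnec t, fun h => (hRS (hsuff h)).stripEstimateAt t⟩,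
      ⟨fun h => hnec 0 ((hRS h).stripEstimateAt 0), hsuff⟩⟩
  exact ⟨fun ht => key _ (fun h => radonEstimate_of_transversal ht hp hq h.1 h.2)
      fun t h => h.condition_of_transversal hω ht hp hq,
    fun ht => key _ (fun h => radonEstimate_of_curvature_ne_zero hω hcurv hp hq h)
      fun t h => h.condition_of_not_transversal hω ht hp hq⟩
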